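/- Let $d\ge 2$ and $k\ge 1$ be integers, and let $V=V_0+V_1\ge 0$ be a real polynomial on $\mathbb R^d$, where $V_0$ is homogeneous of degree $2k$ with $V_0(x)>0$ for $x\ne 0$, and $V_1$ has degree at most $2k-1$. Let $(\varphi_j)_{j\ge 0}$ be an orthonormal basis of $L^2(\mathbb R^d)$ consisting of eigenfunctions of $\hat H=-\Delta+V$, $\hat H\varphi_j=\lambda_j\varphi_j$, with $(\lambda_j)$ nondecreasing. For $s\ge 0$ let $\mathcal H_k^s=\{u\in L^2(\mathbb R^d):\hat H^{\frac{k+1}{2k}s}u\in L^2(\mathbb R^d)\}$, let $H^\sigma$ be the usual Sobolev space, the domain of $(-\Delta)^{\sigma/2}$, and let $L^2(\mathbb R^d,|x|^{a}dx)$ be the space of functions $f$ with $\int|f(x)|^2|x|^{a}dx<\infty$. Let $(X_j)_{j\ge 0}$ be i.i.d. real or complex random variables ($\mathbb K=\mathbb R$ or $\mathbb C$) with $\mathbb E X_j=0$ and $\mathbb E|X_j|^2=1$, whose common law $\nu$ satisfies the concentration of measure property: there are $c,C>0$ such that for all $N$, all convex $F:\mathbb K^N\to\mathbb R$ that are $L$-Lipschitz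 ($L>0$) for the $\ell^2$ norm, and all $r>0$, $$\nu^{\otimes N}\big[\,|F-\mathbb E F|\ge r\,\big]\le c\,e^{-Cr^2/L^2}.$$ Let $(\gamma_j)_{j\ge 0}$ be complex numbers such that $v_\gamma=\sum_j\gamma_j\varphi_j$ converges in $\mathcal S'(\mathbb R^d)$. If $s\ge 0$ and $v_\gamma\notin\mathcal H_k^s(\mathbb R^d)$, then almost surely the series $v_\gamma^\omega=\sum_j\gamma_jX_j(\omega)\varphi_j$ converges in $\mathcal S'(\mathbb R^d)$, $v_\gamma^\omega\notin H^{\frac{k+1}{k}s}(\mathbb R^d)$, and $v_\gamma^\omega\notin L^2(\mathbb R^d,|x|^{2(k+1)s}dx)$, that is, $|x|^{(k+1)s}v_\gamma^\omega\notin L^2(\mathbb R^d)$. -/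

import Mathlib

open MeasureTheory ProbabilityTheory Filter Topology
open scoped ENNReal NNReal SchwartzMap Laplacian

noncomputable section

namespace RandomSmoothing

/-- Euclidean space `ℝ^d`. -/
abbrev Space (d : ℕ) : Type := EuclideanSpace ℝ (Fin d)

/-- The complex Hilbert space `L²(ℝ^d)`. -/
abbrev L2 (d : ℕ) : Type := Lp ℂ 2 (volume : Measure (Space d))

/-- The polynomial function on `ℝ^d` given by a polynomial in `d` variables. -/
def polyFun {d : ℕ} (V : MvPolynomial (Fin d) ℝ) (x : Space d) : ℝ :=
  MvPolynomial.eval (fun i => x i) V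

/-- `V` is a nonnegative elliptic polynomial of degree `2k`: `V = V₀ + V₁`, where `V₀` is homogeneous
of degree `2k` and positive away from the origin and `V₁` has degree at most `2k - 1`. -/
structure IsEllipticPotential {d : ℕ} (k : ℕ) (V : MvPolynomial (Fin d) ℝ) : Prop where
  elliptic : ∃ V₀ V₁ : MvPolynomial (Fin d) ℝ, V = V₀ + V₁ ∧ V₀.IsHomogeneous (2 * k) ∧
    (∀ x : Space d, x ≠ 0 → 0 < polyFun V₀ x) ∧ V₁.totalDegree ≤ 2 * k - 1
  nonneg : ∀ x : Space d, 0 ≤ polyFun V x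

/-- Polynomials have temperate growth, so that multiplication by `V` (`smulLeftCLM` below) is a
genuine operator on tempered distributions. -/
theorem polyFun_hasTemperateGrowth {d : ℕ} (V : MvPolynomial (Fin d) ℝ) :
    Function.HasTemperateGrowth (fun x : Space d => (polyFun V x : ℂ)) := by
  induction V using MvPolynomial.induction_on with
  | C a =>
    simp only [polyFun, MvPolynomial.eval_C]
    fun_prop
  | add p q hp hq =>
    simp only [polyFun, map_add, Complex.ofReal_add] at hp hq ⊢
    exact hp.add hq
  | mul_X p i hp =>
    have hi : Function.HasTemperateGrowth (fun x : Space d => ((x i : ℝ) : ℂ)) :=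
      (Complex.ofRealCLM.comp
        (EuclideanSpace.proj i : Space d →L[ℝ] ℝ)).hasTemperateGrowth
    simp only [polyFun, map_mul, MvPolynomial.eval_X, Complex.ofReal_mul] at hp ⊢
    exact hp.mul hi

/-- The Schrödinger operator `-Δ + V` acting on tempered distributions. -/
def schrodinger {d : ℕ} (V : MvPolynomial (Fin d) ℝ) (T : 𝓢'(Space d, ℂ)) : 𝓢'(Space d, ℂ) :=
  -(Δ T) + TemperedDistribution.smulLeftCLM ℂ (fun x : Space d => (polyFun V x : ℂ)) T

/-- `φ` is an orthonormal (Hilbert) basis of `L²(ℝ^d)` made of eigenfunctions of `-Δ + V`, with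
the nondecreasing sequence of eigenvalues `lam`. The self-adjoint realisation has domain
`{u ∈ L² : -Δu + Vu ∈ L²}`, so an `L²` function is an eigenfunction iff the equation holds in the
sense of tempered distributions. -/
structure IsEigenbasis {d : ℕ} (V : MvPolynomial (Fin d) ℝ) (φ : HilbertBasis ℕ ℂ (L2 d))
    (lam : ℕ → ℝ) : Prop where
  mono : Monotone lam
  eigen : ∀ j, schrodinger V (φ j : 𝓢'(Space d, ℂ)) = (lam j : ℂ) • (φ j : 𝓢'(Space d, ℂ))

/-- `w = H ^ α u`, for the self-adjoint operator `H` on `L²(ℝ^d)` which is diagonal in the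
orthonormal basis `φ` with eigenvalues `lam`. -/
def IsPowApply {d : ℕ} (φ : HilbertBasis ℕ ℂ (L2 d)) (lam : ℕ → ℝ) (α : ℝ) (u w : L2 d) : Prop :=
  ∀ j, inner ℂ (φ j) w = ((lam j ^ α : ℝ) : ℂ) * inner ℂ (φ j) u

/-- The tempered distribution `T` belongs to the Sobolev space
`𝓗_k^s = {u ∈ L² : (H ^ ((k+1)/(2k))) ^ s u ∈ L²}`, the domain of `H ^ ((k+1)s/(2k))`. -/
def MemHk {d : ℕ} (k : ℕ) (φ : HilbertBasis ℕ ℂ (L2 d)) (lam : ℕ → ℝ) (s : ℝ)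
    (T : 𝓢'(Space d, ℂ)) : Prop :=
  ∃ u w : L2 d, T = (u : 𝓢'(Space d, ℂ)) ∧
    IsPowApply φ lam (((k : ℝ) + 1) / (2 * (k : ℝ)) * s) u w

/-- The tempered distribution `T` is (integration against) a function `f` with
`∫ |f(x)|² |x|^a dx < ∞`, i.e. `T ∈ L²(ℝ^d, |x|^a dx)`. -/
def MemWeightedL2 {d : ℕ} (a : ℝ) (T : 𝓢'(Space d, ℂ)) : Prop :=
  ∃ f : Space d → ℂ, AEStronglyMeasurable f volume ∧
    (∀ g : 𝓢(Space d, ℂ), Integrable (fun x => g x * f x) volume ∧ T g = ∫ x, g x * f x) ∧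
    Integrable (fun x => ‖f x‖ ^ 2 * ‖x‖ ^ a) volume

/-- `T = ∑_j c_j φ_j`, the series converging in the space of tempered distributions. -/
def IsSeriesSum {d : ℕ} (φ : HilbertBasis ℕ ℂ (L2 d)) (c : ℕ → ℂ) (T : 𝓢'(Space d, ℂ)) : Prop :=
  Tendsto (fun n : ℕ => ∑ j ∈ Finset.range n, c j • (φ j : 𝓢'(Space d, ℂ))) atTop (𝓝 T)

/-- The (convex, Gaussian) concentration of measure property of a probability measure `ν` on `𝕂`
(`ℝ` or `ℂ`): there are constants `c, C > 0` such that for all `N` and every convex `F : 𝕂^N → ℝ`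
which is `L`-Lipschitz for the `ℓ²` norm,
`ν^{⊗N} (|F - E F| ≥ r) ≤ c exp (-C r² / L²)` for all `r > 0`. -/
def ConcentrationProperty {𝕂 : Type*} [RCLike 𝕂] (ν : Measure 𝕂) : Prop :=
  ∃ c C : ℝ, 0 < c ∧ 0 < C ∧ ∀ (N : ℕ) (F : EuclideanSpace 𝕂 (Fin N) → ℝ) (L : ℝ≥0), 0 < L →
    LipschitzWith L F → ConvexOn ℝ Set.univ F → ∀ r : ℝ, 0 < r →
      (Measure.pi fun _ : Fin N => ν)
          {x | r ≤ |F (WithLp.toLp 2 x) -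
            ∫ y, F (WithLp.toLp 2 y) ∂(Measure.pi fun _ : Fin N => ν)|}
        ≤ ENNReal.ofReal (c * Real.exp (-(C * r ^ 2 / (L : ℝ) ^ 2)))

end RandomSmoothing

end

/-! Let `A` be either the Bessel potential of order σ = (k+1)s/k or multiplication by a smooth
weight of size |x|^((k+1)s) at infinity. Membership of the random series in the Sobolev space,
respectively in the weighted space, forces its image under `A` to lie in L². In the basis `φ` the
m-th coordinate of that image is ∑_j c_jm X_j with c_jm = γ_j ⟨φ_m, A φ_j⟩, and by Parseval ∑_{j,m}
|c_jm|² = ∑_j |γ_j|² ‖A φ_j‖². Two facts are needed: this sum diverges, and divergence forces the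
random vector almost surely out of ℓ².

Divergence. Since v is not in 𝓗_k^s, the lower bound ‖A φ_j‖² ≥ c λ_j^σ for large λ_j suffices
(`not_summable_of_not_memHk`). The virial identity makes the kinetic and the potential energy of φ_j
both at least c λ_j - C, while ‖Δφ_j‖² and ‖Vφ_j‖² are at most C (1 + λ_j)²
(`exists_energy_bounds`). The Paley–Zygmund inequality, for the densities |𝓕φ_j|² and |φ_j|², then
places a fixed share of the mass at frequencies |ξ| ≥ c √λ_j and at positions |x| ≥ c λ_j^(1/(2k))
(`exists_le_fourier_mass`, `exists_le_mass`). Both weights have size λ_j^σ there. The integrations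
by parts need φ_j to be Schwartz (`exists_schwartz_eigenfunction`), which follows from an Agmon
estimate with Gaussian regularisation and elliptic bootstrapping.

Randomness. The norm of a finite sum ∑ X_j a_j is a convex Lipschitz function of the X_j.
Concentration bounds its fourth moment by its squared second moment, so Paley–Zygmund gives a small
ball estimate with a universal constant (`ConcentrationProperty.exists_le_measure_norm_sq`). Hence
the partial sums blow up with positive probability, and Kolmogorov's zero-one law turns this into
probability one (`ConcentrationProperty.ae_not_summable`).

Convergence of the random series. Testing v against (1+H)^m g shows that γ_j φ_j(g) decays faster
than every power of λ_j. The λ_j grow at least like a power of j by a phase space count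
(`exists_index_le`), and almost surely |X_j| ≤ C (j+1). The sums therefore converge against each
test function, and the limit is a tempered distribution by the uniform boundedness principle
(`ae_exists_isSeriesSum`). -/

noncomputable section

/-! ### Completeness of Schwartz space and limits of tempered distributions. -/

namespace SchwartzMap

variable {E F : Type*} [NormedAddCommGroup E] [NormedSpace ℝ E] [NormedAddCommGroup F]
  [NormedSpace ℝ F] [CompleteSpace F]

/-- A series of Schwartz functions which converges absolutely for all Schwartz seminorms has a
Schwartz function as its pointwise sum. -/
theorem exists_tsum_of_summable_seminorm (h : ℕ → 𝓢(E, F))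
    (hs : ∀ k n, Summable fun i => SchwartzMap.seminorm ℝ k n (h i)) :
    ∃ G : 𝓢(E, F), (∀ x, G x = ∑' i, h i x) ∧
      ∀ k n, SchwartzMap.seminorm ℝ k n G ≤ ∑' i, SchwartzMap.seminorm ℝ k n (h i) := by
  have hc : ContDiff ℝ ((⊤ : ℕ∞) : WithTop ℕ∞) fun x => ∑' i, h i x :=
    contDiff_tsum (fun i => (h i).smooth ⊤) (fun k _ => hs 0 k)
      (fun k i x _ => norm_iteratedFDeriv_le_seminorm ℝ (h i) k x)
  have hb : ∀ k n x, ‖x‖ ^ k * ‖iteratedFDeriv ℝ n (fun x => ∑' i, h i x) x‖ ≤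
      ∑' i, SchwartzMap.seminorm ℝ k n (h i) := by
    intro k n x
    rw [iteratedFDeriv_tsum_apply (N := ⊤) (fun i => (h i).smooth ⊤) (fun k _ => hs 0 k)
      (fun k i x _ => norm_iteratedFDeriv_le_seminorm ℝ (h i) k x) le_top x]
    have hsn : Summable fun i => ‖iteratedFDeriv ℝ n (h i) x‖ :=
      Summable.of_nonneg_of_le (fun i => norm_nonneg _)
        (fun i => norm_iteratedFDeriv_le_seminorm ℝ (h i) n x) (hs 0 n)
    calc ‖x‖ ^ k * ‖∑' i, iteratedFDeriv ℝ n (h i) x‖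
        ≤ ‖x‖ ^ k * ∑' i, ‖iteratedFDeriv ℝ n (h i) x‖ := by
          gcongr; exact norm_tsum_le_tsum_norm hsn
      _ = ∑' i, ‖x‖ ^ k * ‖iteratedFDeriv ℝ n (h i) x‖ := tsum_mul_left.symm
      _ ≤ _ := (hsn.mul_left _).tsum_le_tsum (fun i => le_seminorm ℝ k n (h i) x) (hs k n)
  refine ⟨⟨_, hc, fun k n => ⟨_, hb k n⟩⟩, fun x => rfl, fun k n => ?_⟩
  exact seminorm_le_bound ℝ k n _ (tsum_nonneg fun i => apply_nonneg _ _) (hb k n)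

/-- The error after `M` terms is, up to sign, the sum of the shifted series, so each of its
seminorms is at most the tail of a convergent numerical series. -/
theorem exists_tendsto_sum_of_summable_seminorm (h : ℕ → 𝓢(E, F))
    (hs : ∀ k n, Summable fun i => SchwartzMap.seminorm ℝ k n (h i)) :
    ∃ G : 𝓢(E, F), Tendsto (fun M => ∑ i ∈ Finset.range M, h i) atTop (𝓝 G) := by
  obtain ⟨G, hG, -⟩ := exists_tsum_of_summable_seminorm h hs
  refine ⟨G, ?_⟩
  rw [(schwartz_withSeminorms ℝ E F).tendsto_nhds_atTop]
  rintro ⟨k, n⟩ ε hε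
  have ht := tendsto_sum_nat_add fun i => SchwartzMap.seminorm ℝ k n (h i)
  obtain ⟨M₀, hM₀⟩ := ((tendsto_order.1 ht).2 ε hε).exists_forall_of_atTop
  refine ⟨M₀, fun M hM => lt_of_le_of_lt ?_ (hM₀ M hM)⟩
  obtain ⟨G', hG', hle⟩ := exists_tsum_of_summable_seminorm (fun i => h (i + M))
    fun k n => (summable_nat_add_iff M).2 (hs k n)
  have hGG : (∑ i ∈ Finset.range M, h i) - G = -G' := by
    ext x
    have hsx : Summable fun i => h i x :=
      Summable.of_norm_bounded (hs 0 0) fun i => norm_le_seminorm ℝ (h i) x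
    have := hsx.sum_add_tsum_nat_add M
    simp only [sub_apply, sum_apply, neg_apply, hG, hG']
    rw [← this]
    abel
  rw [hGG, map_neg_eq_map]
  exact hle k n

instance instIsCountablyGeneratedUniformity : (uniformity 𝓢(E, F)).IsCountablyGenerated :=
  IsUniformAddGroup.uniformity_countably_generated

/-- Schwartz space is thereby a Baire space, hence barrelled, which is what the uniform boundedness
principle below requires. It suffices to treat sequences whose N-th increment is below 2^(-N) in `p
N`. A fixed seminorm `(k, n)` is dominated by `p N` only once N ≥ `max k n`, hence the shifts;
telescoping reduces the claim to absolutely convergent series. -/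
instance instCompleteSpace : CompleteSpace 𝓢(E, F) := by
  let p : ℕ → Seminorm ℝ 𝓢(E, F) :=
    fun N => (Finset.Iic (N, N)).sup (schwartzSeminormFamily ℝ E F)
  have hp : ∀ N, Continuous (p N) := fun N =>
    Finset.sup_induction (p := fun q : Seminorm ℝ 𝓢(E, F) => Continuous q)
      (by simpa using! continuous_const) (fun q hq r hr => hq.sup hr)
      (fun i _ => (schwartz_withSeminorms ℝ E F).continuous_seminorm i)
  refine UniformSpace.complete_of_convergent_controlled_sequences
    (fun N => {q | p N (q.2 - q.1) < (1 / 2) ^ N}) (fun N => ?_) (fun u hu => ?_)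
  · rw [uniformity_eq_comap_nhds_zero]
    refine ⟨{f | p N f < (1 / 2) ^ N}, ?_, fun q hq => hq⟩
    have h0 : p N 0 < (1 / 2) ^ N := by rw [map_zero]; positivity
    exact (isOpen_lt (hp N) continuous_const).mem_nhds h0
  · have hs : ∀ k n, Summable fun i => SchwartzMap.seminorm ℝ k n (u (i + 1) - u i) := by
      intro k n
      refine (summable_nat_add_iff (max k n)).1 ?_
      refine Summable.of_nonneg_of_le (fun i => apply_nonneg _ _) (fun i => ?_)
        ((summable_nat_add_iff (max k n)).2 (summable_geometric_two))
      have h1 : p (i + max k n) (u (i + max k n + 1) - u (i + max k n)) <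
          (1 / 2) ^ (i + max k n) := hu (i + max k n) _ _ le_rfl (Nat.le_succ _)
      refine le_trans ?_ h1.le
      have h2 : schwartzSeminormFamily ℝ E F (k, n) ≤ p (i + max k n) :=
        Finset.le_sup (f := schwartzSeminormFamily ℝ E F)
          (Finset.mem_Iic.2 (Prod.mk_le_mk.2 ⟨by omega, by omega⟩))
      exact h2 _
    obtain ⟨G, hG⟩ := exists_tendsto_sum_of_summable_seminorm _ hs
    refine ⟨G + u 0, ?_⟩
    have := hG.add_const (u 0)
    refine this.congr fun M => ?_
    rw [Finset.sum_range_sub, sub_add_cancel]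

end SchwartzMap

/-- A pointwise limit of a sequence of tempered distributions is a tempered distribution. -/
theorem TemperedDistribution.exists_tendsto_of_forall_tendsto {E : Type*} [NormedAddCommGroup E]
    [NormedSpace ℝ E] (T : ℕ → 𝓢'(E, ℂ))
    (h : ∀ g : 𝓢(E, ℂ), ∃ z : ℂ, Tendsto (fun n => T n g) atTop (𝓝 z)) :
    ∃ S : 𝓢'(E, ℂ), Tendsto T atTop (𝓝 S) := by
  choose f hf using h
  -- Tempered distributions carry the topology of pointwise convergence; they are repackaged as
  -- plain functionals so that Banach–Steinhaus applies.
  let T' : ℕ → 𝓢(E, ℂ) →L[ℂ] ℂ := fun n =>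
    { toFun := T n, map_add' := map_add _, map_smul' := map_smul _, cont := (T n).continuous }
  let S := continuousLinearMapOfTendsto T' (f := f) (tendsto_pi_nhds.2 hf)
  refine ⟨ContinuousLinearMap.toPointwiseConvergenceCLM _ _ _ _ S, ?_⟩
  rw [PointwiseConvergenceCLM.tendsto_iff_forall_tendsto]
  exact hf

/-! ### Paley–Zygmund, moments from tails, and second moments of random sums. -/

namespace RandomSmoothing

/-- The Paley–Zygmund inequality for the measure of density `ρ`. -/
theorem sq_le_mul_setIntegral_of_le_integral {α : Type*} [MeasurableSpace α] {μ : Measure α}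
    {f ρ : α → ℝ} (hf : Measurable f) (hρ : 0 ≤ ρ) (hρi : Integrable ρ μ)
    (hρ1 : ∫ x, ρ x ∂μ ≤ 1) (hfi : Integrable (fun x => f x * ρ x) μ)
    (hf2 : Integrable (fun x => f x ^ 2 * ρ x) μ) {A B : ℝ} (hA : 0 < A)
    (hAf : A ≤ ∫ x, f x * ρ x ∂μ) (hB : ∫ x, f x ^ 2 * ρ x ∂μ ≤ B) :
    A ^ 2 / 4 ≤ B * ∫ x in {x | A / 2 ≤ f x}, ρ x ∂μ := by
  set S := {x | A / 2 ≤ f x} with hS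
  have hSm : MeasurableSet S := measurableSet_le measurable_const hf
  have hI : ∫ x in S, ρ x ∂μ = ∫ x, S.indicator ρ x ∂μ := (integral_indicator hSm).symm
  -- Replaces Cauchy–Schwarz: on `S` use f ≤ θ f²/2 + 1/(2θ), off `S` use f ≤ A/2, and optimise in θ
  -- afterwards.
  have key : ∀ θ : ℝ, 0 < θ → A / 2 ≤ θ / 2 * B + 1 / (2 * θ) * ∫ x in S, ρ x ∂μ := by
    intro θ hθ
    have hle : ∫ x, f x * ρ x ∂μ ≤
        ∫ x, (A / 2 * ρ x + θ / 2 * (f x ^ 2 * ρ x) + 1 / (2 * θ) * S.indicator ρ x) ∂μ := by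
      refine integral_mono hfi (((hρi.const_mul _).add (hf2.const_mul _)).add
        ((hρi.indicator hSm).const_mul _)) fun x => ?_
      have h0 : 0 ≤ ρ x := hρ x
      by_cases hx : x ∈ S
      · simp only [Set.indicator_of_mem hx]
        have h1 : f x ≤ θ / 2 * f x ^ 2 + 1 / (2 * θ) := by
          have : 0 ≤ (θ * f x - 1) ^ 2 / (2 * θ) := by positivity
          have h2 : (θ * f x - 1) ^ 2 / (2 * θ) = θ / 2 * f x ^ 2 + 1 / (2 * θ) - f x := by
            field_simp; ring
          linarith
        nlinarith [mul_le_mul_of_nonneg_right h1 h0, mul_nonneg (half_pos hA).le h0]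
      · simp only [Set.indicator_of_notMem hx, mul_zero, add_zero]
        have h1 : f x ≤ A / 2 := (not_le.1 hx).le
        have h2 : 0 ≤ θ / 2 * (f x ^ 2 * ρ x) := by positivity
        nlinarith [mul_le_mul_of_nonneg_right h1 h0]
    have i1 : Integrable (fun x => A / 2 * ρ x + θ / 2 * (f x ^ 2 * ρ x)) μ :=
      (hρi.const_mul _).add (hf2.const_mul _)
    rw [integral_add i1 ((hρi.indicator hSm).const_mul _),
      integral_add (hρi.const_mul _) (hf2.const_mul _),
      integral_const_mul, integral_const_mul, integral_const_mul, ← hI] at hle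
    have h3 : A / 2 * ∫ x, ρ x ∂μ ≤ A / 2 := by nlinarith
    have h4 : θ / 2 * ∫ x, f x ^ 2 * ρ x ∂μ ≤ θ / 2 * B := by gcongr
    linarith
  have hs0 : 0 ≤ ∫ x in S, ρ x ∂μ := integral_nonneg hρ
  have hB0 : 0 ≤ B := le_trans (integral_nonneg fun x => mul_nonneg (sq_nonneg _) (hρ x)) hB
  rcases hB0.eq_or_lt with hB1 | hB1
  -- If B = 0 only the 1/(2θ) term is left, and a large θ makes it smaller than A/2.
  · exfalso
    have h1 := key ((∫ x in S, ρ x ∂μ) * 2 / A + 1) (by positivity)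
    rw [← hB1] at h1
    have h2 : 1 / (2 * ((∫ x in S, ρ x ∂μ) * 2 / A + 1)) * ∫ x in S, ρ x ∂μ < A / 2 := by
      rw [div_mul_eq_mul_div, div_lt_iff₀ (by positivity)]
      have : A / 2 * (2 * ((∫ x in S, ρ x ∂μ) * 2 / A + 1)) = (∫ x in S, ρ x ∂μ) * 2 + A := by
        field_simp
      rw [this]; linarith
    linarith
  -- This θ turns the quadratic term into A/4, half of the left side.
  · have h1 := key (A / (2 * B)) (by positivity)
    have h2 : A / (2 * B) / 2 * B = A / 4 := by field_simp; ring
    have h3 : 1 / (2 * (A / (2 * B))) = B / A := by field_simp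
    rw [h2, h3] at h1
    have h4 : A / 4 ≤ B / A * ∫ x in S, ρ x ∂μ := by linarith
    have h5 := mul_le_mul_of_nonneg_left h4 hA.le
    have h6 : A * (B / A * ∫ x in S, ρ x ∂μ) = B * ∫ x in S, ρ x ∂μ := by field_simp
    rw [h6] at h5
    linarith

/-- Gaussian tails bound the fourth moment, uniformly. -/
theorem exists_lintegral_pow_four_le_of_tail {c C : ℝ} (hC : 0 < C) :
    ∃ K : ℝ≥0∞, K ≠ ∞ ∧ ∀ {Ω : Type*} [MeasurableSpace Ω] (P : Measure Ω) (f : Ω → ℝ),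
      AEMeasurable f P → (∀ r : ℝ, 0 < r → P {ω | r ≤ |f ω|} ≤
        ENNReal.ofReal (c * Real.exp (-(C * r ^ 2)))) →
      ∫⁻ ω, ENNReal.ofReal (f ω ^ 4) ∂P ≤ K := by
  have hint : IntegrableOn (fun x : ℝ => c * (x ^ (3 : ℝ) * Real.exp (-C * x ^ 2)))
      (Set.Ioi 0) := (integrableOn_rpow_mul_exp_neg_mul_sq hC (by norm_num)).const_mul c
  refine ⟨ENNReal.ofReal 4 * ∫⁻ t in Set.Ioi (0 : ℝ),
    ENNReal.ofReal (c * (t ^ (3 : ℝ) * Real.exp (-C * t ^ 2))), ?_, ?_⟩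
  · exact ENNReal.mul_ne_top ENNReal.ofReal_ne_top hint.lintegral_lt_top.ne
  · intro Ω _ P f hf htail
    -- Layer cake formula: the fourth moment is 4 ∫ t³ P(|f| ≥ t) dt, so it depends on the tail
    -- bound alone.
    have h1 := lintegral_rpow_eq_lintegral_meas_le_mul P (f := fun ω => |f ω|)
      (Eventually.of_forall fun ω => abs_nonneg _) (continuous_abs.measurable.comp_aemeasurable hf) (p := 4) (by norm_num)
    have h2 : ∀ ω, |f ω| ^ (4 : ℝ) = f ω ^ 4 := by
      intro ω
      rw [show (4 : ℝ) = ((4 : ℕ) : ℝ) by norm_num, Real.rpow_natCast]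
      exact (Even.pow_abs (by decide) _)
    simp only [h2] at h1
    rw [h1]
    refine mul_le_mul' le_rfl ?_
    refine setLIntegral_mono' measurableSet_Ioi fun t ht => ?_
    have ht0 : (0 : ℝ) < t := ht
    calc P {a | t ≤ |f a|} * ENNReal.ofReal (t ^ ((4 : ℝ) - 1))
        ≤ ENNReal.ofReal (c * Real.exp (-(C * t ^ 2))) * ENNReal.ofReal (t ^ ((4 : ℝ) - 1)) := by
          gcongr; exact htail t ht0
      _ = _ := by
          rw [← ENNReal.ofReal_mul' (by positivity)]
          congr 1
          norm_num
          ring_nf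

section Series

variable {𝕂 : Type*} [RCLike 𝕂]

theorem norm_map_complex (x : 𝕂) : ‖RCLike.map 𝕂 ℂ x‖ = ‖x‖ := by
  rw [RCLike.map_apply, ← sq_eq_sq₀ (norm_nonneg _) (norm_nonneg _), ← RCLike.normSq_eq_def',
    ← RCLike.normSq_eq_def']
  simp [RCLike.normSq_apply]

variable {Ω : Type*} [MeasurableSpace Ω] {P : Measure Ω} {X : ℕ → Ω → 𝕂}

/-- The integral of a non-integrable function is 0 by convention, so the value 1 already contains
square integrability. -/
theorem memLp_two_of_integral_norm_sq (hXm : ∀ j, Measurable (X j))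
    (hX_var : ∀ j, ∫ ω, ‖X j ω‖ ^ 2 ∂P = 1) (j : ℕ) :
    MemLp (fun ω => RCLike.map 𝕂 ℂ (X j ω)) 2 P := by
  rw [memLp_two_iff_integrable_sq_norm
    (f := fun ω => RCLike.map 𝕂 ℂ (X j ω))
    ((RCLike.map 𝕂 ℂ).continuous.measurable.comp (hXm j)).aestronglyMeasurable]
  simp only [norm_map_complex]
  by_contra h
  have := hX_var j
  rw [integral_undef h] at this
  exact zero_ne_one this

theorem integral_conj_mul [IsProbabilityMeasure P] (hXm : ∀ j, Measurable (X j))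
    (hX_indep : iIndepFun X P)
    (hX_mean : ∀ j, ∫ ω, X j ω ∂P = 0) (hX_var : ∀ j, ∫ ω, ‖X j ω‖ ^ 2 ∂P = 1) (i j : ℕ) :
    ∫ ω, star (RCLike.map 𝕂 ℂ (X i ω)) * RCLike.map 𝕂 ℂ (X j ω) ∂P = if i = j then 1 else 0 := by
  have hYm : ∀ j, Measurable fun ω => RCLike.map 𝕂 ℂ (X j ω) := fun j =>
    (RCLike.map 𝕂 ℂ).continuous.measurable.comp (hXm j)
  split_ifs with h
  · subst h
    have h1 : ∀ ω, star (RCLike.map 𝕂 ℂ (X i ω)) * RCLike.map 𝕂 ℂ (X i ω) =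
        ((‖X i ω‖ ^ 2 : ℝ) : ℂ) := by
      intro ω
      rw [← norm_map_complex, ← Complex.normSq_eq_norm_sq, Complex.normSq_eq_conj_mul_self]
      rfl
    simp only [h1]
    rw [integral_complex_ofReal, hX_var]
    simp
  · have hXi : Integrable (X j) P := by
      have := (memLp_two_of_integral_norm_sq hXm hX_var j).integrable (by norm_num)
      refine ⟨(hXm j).aestronglyMeasurable, ?_⟩
      have h2 := this.2
      rw [hasFiniteIntegral_iff_norm] at h2 ⊢
      simpa only [norm_map_complex] using h2
    have hind : IndepFun (fun ω => star (RCLike.map 𝕂 ℂ (X i ω)))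
        (fun ω => RCLike.map 𝕂 ℂ (X j ω)) P :=
      (hX_indep.indepFun h).comp (φ := fun x => star (RCLike.map 𝕂 ℂ x))
        (ψ := fun x => RCLike.map 𝕂 ℂ x)
        (continuous_star.comp (RCLike.map 𝕂 ℂ).continuous).measurable
        (RCLike.map 𝕂 ℂ).continuous.measurable
    rw [hind.integral_fun_mul_eq_mul_integral
      (continuous_star.measurable.comp (hYm i)).aestronglyMeasurable
      (hYm j).aestronglyMeasurable,
      ContinuousLinearMap.integral_comp_comm (RCLike.map 𝕂 ℂ) hXi, hX_mean j]
    simp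

variable {H : Type*} [NormedAddCommGroup H] [InnerProductSpace ℂ H]

theorem memLp_two_sum_smul (hXm : ∀ j, Measurable (X j))
    (hX_var : ∀ j, ∫ ω, ‖X j ω‖ ^ 2 ∂P = 1) (a : ℕ → H) (N : ℕ) :
    MemLp (fun ω => ∑ j ∈ Finset.range N, RCLike.map 𝕂 ℂ (X j ω) • a j) 2 P := by
  refine memLp_finsetSum _ fun j _ => ?_
  have := (memLp_two_of_integral_norm_sq hXm hX_var j)
  refine (this.norm.mul_const ‖a j‖).mono ?_ ?_
  · exact this.1.smul_const _
  · exact Eventually.of_forall fun ω => by simp [norm_smul]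

variable [IsProbabilityMeasure P]

/-- The X_j are orthonormal in L²(P), so only the diagonal terms of the expanded square survive. -/
theorem integral_norm_sq_sum_smul (hXm : ∀ j, Measurable (X j)) (hX_indep : iIndepFun X P)
    (hX_mean : ∀ j, ∫ ω, X j ω ∂P = 0) (hX_var : ∀ j, ∫ ω, ‖X j ω‖ ^ 2 ∂P = 1)
    (a : ℕ → H) (N : ℕ) :
    ∫ ω, ‖∑ j ∈ Finset.range N, RCLike.map 𝕂 ℂ (X j ω) • a j‖ ^ 2 ∂P =
      ∑ j ∈ Finset.range N, ‖a j‖ ^ 2 := by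
  have hc : ((∫ ω, ‖∑ j ∈ Finset.range N, RCLike.map 𝕂 ℂ (X j ω) • a j‖ ^ 2 ∂P : ℝ) : ℂ) =
      ((∑ j ∈ Finset.range N, ‖a j‖ ^ 2 : ℝ) : ℂ) := by
    rw [← integral_complex_ofReal]
    have h1 : ∀ ω, ((‖∑ j ∈ Finset.range N, RCLike.map 𝕂 ℂ (X j ω) • a j‖ ^ 2 : ℝ) : ℂ) =
        ∑ i ∈ Finset.range N, ∑ j ∈ Finset.range N,
          star (RCLike.map 𝕂 ℂ (X i ω)) * RCLike.map 𝕂 ℂ (X j ω) * inner ℂ (a i) (a j) := by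
      intro ω
      rw [Complex.ofReal_pow]
      refine (inner_self_eq_norm_sq_to_K (𝕜 := ℂ)
        (∑ j ∈ Finset.range N, RCLike.map 𝕂 ℂ (X j ω) • a j)).symm.trans ?_
      rw [sum_inner]
      refine Finset.sum_congr rfl fun i _ => ?_
      rw [inner_sum]
      refine Finset.sum_congr rfl fun j _ => ?_
      rw [inner_smul_left, inner_smul_right, mul_assoc]
      rfl
    have hint : ∀ i j, Integrable (fun ω => star (RCLike.map 𝕂 ℂ (X i ω)) *
        RCLike.map 𝕂 ℂ (X j ω)) P := fun i j =>
      MemLp.integrable_mul (p := 2) (q := 2) (memLp_two_of_integral_norm_sq hXm hX_var i).star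
        (memLp_two_of_integral_norm_sq hXm hX_var j)
    simp only [h1]
    rw [integral_finsetSum _ fun i _ => integrable_finsetSum _ fun j _ =>
      (hint i j).mul_const _]
    rw [Complex.ofReal_sum]
    refine Finset.sum_congr rfl fun i hi => ?_
    rw [integral_finsetSum _ fun j _ => (hint i j).mul_const _]
    simp only [integral_mul_const, integral_conj_mul hXm hX_indep hX_mean hX_var]
    simp only [ite_mul, one_mul, zero_mul, Finset.sum_ite_eq, hi, if_true]
    rw [Complex.ofReal_pow]
    exact inner_self_eq_norm_sq_to_K (𝕜 := ℂ) _
  exact_mod_cast hc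

end Series

end RandomSmoothing

/-! ### Small ball estimate from convex concentration. -/

namespace RandomSmoothing

section SmallBall

variable {𝕂 : Type*} [RCLike 𝕂] {H : Type*} [NormedAddCommGroup H] [InnerProductSpace ℂ H]

/-- Cauchy–Schwarz. Dividing by σ normalises the Lipschitz constant to 1, so the tails are uniform
in `N` and in the vectors `a j`. -/
theorem lipschitzWith_norm_sum_smul {N : ℕ} (a : Fin N → H) {σ : ℝ} (hσ : 0 < σ)
    (ha : ∑ j, ‖a j‖ ^ 2 = σ ^ 2) :
    LipschitzWith 1 fun x : EuclideanSpace 𝕂 (Fin N) =>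
      ‖∑ j, RCLike.map 𝕂 ℂ (x j) • a j‖ / σ := by
  refine LipschitzWith.of_dist_le_mul fun x y => ?_
  rw [NNReal.coe_one, one_mul, Real.dist_eq, ← sub_div, abs_div, abs_of_pos hσ, div_le_iff₀ hσ]
  refine (abs_norm_sub_norm_le _ _).trans ?_
  have h1 : ∑ j, RCLike.map 𝕂 ℂ (x j) • a j - ∑ j, RCLike.map 𝕂 ℂ (y j) • a j =
      ∑ j, RCLike.map 𝕂 ℂ (x j - y j) • a j := by
    rw [← Finset.sum_sub_distrib]
    exact Finset.sum_congr rfl fun j _ => by rw [map_sub, sub_smul]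
  rw [h1]
  refine (norm_sum_le _ _).trans ?_
  simp only [norm_smul, norm_map_complex]
  refine (Real.sum_mul_le_sqrt_mul_sqrt _ _ _).trans ?_
  rw [ha, Real.sqrt_sq hσ.le, EuclideanSpace.dist_eq]
  simp [dist_eq_norm]

theorem convexOn_norm_sum_smul {N : ℕ} (a : Fin N → H) {σ : ℝ} (hσ : 0 < σ) :
    ConvexOn ℝ Set.univ fun x : EuclideanSpace 𝕂 (Fin N) =>
      ‖∑ j, RCLike.map 𝕂 ℂ (x j) • a j‖ / σ := by
  refine ⟨convex_univ, fun x _ y _ s t hs ht _ => ?_⟩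
  have h1 : ∑ j, RCLike.map 𝕂 ℂ ((s • x + t • y) j) • a j =
      (s : ℂ) • ∑ j, RCLike.map 𝕂 ℂ (x j) • a j + (t : ℂ) • ∑ j, RCLike.map 𝕂 ℂ (y j) • a j := by
    rw [Finset.smul_sum, Finset.smul_sum, ← Finset.sum_add_distrib]
    refine Finset.sum_congr rfl fun j _ => ?_
    rw [PiLp.add_apply, PiLp.smul_apply, PiLp.smul_apply, map_add, map_smul, map_smul, add_smul,
      smul_smul, smul_smul]
    rfl
  simp only [smul_eq_mul]
  rw [h1, mul_div_assoc', mul_div_assoc', ← add_div]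
  gcongr
  refine (norm_add_le _ _).trans (le_of_eq ?_)
  simp [norm_smul, abs_of_nonneg hs, abs_of_nonneg ht]

/-- A small ball estimate for sums of independent vectors, with a constant which only depends on
the constants in the concentration property. -/
theorem ConcentrationProperty.exists_le_measure_norm_sq {ν : Measure 𝕂}
    (hν : ConcentrationProperty ν) :
    ∃ κ : ℝ, 0 < κ ∧ ∀ {Ω : Type*} [MeasurableSpace Ω] {P : Measure Ω} [IsProbabilityMeasure P]
      {X : ℕ → Ω → 𝕂}, (∀ j, Measurable (X j)) → (∀ j, HasLaw (X j) ν P) → iIndepFun X P →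
      (∀ j, ∫ ω, X j ω ∂P = 0) → (∀ j, ∫ ω, ‖X j ω‖ ^ 2 ∂P = 1) →
      ∀ {H : Type} [NormedAddCommGroup H] [InnerProductSpace ℂ H] (a : ℕ → H) (N : ℕ),
      κ ≤ P.real {ω | (∑ j ∈ Finset.range N, ‖a j‖ ^ 2) / 2 ≤
        ‖∑ j ∈ Finset.range N, RCLike.map 𝕂 ℂ (X j ω) • a j‖ ^ 2} := by
  obtain ⟨c, C, -, hC, htail⟩ := hν
  obtain ⟨K, hK, hmom⟩ := exists_lintegral_pow_four_le_of_tail (c := c) hC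
  -- For the normalised norm, 8K + 8 bounds the fourth moment, and Paley–Zygmund with A = 1 gives
  -- 1/4 ≤ (8K + 8) · probability. The minimum with 1 covers the case where all vectors vanish.
  refine ⟨min 1 (1 / (4 * (8 * K.toReal + 8))), by positivity, ?_⟩
  intro Ω _ P _ X hXm hXl hXi hX0 hX1 H _ _ a N
  set σ : ℝ := √(∑ j ∈ Finset.range N, ‖a j‖ ^ 2) with hσdef
  have hs0 : 0 ≤ ∑ j ∈ Finset.range N, ‖a j‖ ^ 2 := by positivity
  have hσ2 : ∑ j ∈ Finset.range N, ‖a j‖ ^ 2 = σ ^ 2 := (Real.sq_sqrt hs0).symm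
  rcases hs0.eq_or_lt with h0 | h0
  · rw [← h0]
    have : {ω | (0 : ℝ) / 2 ≤ ‖∑ j ∈ Finset.range N, RCLike.map 𝕂 ℂ (X j ω) • a j‖ ^ 2} =
        Set.univ := by
      ext ω; simp
    rw [this, probReal_univ]
    exact min_le_left _ _
  have hσ : 0 < σ := Real.sqrt_pos.2 h0
  set S : Ω → H := fun ω => ∑ j ∈ Finset.range N, RCLike.map 𝕂 ℂ (X j ω) • a j with hS
  set f : Ω → ℝ := fun ω => ‖S ω‖ / σ with hf
  let F : EuclideanSpace 𝕂 (Fin N) → ℝ := fun x => ‖∑ j : Fin N, RCLike.map 𝕂 ℂ (x j) • a j‖ / σ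
  have hFl : LipschitzWith 1 F :=
    lipschitzWith_norm_sum_smul (fun j : Fin N => a j) hσ
      (by rw [← hσ2, Finset.sum_range])
  have hfF : ∀ ω, f ω = F (WithLp.toLp 2 fun j : Fin N => X j ω) := by
    intro ω
    simp only [hf, hS, F]
    rw [Finset.sum_range]
  have hXv : Measurable fun ω => fun j : Fin N => X j ω := measurable_pi_lambda _ fun j => hXm j
  have hFm : Measurable fun x : Fin N → 𝕂 => F (WithLp.toLp 2 x) :=
    hFl.continuous.measurable.comp (WithLp.measurable_toLp 2 _)
  have hpi : (Measure.pi fun _ : Fin N => ν) = P.map fun ω => fun j : Fin N => X j ω := by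
    have h1 : iIndepFun (fun (j : Fin N) ω => X j ω) P := hXi.precomp Fin.val_injective
    rw [(iIndepFun_iff_map_fun_eq_pi_map fun j : Fin N => (hXm j).aemeasurable).1 h1]
    congr 1
    funext j
    exact (hXl j).map_eq.symm
  have hfm : Measurable f := by
    have : f = (fun x : Fin N → 𝕂 => F (WithLp.toLp 2 x)) ∘ fun ω => fun j : Fin N => X j ω :=
      funext hfF
    rw [this]; exact hFm.comp hXv
  set m : ℝ := ∫ y, F (WithLp.toLp 2 y) ∂(Measure.pi fun _ : Fin N => ν) with hm
  have hmf : m = ∫ ω, f ω ∂P := by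
    rw [hm, hpi, integral_map hXv.aemeasurable hFm.aestronglyMeasurable]
    exact integral_congr_ae (Eventually.of_forall fun ω => (hfF ω).symm)
  have htf : ∀ r : ℝ, 0 < r → P {ω | r ≤ |f ω - m|} ≤
      ENNReal.ofReal (c * Real.exp (-(C * r ^ 2))) := by
    intro r hr
    have h1 := htail N F 1 one_pos hFl (convexOn_norm_sum_smul _ hσ) r hr
    have hms : MeasurableSet {x : Fin N → 𝕂 | r ≤ |F (WithLp.toLp 2 x) - m|} :=
      measurableSet_le measurable_const
        (continuous_abs.measurable.comp (hFm.sub measurable_const))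
    rw [← hm, hpi, Measure.map_apply hXv hms] at h1
    simp only [NNReal.coe_one, one_pow, div_one] at h1
    refine le_trans (le_of_eq ?_) h1
    congr 1
    ext ω
    simp only [hfF]
    rfl
  have h4 := hmom P (fun ω => f ω - m) (hfm.sub measurable_const).aemeasurable htf
  have hf2i : Integrable (fun ω => f ω ^ 2) P := by
    have := ((memLp_two_sum_smul hXm hX1 a N).norm.integrable_sq).div_const (σ ^ 2)
    simpa only [hf, div_pow] using! this
  have hfLp : MemLp f 2 P := (memLp_two_iff_integrable_sq hfm.aestronglyMeasurable).2 hf2i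
  have hfi : Integrable f P := hfLp.integrable (by norm_num)
  have hf2 : ∫ ω, f ω ^ 2 ∂P = 1 := by
    simp only [hf, div_pow]
    rw [integral_div, integral_norm_sq_sum_smul hXm hXi hX0 hX1 a N, hσ2, div_self (by positivity)]
  -- The variance is nonnegative and the second moment is 1, so the mean adds only a constant to the
  -- fourth moment.
  have hm2 : m ^ 2 ≤ 1 := by
    have h1 : 0 ≤ ∫ ω, (f ω - m) ^ 2 ∂P := integral_nonneg fun ω => sq_nonneg _
    have h2 : ∫ ω, (f ω - m) ^ 2 ∂P = ∫ ω, (f ω ^ 2 - 2 * m * f ω + m ^ 2) ∂P :=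
      integral_congr_ae (Eventually.of_forall fun ω => by ring)
    have i1 : Integrable (fun ω => f ω ^ 2 - 2 * m * f ω) P := hf2i.sub (hfi.const_mul _)
    rw [h2, integral_add i1 (integrable_const _), integral_sub hf2i (hfi.const_mul _),
      integral_const_mul, ← hmf, hf2, integral_const, probReal_univ] at h1
    simp only [smul_eq_mul] at h1
    nlinarith
  have h4i : Integrable (fun ω => (f ω - m) ^ 4) P := by
    refine ⟨((hfm.sub measurable_const).pow_const 4).aestronglyMeasurable, ?_⟩
    rw [hasFiniteIntegral_iff_ofReal (Eventually.of_forall fun ω => Even.pow_nonneg (by decide) _)]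
    exact h4.trans_lt hK.lt_top
  have h4le : ∫ ω, (f ω - m) ^ 4 ∂P ≤ K.toReal := by
    rw [integral_eq_lintegral_of_nonneg_ae
      (Eventually.of_forall fun ω => Even.pow_nonneg (by decide) _) h4i.1]
    exact ENNReal.toReal_mono hK h4
  have hpt : ∀ ω, f ω ^ 4 ≤ 8 * (f ω - m) ^ 4 + 8 := by
    intro ω
    have e : f ω ^ 4 ≤ 8 * ((f ω - m) ^ 4 + m ^ 4) := by
      have e1 : f ω ^ 2 ≤ 2 * ((f ω - m) ^ 2 + m ^ 2) := by nlinarith [sq_nonneg (f ω - 2 * m)]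
      have e2 : (f ω ^ 2) ^ 2 ≤ (2 * ((f ω - m) ^ 2 + m ^ 2)) ^ 2 := by gcongr
      nlinarith [sq_nonneg ((f ω - m) ^ 2 - m ^ 2)]
    have : m ^ 4 ≤ 1 := by nlinarith [sq_nonneg m]
    linarith
  have hf4i : Integrable (fun ω => f ω ^ 4) P := by
    refine ((h4i.const_mul 8).add (integrable_const 8)).mono
      (hfm.pow_const 4).aestronglyMeasurable (Eventually.of_forall fun ω => ?_)
    rw [Real.norm_of_nonneg (Even.pow_nonneg (by decide) _)]
    exact (hpt ω).trans (le_abs_self _)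
  have hf4 : ∫ ω, f ω ^ 4 ∂P ≤ 8 * K.toReal + 8 := by
    have hle : ∫ ω, f ω ^ 4 ∂P ≤ ∫ ω, (8 * (f ω - m) ^ 4 + 8) ∂P :=
      integral_mono hf4i ((h4i.const_mul 8).add (integrable_const 8)) hpt
    refine hle.trans ?_
    rw [integral_add (h4i.const_mul 8) (integrable_const 8), integral_const_mul, integral_const,
      probReal_univ]
    simp only [smul_eq_mul]
    linarith
  have hPZ := sq_le_mul_setIntegral_of_le_integral (μ := P) (f := fun ω => f ω ^ 2)
    (ρ := fun _ => 1) (hfm.pow_const 2) (fun _ => zero_le_one) (integrable_const _) (by simp)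
    (by simpa using hf2i) (by simpa [← pow_mul] using hf4i) (A := 1) (B := 8 * K.toReal + 8)
    one_pos (by simp [hf2]) (by simpa [← pow_mul] using hf4)
  have hset : {ω | (1 : ℝ) / 2 ≤ f ω ^ 2} = {ω | σ ^ 2 / 2 ≤ ‖S ω‖ ^ 2} := by
    ext ω
    simp only [Set.mem_ofPred_eq, hf, div_pow]
    rw [le_div_iff₀ (by positivity)]
    constructor <;> intro h <;> linarith
  rw [hset, setIntegral_const] at hPZ
  simp only [smul_eq_mul, mul_one, one_pow] at hPZ
  rw [hσ2]
  refine (min_le_right _ _).trans ?_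
  rw [div_le_iff₀ (by positivity)]
  linarith

end SmallBall

end RandomSmoothing

/-! ### The blow-up event and the zero-one law. -/

namespace RandomSmoothing

/-- The event that the partial sums `∑_{m < M} |∑_{n ≤ j < N} c_{jm} y_j|²` are unbounded, in the
sense of an iterated upper limit. -/
def blowUpSet {Ω : Type*} (c : ℕ → ℕ → ℂ) (Y : ℕ → Ω → ℂ) (n : ℕ) : Set Ω :=
  -- `M` is chosen before `N₀`: a single finite block of coordinates must be large for arbitrarily
  -- late `N`, which coordinatewise convergence can contradict.
  ⋂ K : ℕ, ⋃ M : ℕ, ⋂ N₀ : ℕ, ⋃ N : ℕ, ⋃ _ : N₀ ≤ N,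
    {ω | (K : ℝ) ≤ ∑ m ∈ Finset.range M, ‖∑ j ∈ Finset.Ico n N, c j m * Y j ω‖ ^ 2}

theorem mem_blowUpSet {Ω : Type*} {c : ℕ → ℕ → ℂ} {Y : ℕ → Ω → ℂ} {n : ℕ} {ω : Ω} :
    ω ∈ blowUpSet c Y n ↔ ∀ K : ℕ, ∃ M : ℕ, ∀ N₀ : ℕ, ∃ N : ℕ, N₀ ≤ N ∧
      (K : ℝ) ≤ ∑ m ∈ Finset.range M, ‖∑ j ∈ Finset.Ico n N, c j m * Y j ω‖ ^ 2 := by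
  simp only [blowUpSet, Set.mem_iInter, Set.mem_iUnion, Set.mem_ofPred_eq, exists_prop]

theorem sum_norm_add_sq_le (M : ℕ) (a b : ℕ → ℂ) :
    ∑ m ∈ Finset.range M, ‖a m + b m‖ ^ 2 ≤
      2 * ∑ m ∈ Finset.range M, ‖a m‖ ^ 2 + 2 * ∑ m ∈ Finset.range M, ‖b m‖ ^ 2 := by
  rw [Finset.mul_sum, Finset.mul_sum, ← Finset.sum_add_distrib]
  refine Finset.sum_le_sum fun m _ => ?_
  have h1 : ‖a m + b m‖ ^ 2 ≤ (‖a m‖ + ‖b m‖) ^ 2 := by gcongr; exact norm_add_le _ _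
  nlinarith [sq_nonneg (‖a m‖ - ‖b m‖)]

theorem summable_norm_sq_sum {c : ℕ → ℕ → ℂ} (hrow : ∀ j, Summable fun m => ‖c j m‖ ^ 2)
    (y : ℕ → ℂ) (s : Finset ℕ) : Summable fun m => ‖∑ j ∈ s, c j m * y j‖ ^ 2 := by
  refine Summable.of_nonneg_of_le (fun m => sq_nonneg _) (fun m => ?_)
    (summable_sum (s := s) fun j _ => ((hrow j).mul_right (s.card * ‖y j‖ ^ 2)))
  have h1 : ‖∑ j ∈ s, c j m * y j‖ ^ 2 ≤ (∑ j ∈ s, ‖c j m * y j‖) ^ 2 := by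
    gcongr; exact norm_sum_le _ _
  refine h1.trans (sq_sum_le_card_mul_sum_sq.trans (le_of_eq ?_))
  rw [Finset.mul_sum]
  refine Finset.sum_congr rfl fun j _ => ?_
  rw [norm_mul]; ring

/-- This makes the event a tail event. Dropping the first `n` terms changes the vector by a fixed
square summable one, because the rows are square summable, and ‖a + b‖² ≤ 2‖a‖² + 2‖b‖² carries
unboundedness across. -/
theorem blowUpSet_eq {Ω : Type*} {c : ℕ → ℕ → ℂ} (hrow : ∀ j, Summable fun m => ‖c j m‖ ^ 2)
    (Y : ℕ → Ω → ℂ) (n : ℕ) : blowUpSet c Y n = blowUpSet c Y 0 := by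
  have key : ∀ (ω : Ω) (n₁ n₂ : ℕ) (b : ℕ → ℂ), (Summable fun m => ‖b m‖ ^ 2) →
      (∀ N m, n ≤ N → ∑ j ∈ Finset.Ico n₁ N, c j m * Y j ω =
        b m + ∑ j ∈ Finset.Ico n₂ N, c j m * Y j ω) →
      ω ∈ blowUpSet c Y n₁ → ω ∈ blowUpSet c Y n₂ := by
    intro ω n₁ n₂ b hb hsum hω
    rw [mem_blowUpSet] at hω ⊢
    intro K
    obtain ⟨K', hK'⟩ := exists_nat_ge (2 * ∑' m, ‖b m‖ ^ 2 + 2 * K)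
    obtain ⟨M, hM⟩ := hω K'
    refine ⟨M, fun N₀ => ?_⟩
    obtain ⟨N, hN, hle⟩ := hM (max N₀ n)
    refine ⟨N, (le_max_left _ _).trans hN, ?_⟩
    have h1 := sum_norm_add_sq_le M b fun m => ∑ j ∈ Finset.Ico n₂ N, c j m * Y j ω
    have h2 : ∑ m ∈ Finset.range M, ‖b m‖ ^ 2 ≤ ∑' m, ‖b m‖ ^ 2 :=
      hb.sum_le_tsum _ fun m _ => sq_nonneg _
    simp only [← hsum N _ ((le_max_right _ _).trans hN)] at h1
    linarith
  have hsplit : ∀ (ω : Ω) N m, n ≤ N → ∑ j ∈ Finset.Ico 0 N, c j m * Y j ω =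
      ∑ j ∈ Finset.Ico 0 n, c j m * Y j ω + ∑ j ∈ Finset.Ico n N, c j m * Y j ω :=
    fun ω N m h => (Finset.sum_Ico_consecutive _ (Nat.zero_le n) h).symm
  have hs : ∀ ω : Ω, Summable fun m => ‖∑ j ∈ Finset.Ico 0 n, c j m * Y j ω‖ ^ 2 := fun ω =>
    summable_norm_sq_sum hrow (fun j => Y j ω) _
  refine Set.Subset.antisymm (fun ω hω => ?_) (fun ω hω => ?_)
  · refine key ω n 0 (fun m => -∑ j ∈ Finset.Ico 0 n, c j m * Y j ω) (by simpa using hs ω) ?_ hω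
    intro N m h
    rw [hsplit ω N m h]; ring
  · exact key ω 0 n _ (hs ω) (hsplit ω) hω

theorem measurableSet_blowUpSet {Ω : Type*} (mΩ : MeasurableSpace Ω) (c : ℕ → ℕ → ℂ)
    {Y : ℕ → Ω → ℂ} {n : ℕ} (hY : ∀ j, n ≤ j → Measurable (Y j)) :
    MeasurableSet (blowUpSet c Y n) := by
  refine MeasurableSet.iInter fun K => MeasurableSet.iUnion fun M => MeasurableSet.iInter fun N₀ =>
    MeasurableSet.iUnion fun N => MeasurableSet.iUnion fun _ => ?_
  refine measurableSet_le measurable_const ?_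
  refine Finset.measurable_fun_sum _ fun m _ => ?_
  refine Measurable.pow_const ?_ 2
  refine Measurable.norm ?_
  exact Finset.measurable_fun_sum _ fun j hj =>
    measurable_const.mul (hY j (Finset.mem_Ico.1 hj).1)

theorem le_measureReal_iInter_of_antitone {Ω : Type*} [MeasurableSpace Ω] {P : Measure Ω}
    [IsProbabilityMeasure P] {A : ℕ → Set Ω} (hA : Antitone A) (hm : ∀ n, MeasurableSet (A n))
    {κ : ℝ} (hκ : ∀ n, κ ≤ P.real (A n)) : κ ≤ P.real (⋂ n, A n) := by
  have h1 := tendsto_measure_iInter_atTop (μ := P) (fun n => (hm n).nullMeasurableSet) hA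
    ⟨0, measure_ne_top _ _⟩
  have h2 := (ENNReal.tendsto_toReal (measure_ne_top P _)).comp h1
  exact ge_of_tendsto' h2 hκ

variable {𝕂 : Type*} [RCLike 𝕂]

/-- The small ball constant κ depends on none of `K`, `M`, `N`, so it survives the decreasing
intersections over `N₀` and over `K`. -/
theorem ConcentrationProperty.measure_blowUpSet_pos {ν : Measure 𝕂}
    (hν : ConcentrationProperty ν) {Ω : Type*} [MeasurableSpace Ω] {P : Measure Ω}
    [IsProbabilityMeasure P] {X : ℕ → Ω → 𝕂} (hXm : ∀ j, Measurable (X j))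
    (hX_law : ∀ j, HasLaw (X j) ν P) (hX_indep : iIndepFun X P)
    (hX_mean : ∀ j, ∫ ω, X j ω ∂P = 0) (hX_var : ∀ j, ∫ ω, ‖X j ω‖ ^ 2 ∂P = 1)
    {c : ℕ → ℕ → ℂ} (hdiv : ¬ Summable fun p : ℕ × ℕ => ‖c p.1 p.2‖ ^ 2) :
    0 < P.real (blowUpSet c (fun j ω => RCLike.map 𝕂 ℂ (X j ω)) 0) := by
  obtain ⟨κ, hκ, hsmall⟩ := hν.exists_le_measure_norm_sq
  refine hκ.trans_le ?_
  have hYm : ∀ j, Measurable fun ω => RCLike.map 𝕂 ℂ (X j ω) := fun j =>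
    (RCLike.map 𝕂 ℂ).continuous.measurable.comp (hXm j)
  have hmeas : ∀ (K M N : ℕ), MeasurableSet {ω | (K : ℝ) ≤ ∑ m ∈ Finset.range M,
      ‖∑ j ∈ Finset.Ico 0 N, c j m * RCLike.map 𝕂 ℂ (X j ω)‖ ^ 2} := fun K M N => by
    refine measurableSet_le measurable_const (Finset.measurable_fun_sum _ fun m _ => ?_)
    exact ((Finset.measurable_fun_sum _ fun j _ => measurable_const.mul (hYm j)).norm).pow_const 2
  refine le_measureReal_iInter_of_antitone (fun K₁ K₂ hK => ?_) (fun K => ?_) (fun K => ?_)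
  · refine Set.iUnion_mono fun M => Set.iInter_mono fun N₀ => Set.iUnion_mono fun N =>
      Set.iUnion_mono fun _ ω hω => ?_
    exact le_trans (Nat.cast_le.2 hK) (show ((K₂ : ℕ) : ℝ) ≤ _ from hω)
  · exact MeasurableSet.iUnion fun M => MeasurableSet.iInter fun N₀ =>
      MeasurableSet.iUnion fun N => MeasurableSet.iUnion fun _ => hmeas K M N
  -- The factor 2 pays for the half of the second moment lost in the small ball estimate.
  · obtain ⟨M, N₁, hMN⟩ : ∃ M N₁ : ℕ, (2 * K : ℝ) ≤
        ∑ j ∈ Finset.range N₁, ∑ m ∈ Finset.range M, ‖c j m‖ ^ 2 := by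
      by_contra! hcon
      refine hdiv (summable_of_sum_le (c := 2 * K) (fun p => sq_nonneg _) fun u => ?_)
      obtain ⟨n, hn⟩ : ∃ n, u ⊆ Finset.range n ×ˢ Finset.range n := by
        refine ⟨(u.sup fun p => max p.1 p.2) + 1, fun p hp => ?_⟩
        have : max p.1 p.2 ≤ u.sup fun p => max p.1 p.2 :=
          Finset.le_sup (f := fun p : ℕ × ℕ => max p.1 p.2) hp
        simp only [Finset.mem_product, Finset.mem_range]
        omega
      refine (Finset.sum_le_sum_of_subset_of_nonneg hn fun _ _ _ => sq_nonneg _).trans ?_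
      rw [Finset.sum_product]
      exact (hcon n n).le
    refine le_trans (b := P.real (⋂ N₀ : ℕ, ⋃ N : ℕ, ⋃ _ : N₀ ≤ N, {ω | (K : ℝ) ≤
      ∑ m ∈ Finset.range M, ‖∑ j ∈ Finset.Ico 0 N, c j m * RCLike.map 𝕂 ℂ (X j ω)‖ ^ 2})) ?_
      (measureReal_mono (Set.subset_iUnion_of_subset M subset_rfl) (measure_ne_top _ _))
    refine le_measureReal_iInter_of_antitone (fun N₀ N₀' h => ?_) (fun N₀ => ?_) (fun N₀ => ?_)
    · exact Set.iUnion_mono fun N => Set.iUnion_mono' fun h' => ⟨h.trans h', subset_rfl⟩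
    · exact MeasurableSet.iUnion fun N => MeasurableSet.iUnion fun _ => hmeas K M N
    · let a : ℕ → EuclideanSpace ℂ (Fin M) := fun j => WithLp.toLp 2 fun m => c j m
      have h1 := hsmall hXm hX_law hX_indep hX_mean hX_var a (max N₀ N₁)
      refine h1.trans (measureReal_mono (fun ω hω => ?_) (measure_ne_top _ _))
      refine Set.mem_iUnion₂.2 ⟨max N₀ N₁, le_max_left _ _, ?_⟩
      have ha : ∀ j, ‖a j‖ ^ 2 = ∑ m ∈ Finset.range M, ‖c j m‖ ^ 2 := fun j => by
        rw [EuclideanSpace.norm_sq_eq, Finset.sum_range]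
      have hb : ‖∑ j ∈ Finset.range (max N₀ N₁), RCLike.map 𝕂 ℂ (X j ω) • a j‖ ^ 2 =
          ∑ m ∈ Finset.range M,
            ‖∑ j ∈ Finset.Ico 0 (max N₀ N₁), c j m * RCLike.map 𝕂 ℂ (X j ω)‖ ^ 2 := by
        rw [EuclideanSpace.norm_sq_eq, Finset.sum_range (n := M)]
        refine Finset.sum_congr rfl fun m _ => ?_
        rw [Finset.range_eq_Ico]
        congr 2
        rw [WithLp.ofLp_sum, Finset.sum_apply]
        refine Finset.sum_congr rfl fun j _ => ?_
        rw [PiLp.smul_apply, smul_eq_mul, mul_comm]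
      have hω' : (∑ j ∈ Finset.range (max N₀ N₁), ‖a j‖ ^ 2) / 2 ≤
        ‖∑ j ∈ Finset.range (max N₀ N₁), RCLike.map 𝕂 ℂ (X j ω) • a j‖ ^ 2 := hω
      rw [hb] at hω'
      refine le_trans ?_ hω'
      have h2 : ∑ j ∈ Finset.range N₁, ‖a j‖ ^ 2 ≤
          ∑ j ∈ Finset.range (max N₀ N₁), ‖a j‖ ^ 2 :=
        Finset.sum_le_sum_of_subset_of_nonneg
          (Finset.range_mono (le_max_right _ _)) fun _ _ _ => sq_nonneg _
      simp only [ha] at h2 ⊢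
      linarith

/-- Kolmogorov's law: for every `n` the event can be rewritten with the variables of index at least
`n` only, so it lies in the tail σ-algebra. -/
theorem measure_blowUpSet_eq_zero_or_one {Ω : Type*} [MeasurableSpace Ω] {P : Measure Ω}
    [IsProbabilityMeasure P] {X : ℕ → Ω → 𝕂} (hXm : ∀ j, Measurable (X j))
    (hX_indep : iIndepFun X P) {c : ℕ → ℕ → ℂ} (hrow : ∀ j, Summable fun m => ‖c j m‖ ^ 2) :
    P (blowUpSet c (fun j ω => RCLike.map 𝕂 ℂ (X j ω)) 0) = 0 ∨
      P (blowUpSet c (fun j ω => RCLike.map 𝕂 ℂ (X j ω)) 0) = 1 := by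
  refine measure_zero_or_one_of_measurableSet_limsup_atTop
    (s := fun j => MeasurableSpace.comap (X j) inferInstance) (fun j => (hXm j).comap_le)
    hX_indep ?_
  rw [limsup_eq_iInf_iSup_of_nat, MeasurableSpace.measurableSet_iInf]
  intro n
  rw [← blowUpSet_eq hrow _ n]
  refine measurableSet_blowUpSet _ c fun j hj => ?_
  refine (RCLike.map 𝕂 ℂ).continuous.measurable.comp ?_
  exact (Measurable.of_comap_le le_rfl).mono
    (le_iSup₂_of_le (f := fun j (_ : j ≥ n) => MeasurableSpace.comap (X j) inferInstance) j hj
      le_rfl) le_rfl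

/-- If `∑_{j,m} |c_{jm}|²` diverges while its rows converge, then the random vector
`(∑_j c_{jm} X_j)_m` is almost surely not square summable. -/
theorem ConcentrationProperty.ae_not_summable {ν : Measure 𝕂}
    (hν : ConcentrationProperty ν) {Ω : Type*} [MeasurableSpace Ω] {P : Measure Ω}
    [IsProbabilityMeasure P] {X : ℕ → Ω → 𝕂}
    (hX_law : ∀ j, HasLaw (X j) ν P) (hX_indep : iIndepFun X P)
    (hX_mean : ∀ j, ∫ ω, X j ω ∂P = 0) (hX_var : ∀ j, ∫ ω, ‖X j ω‖ ^ 2 ∂P = 1)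
    {c : ℕ → ℕ → ℂ} (hrow : ∀ j, Summable fun m => ‖c j m‖ ^ 2)
    (hdiv : ¬ Summable fun p : ℕ × ℕ => ‖c p.1 p.2‖ ^ 2) :
    ∀ᵐ ω ∂P, ∀ S : ℕ → ℂ, (∀ m, Tendsto (fun N => ∑ j ∈ Finset.range N,
      c j m * RCLike.map 𝕂 ℂ (X j ω)) atTop (𝓝 (S m))) → ¬ Summable fun m => ‖S m‖ ^ 2 := by
  -- Having a law provides a.e. measurability only, whereas tail measurability needs genuinely
  -- measurable representatives.
  let X' : ℕ → Ω → 𝕂 := fun j => (hX_law j).aemeasurable.mk (X j)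
  have hXX' : ∀ j, X j =ᵐ[P] X' j := fun j => (hX_law j).aemeasurable.ae_eq_mk
  have hX'm : ∀ j, Measurable (X' j) := fun j => (hX_law j).aemeasurable.measurable_mk
  have hX'_law : ∀ j, HasLaw (X' j) ν P := fun j => (hX_law j).congr (hXX' j).symm
  have hX'_indep : iIndepFun X' P := hX_indep.congr hXX'
  have hX'_mean : ∀ j, ∫ ω, X' j ω ∂P = 0 := fun j => by
    rw [← hX_mean j]; exact integral_congr_ae (hXX' j).symm
  have hX'_var : ∀ j, ∫ ω, ‖X' j ω‖ ^ 2 ∂P = 1 := fun j => by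
    rw [← hX_var j]
    refine integral_congr_ae ?_
    filter_upwards [hXX' j] with ω hω
    rw [hω]
  have hpos := hν.measure_blowUpSet_pos hX'm hX'_law hX'_indep hX'_mean hX'_var hdiv
  have hone : P (blowUpSet c (fun j ω => RCLike.map 𝕂 ℂ (X' j ω)) 0) = 1 := by
    refine (measure_blowUpSet_eq_zero_or_one hX'm hX'_indep hrow).resolve_left fun h => ?_
    rw [measureReal_def, h] at hpos
    simp at hpos
  have hYm : ∀ j, Measurable fun ω => RCLike.map 𝕂 ℂ (X' j ω) := fun j =>
    (RCLike.map 𝕂 ℂ).continuous.measurable.comp (hX'm j)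
  have hae : ∀ᵐ ω ∂P, ω ∈ blowUpSet c (fun j ω => RCLike.map 𝕂 ℂ (X' j ω)) 0 :=
    (prob_compl_eq_zero_iff (measurableSet_blowUpSet _ c fun j _ => hYm j)).2 hone
  filter_upwards [hae, ae_all_iff.2 hXX'] with ω hω hω' S hS hsum
  rw [mem_blowUpSet] at hω
  obtain ⟨K, hK⟩ := exists_nat_gt (∑' m, ‖S m‖ ^ 2)
  obtain ⟨M, hM⟩ := hω K
  -- The block of `M` coordinates converges to a value below `K`, yet on the event it is at least
  -- `K` for arbitrarily large `N`.
  have hlim : Tendsto (fun N => ∑ m ∈ Finset.range M,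
      ‖∑ j ∈ Finset.Ico 0 N, c j m * RCLike.map 𝕂 ℂ (X' j ω)‖ ^ 2) atTop
      (𝓝 (∑ m ∈ Finset.range M, ‖S m‖ ^ 2)) := by
    refine tendsto_finsetSum _ fun m _ => ((hS m).norm.pow 2).congr fun N => ?_
    rw [Finset.range_eq_Ico]
    simp only [hω']
  have hlt : ∑ m ∈ Finset.range M, ‖S m‖ ^ 2 < K :=
    (hsum.sum_le_tsum _ fun m _ => sq_nonneg _).trans_lt hK
  obtain ⟨N₀, hN₀⟩ := ((tendsto_order.1 hlim).2 _ hlt).exists_forall_of_atTop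
  obtain ⟨N, hN, hle⟩ := hM N₀
  exact absurd hle (not_le.2 (hN₀ N hN))

end RandomSmoothing

/-! ### Leibniz rules and elliptic regularity in Sobolev spaces. -/

namespace RandomSmoothing

open TemperedDistribution LineDeriv

variable {d : ℕ}

/-- The standard basis of `ℝ^d`. -/
abbrev stdBasis (d : ℕ) : OrthonormalBasis (Fin d) ℝ (Space d) := EuclideanSpace.basisFun (Fin d) ℝ

/-- A real polynomial, as a complex valued function on `ℝ^d`. -/
def cpoly (p : MvPolynomial (Fin d) ℝ) (x : Space d) : ℂ := (polyFun p x : ℂ)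

theorem cpoly_hasTemperateGrowth (p : MvPolynomial (Fin d) ℝ) :
    Function.HasTemperateGrowth (cpoly p) :=
  polyFun_hasTemperateGrowth p

theorem hasFDerivAt_polyFun (p : MvPolynomial (Fin d) ℝ) (x : Space d) :
    HasFDerivAt (polyFun p) (∑ i, polyFun (MvPolynomial.pderiv i p) x •
      (EuclideanSpace.proj i : Space d →L[ℝ] ℝ)) x := by
  induction p using MvPolynomial.induction_on with
  | C a =>
    have : polyFun (MvPolynomial.C a) = fun _ : Space d => a := by
      funext y; simp [polyFun]
    rw [this]
    simpa [polyFun] using hasFDerivAt_const a x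
  | add p q hp hq =>
    have : polyFun (p + q) = fun y : Space d => polyFun p y + polyFun q y := by
      funext y; simp [polyFun]
    rw [this]
    refine (hp.add hq).congr_fderiv ?_
    rw [← Finset.sum_add_distrib]
    refine Finset.sum_congr rfl fun i _ => ?_
    rw [← add_smul]; simp [polyFun]
  | mul_X p j hp =>
    have : polyFun (p * MvPolynomial.X j) = fun y : Space d => polyFun p y * y j := by
      funext y; simp [polyFun]
    rw [this]
    have h1 : HasFDerivAt (fun y : Space d => y j)
        (EuclideanSpace.proj j : Space d →L[ℝ] ℝ) x :=
      (EuclideanSpace.proj j : Space d →L[ℝ] ℝ).hasFDerivAt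
    refine (hp.mul h1).congr_fderiv ?_
    rw [Finset.smul_sum]
    ext v
    simp only [_root_.add_apply, _root_.smul_apply,
      _root_.sum_apply, smul_eq_mul, MvPolynomial.pderiv_mul, MvPolynomial.pderiv_X]
    have h2 : ∀ i, polyFun (MvPolynomial.pderiv i p * MvPolynomial.X j +
        p * Pi.single (M := fun _ : Fin d => MvPolynomial (Fin d) ℝ) i 1 j) x =
        x j * polyFun (MvPolynomial.pderiv i p) x + polyFun p x * (if i = j then 1 else 0) := by
      intro i
      by_cases h : i = j
      · subst h; simp [polyFun, mul_comm]
      · simp [polyFun, h, mul_comm]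
    simp only [h2, add_mul, Finset.sum_add_distrib]
    simp [mul_assoc, add_comm]

theorem fderiv_cpoly (p : MvPolynomial (Fin d) ℝ) (x : Space d) (i : Fin d) :
    fderiv ℝ (cpoly p) x (stdBasis d i) = cpoly (MvPolynomial.pderiv i p) x := by
  have h : HasFDerivAt (cpoly p) _ x := Complex.ofRealCLM.hasFDerivAt.comp x (hasFDerivAt_polyFun p x)
  rw [h.fderiv]
  simp only [ContinuousLinearMap.comp_apply, _root_.sum_apply,
    _root_.smul_apply]
  rw [Finset.sum_eq_single i]
  · simp [cpoly]
  · intro j _ hj; simp [hj]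
  · simp

/-- The Leibniz rule for the product of a Schwartz function and a smooth function. -/
theorem schwartz_lineDerivOp_smulLeftCLM {a a' : Space d → ℂ} (ha : a.HasTemperateGrowth)
    (ha' : a'.HasTemperateGrowth) {m : Space d} (h : ∀ x, fderiv ℝ a x m = a' x)
    (g : 𝓢(Space d, ℂ)) :
    ∂_{m} (SchwartzMap.smulLeftCLM ℂ a g) =
      SchwartzMap.smulLeftCLM ℂ a (∂_{m} g) + SchwartzMap.smulLeftCLM ℂ a' g := by
  ext x
  rw [_root_.add_apply, SchwartzMap.smulLeftCLM_apply_apply ha,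
    SchwartzMap.smulLeftCLM_apply_apply ha', SchwartzMap.lineDerivOp_apply_eq_fderiv,
    SchwartzMap.lineDerivOp_apply_eq_fderiv]
  have h1 : (⇑(SchwartzMap.smulLeftCLM ℂ a g) : Space d → ℂ) = fun x => a x • g x := by
    funext y; rw [SchwartzMap.smulLeftCLM_apply_apply ha]
  rw [h1, fderiv_fun_smul (ha.1.differentiable (by simp) x) (g.differentiable x)]
  simp [h x]

/-- The Leibniz rule for the product of a tempered distribution and a smooth function. -/
theorem lineDerivOp_smulLeftCLM {a a' : Space d → ℂ} (ha : a.HasTemperateGrowth)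
    (ha' : a'.HasTemperateGrowth) {m : Space d} (h : ∀ x, fderiv ℝ a x m = a' x)
    (T : 𝓢'(Space d, ℂ)) :
    ∂_{m} (smulLeftCLM ℂ a T) = smulLeftCLM ℂ a (∂_{m} T) + smulLeftCLM ℂ a' T := by
  ext g
  have h1 := schwartz_lineDerivOp_smulLeftCLM ha ha' h g
  have h2 : SchwartzMap.smulLeftCLM ℂ a (-∂_{m} g) =
      -∂_{m} (SchwartzMap.smulLeftCLM ℂ a g) + SchwartzMap.smulLeftCLM ℂ a' g := by
    rw [h1, map_neg]; abel
  rw [lineDerivOp_apply_apply, smulLeftCLM_apply_apply, h2, map_add]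
  rfl

/-- `Δ(aT)` in divergence form. -/
theorem laplacian_smulLeftCLM {a : Space d → ℂ} {a' a'' : Fin d → Space d → ℂ}
    (ha : a.HasTemperateGrowth) (ha' : ∀ i, (a' i).HasTemperateGrowth)
    (ha'' : ∀ i, (a'' i).HasTemperateGrowth) (h : ∀ i x, fderiv ℝ a x (stdBasis d i) = a' i x)
    (h' : ∀ i x, fderiv ℝ (a' i) x (stdBasis d i) = a'' i x) (T : 𝓢'(Space d, ℂ)) :
    Δ (smulLeftCLM ℂ a T) = smulLeftCLM ℂ a (Δ T) +
      ∑ i, ((2 : ℂ) • ∂_{stdBasis d i} (smulLeftCLM ℂ (a' i) T) - smulLeftCLM ℂ (a'' i) T) := by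
  rw [laplacian_eq_sum (stdBasis d), laplacian_eq_sum (stdBasis d), map_sum,
    ← Finset.sum_add_distrib]
  refine Finset.sum_congr rfl fun i _ => ?_
  rw [lineDerivOp_smulLeftCLM ha (ha' i) (h i), lineDerivOp_add,
    lineDerivOp_smulLeftCLM ha (ha' i) (h i), lineDerivOp_smulLeftCLM (ha' i) (ha'' i) (h' i)]
  module

/-- With frequencies normalised by 2π, the Bessel potential of order 2 is 1 - (2π)⁻² Δ. -/
theorem memSobolev_add_two {s : ℝ} {T : 𝓢'(Space d, ℂ)} (h : MemSobolev s 2 T)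
    (h' : MemSobolev s 2 (Δ T)) : MemSobolev (2 + s) 2 T := by
  rw [← memSobolev_besselPotential_iff]
  have h1 : besselPotential (Space d) ℂ 2 T = T + (-(((2 * Real.pi) ^ 2 : ℝ) : ℂ)⁻¹) • Δ T := by
    rw [laplacian_eq_fourierMultiplierCLM, besselPotential]
    have h2 : (fun x : Space d => (((1 + ‖x‖ ^ 2) ^ ((2 : ℝ) / 2) : ℝ) : ℂ)) =
        (fun _ => (1 : ℂ)) + fun x => ((‖x‖ ^ 2 : ℝ) : ℂ) := by
      funext x; simp
    rw [h2, fourierMultiplierCLM_apply, smulLeftCLM_add (by fun_prop) (by fun_prop),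
      _root_.add_apply, FourierTransform.fourierInv_add, smulLeftCLM_const, one_smul,
      FourierTransform.fourierInv_fourier_eq]
    congr 1
    rw [← fourierMultiplierCLM_apply, ← Complex.coe_smul (-(2 * Real.pi) ^ 2), smul_smul]
    have : -(((2 * Real.pi) ^ 2 : ℝ) : ℂ)⁻¹ * ((-(2 * Real.pi) ^ 2 : ℝ) : ℂ) = 1 := by
      have hpi : ((Real.pi : ℝ) : ℂ) ≠ 0 := by exact_mod_cast Real.pi_ne_zero
      push_cast
      field_simp
    rw [this, one_smul]
  rw [h1]
  exact h.add (h'.smul _)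

theorem MemSobolev.sum {ι : Type*} {s : ℝ} {u : Finset ι} {T : ι → 𝓢'(Space d, ℂ)}
    (h : ∀ i ∈ u, MemSobolev s 2 (T i)) : MemSobolev s 2 (∑ i ∈ u, T i) := by
  classical
  induction u using Finset.induction_on with
  | empty => simp
  | insert i u hi ih =>
    rw [Finset.sum_insert hi]
    exact (h i (Finset.mem_insert_self _ _)).add
      (ih fun j hj => h j (Finset.mem_insert_of_mem hj))

/-- Elliptic regularity for `-Δ + V`, for a class `𝒜` of multipliers which is stable under
multiplication by `V` and differentiation. -/
theorem memSobolev_of_multipliers {V : MvPolynomial (Fin d) ℝ} {T : 𝓢'(Space d, ℂ)} {l : ℂ}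
    (hT : schrodinger V T = l • T) (𝒜 : (Space d → ℂ) → Prop)
    (htemp : ∀ a, 𝒜 a → a.HasTemperateGrowth) (hmul : ∀ a, 𝒜 a → 𝒜 (cpoly V * a))
    (hder : ∀ a, 𝒜 a → ∀ i, ∃ a', 𝒜 a' ∧ ∀ x, fderiv ℝ a x (stdBasis d i) = a' x)
    (h0 : ∀ a, 𝒜 a → MemSobolev 0 2 (smulLeftCLM ℂ a T)) (n : ℕ) :
    ∀ a, 𝒜 a → MemSobolev n 2 (smulLeftCLM ℂ a T) := by
  have hΔ : Δ T = smulLeftCLM ℂ (cpoly V) T - l • T := by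
    rw [← hT, schrodinger]
    change _ = smulLeftCLM ℂ (cpoly V) T - (-Δ T + smulLeftCLM ℂ (cpoly V) T)
    abel
  induction n with
  | zero => simpa using h0
  | succ n ih =>
    intro a ha
    choose a' ha' hda' using hder a ha
    choose a'' ha'' hda'' using fun i => hder (a' i) (ha' i) i
    have hle : ((n : ℝ) - 1) ≤ n := by linarith
    -- The first-order terms appear as ∂_i(a'T), never as a'∂_iT, so the induction hypothesis
    -- applies to a'T and costs one derivative. Inverting Δ returns two: a net gain of one per step.
    have h1 : MemSobolev ((n : ℝ) - 1) 2 (Δ (smulLeftCLM ℂ a T)) := by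
      rw [laplacian_smulLeftCLM (htemp a ha) (fun i => htemp _ (ha' i)) (fun i => htemp _ (ha'' i))
        hda' hda'', hΔ, map_sub, map_smul,
        smulLeftCLM_smulLeftCLM_apply (cpoly_hasTemperateGrowth V) (htemp a ha)]
      refine (((ih _ (hmul a ha)).mono hle).sub (((ih _ ha).mono hle).smul l)).add ?_
      refine MemSobolev.sum fun i _ => ?_
      exact ((ih _ (ha' i)).lineDerivOp.smul 2).sub ((ih _ (ha'' i)).mono hle)
    have h2 := memSobolev_add_two ((ih a ha).mono hle) h1
    convert h2 using 1
    push_cast; ring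

end RandomSmoothing

/-! ### Recognising Schwartz functions among tempered distributions. -/

namespace RandomSmoothing

open TemperedDistribution LineDeriv FourierTransform

variable {d : ℕ}

/-- A class of functions which is stable under partial derivatives. -/
def IsDerivationClosed (𝒟 : (Space d → ℂ) → Prop) : Prop :=
  ∀ f, 𝒟 f → ∃ f' : Fin d → Space d → ℂ, (∀ i, 𝒟 (f' i)) ∧
    ∀ x, HasFDerivAt f (∑ i, (EuclideanSpace.proj i : Space d →L[ℝ] ℝ).smulRight (f' i x)) x

namespace IsDerivationClosed

variable {𝒟 : (Space d → ℂ) → Prop}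

theorem contDiff (hder : IsDerivationClosed 𝒟) (n : ℕ) : ∀ f, 𝒟 f → ContDiff ℝ n f := by
  induction n with
  | zero =>
    intro f hf
    obtain ⟨f', -, h⟩ := hder f hf
    exact contDiff_zero.2 (continuous_iff_continuousAt.2 fun x => (h x).continuousAt)
  | succ n ih =>
    intro f hf
    obtain ⟨f', hf', h⟩ := hder f hf
    rw [show ((n + 1 : ℕ) : WithTop ℕ∞) = (n : WithTop ℕ∞) + 1 by norm_cast,
      contDiff_succ_iff_fderiv]
    refine ⟨fun x => (h x).differentiableAt, by simp, ?_⟩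
    rw [funext fun x => (h x).fderiv]
    exact ContDiff.sum fun i _ => contDiff_const.smulRight (ih _ (hf' i))

/-- Induction on the order for the whole class at once: derivatives of order n+1 of `f` are
combinations of derivatives of order n of members of the class. -/
theorem decay (hder : IsDerivationClosed 𝒟)
    (hdec : ∀ f, 𝒟 f → ∀ k : ℕ, ∃ C, ∀ x, ‖x‖ ^ k * ‖f x‖ ≤ C) (n : ℕ) :
    ∀ f, 𝒟 f → ∀ k : ℕ, ∃ C, ∀ x, ‖x‖ ^ k * ‖iteratedFDeriv ℝ n f x‖ ≤ C := by
  induction n with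
  | zero => simpa only [norm_iteratedFDeriv_zero] using hdec
  | succ n ih =>
    intro f hf k
    obtain ⟨f', hf', h⟩ := hder f hf
    choose C hC using fun i => ih _ (hf' i) k
    let L : Fin d → ℂ →L[ℝ] Space d →L[ℝ] ℂ := fun i =>
      ContinuousLinearMap.smulRightL ℝ (Space d) ℂ (EuclideanSpace.proj i : Space d →L[ℝ] ℝ)
    refine ⟨∑ i, ‖L i‖ * C i, fun x => ?_⟩
    have hfd : fderiv ℝ f = fun x => ∑ i, L i (f' i x) := funext fun x => by
      rw [(h x).fderiv]; rfl
    have hsm : ∀ i, ContDiff ℝ n (f' i) := fun i =>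
      contDiff hder n _ (hf' i)
    rw [← norm_iteratedFDeriv_fderiv, hfd,
      iteratedFDeriv_fun_sum_apply (f := fun i x => L i (f' i x))
        fun i _ => ((L i).contDiff.comp (hsm i)).contDiffAt]
    calc ‖x‖ ^ k * ‖∑ i, iteratedFDeriv ℝ n (fun x => L i (f' i x)) x‖
        ≤ ‖x‖ ^ k * ∑ i, ‖L i‖ * ‖iteratedFDeriv ℝ n (f' i) x‖ := by
          gcongr
          refine (norm_sum_le _ _).trans (Finset.sum_le_sum fun i _ => ?_)
          exact (L i).norm_iteratedFDeriv_comp_left (hsm i).contDiffAt le_rfl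
      _ = ∑ i, ‖L i‖ * (‖x‖ ^ k * ‖iteratedFDeriv ℝ n (f' i) x‖) := by
          rw [Finset.mul_sum]; exact Finset.sum_congr rfl fun i _ => by ring
      _ ≤ _ := by
          refine Finset.sum_le_sum fun i _ => ?_
          gcongr
          exact hC i x

/-- Rapidly decaying functions in a class stable under partial derivatives are Schwartz. -/
theorem exists_schwartz (hder : IsDerivationClosed 𝒟)
    (hdec : ∀ f, 𝒟 f → ∀ k : ℕ, ∃ C, ∀ x, ‖x‖ ^ k * ‖f x‖ ≤ C) {f : Space d → ℂ} (hf : 𝒟 f) :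
    ∃ F : 𝓢(Space d, ℂ), ⇑F = f :=
  ⟨⟨f, contDiff_infty.2 fun n => contDiff hder n f hf,
    fun k n => decay hder hdec n f hf k⟩, rfl⟩

end IsDerivationClosed

/-- A locally integrable function is determined by its integrals against Schwartz functions. -/
theorem ae_eq_of_forall_integral_schwartz_mul {f₁ f₂ : Space d → ℂ}
    (h₁ : LocallyIntegrable f₁) (h₂ : LocallyIntegrable f₂)
    (h : ∀ g : 𝓢(Space d, ℂ), ∫ x, g x * f₁ x = ∫ x, g x * f₂ x) : f₁ =ᵐ[volume] f₂ := by
  refine ae_eq_of_integral_contDiff_smul_eq h₁ h₂ fun g hg hgc => ?_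
  have hc : HasCompactSupport (Complex.ofRealCLM ∘ g) := hgc.comp_left rfl
  have hs : ContDiff ℝ ((⊤ : ℕ∞) : WithTop ℕ∞) (Complex.ofRealCLM ∘ g) := by fun_prop
  simpa using! h (hc.toSchwartzMap hs)

/-- For 2s > d the weight (1+|ξ|²)^(-s/2) is square integrable, so the Fourier transform of `T` is
in L¹. `w` is its reflection, since `T` is expressed through 𝓕 g instead of 𝓕⁻ g. -/
theorem exists_integrable_fourier_of_memSobolev {s : ℝ} (hs : (d : ℝ) < 2 * s)
    {T : 𝓢'(Space d, ℂ)} (hT : MemSobolev s 2 T) :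
    ∃ w : Space d → ℂ, Integrable w ∧ ∀ g : 𝓢(Space d, ℂ), T g = ∫ ξ, (𝓕 g) ξ * w ξ := by
  obtain ⟨v, hv⟩ := hT.fourier_memL1 (by simpa using hs)
  refine ⟨fun ξ => v (-ξ), (L1.integrable_coeFn v).comp_neg, fun g => ?_⟩
  have h1 : T g = (𝓕 T) (𝓕⁻ g) := by simp
  rw [h1, hv, Lp.toTemperedDistribution_apply, ← integral_neg_eq_self]
  refine integral_congr_ae (Eventually.of_forall fun ξ => ?_)
  simp only [smul_eq_mul]
  congr 1
  rw [SchwartzMap.fourierInv_coe, SchwartzMap.fourier_coe, Real.fourierInv_eq_fourier_neg, neg_neg]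

theorem integral_mul_fourier_eq {w : Space d → ℂ} (hw : Integrable w) (g : 𝓢(Space d, ℂ)) :
    ∫ ξ, (𝓕 g) ξ * w ξ = ∫ x, g x * 𝓕 w x := by
  have := VectorFourier.integral_fourierIntegral_smul_eq_flip (L := innerₗ (Space d))
    Real.continuous_fourierChar continuous_inner g.integrable hw (μ := volume) (ν := volume)
  simpa using! this

/-- Test with 𝓕⁻ h for arbitrary h. The minus sign comes from `w` being a reflected Fourier
transform. -/
theorem ae_eq_of_lineDeriv {T : 𝓢'(Space d, ℂ)} {w w' : Space d → ℂ} (hw : Integrable w)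
    (hw' : Integrable w') {m : Space d} (hT : ∀ g : 𝓢(Space d, ℂ), T g = ∫ ξ, (𝓕 g) ξ * w ξ)
    (hT' : ∀ g : 𝓢(Space d, ℂ), (∂_{m} T) g = ∫ ξ, (𝓕 g) ξ * w' ξ) :
    w' =ᵐ[volume] fun ξ => -(2 * Real.pi * Complex.I) * ((inner ℝ ξ m : ℝ) * w ξ) := by
  have hc : Continuous fun ξ : Space d => -(2 * Real.pi * Complex.I) * (inner ℝ ξ m : ℝ) := by
    fun_prop
  refine ae_eq_of_forall_integral_schwartz_mul hw'.locallyIntegrable ?_ fun h => ?_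
  · have := hw.locallyIntegrable.continuous_smul hc
    simpa only [smul_eq_mul, mul_assoc] using! this
  · have h1 := hT' (𝓕⁻ h)
    rw [FourierTransform.fourier_fourierInv_eq] at h1
    rw [← h1, lineDerivOp_apply_apply, hT]
    refine integral_congr_ae (Eventually.of_forall fun ξ => ?_)
    have h2 : 𝓕 (-∂_{m} (𝓕⁻ h)) =
        -((2 * Real.pi * Complex.I) • SchwartzMap.smulLeftCLM ℂ (inner ℝ · m) h) := by
      rw [FourierTransform.fourier_neg, SchwartzMap.fourier_lineDerivOp_eq,
        FourierTransform.fourier_fourierInv_eq]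
    simp only [h2]
    have h3 : Function.HasTemperateGrowth fun ξ : Space d => inner ℝ ξ m := by fun_prop
    rw [_root_.neg_apply, _root_.smul_apply, SchwartzMap.smulLeftCLM_apply_apply h3]
    simp only [smul_eq_mul, Complex.real_smul]
    ring

/-- Tempered distributions all of whose polynomial multiples are in all Sobolev spaces. -/
def IsRapidlySmooth (T : 𝓢'(Space d, ℂ)) : Prop :=
  ∀ (p : MvPolynomial (Fin d) ℝ) (n : ℕ), MemSobolev n 2 (smulLeftCLM ℂ (cpoly p) T)

theorem cpoly_mul (p q : MvPolynomial (Fin d) ℝ) : cpoly (p * q) = cpoly p * cpoly q := by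
  funext x; simp [cpoly, polyFun]

theorem cpoly_one : cpoly (1 : MvPolynomial (Fin d) ℝ) = fun _ => 1 := by
  funext x; simp [cpoly, polyFun]

namespace IsRapidlySmooth

variable {T : 𝓢'(Space d, ℂ)}

theorem memSobolev (hT : IsRapidlySmooth T) (n : ℕ) : MemSobolev n 2 T := by
  have := hT 1 n
  rwa [cpoly_one, smulLeftCLM_const, one_smul] at this

theorem smulLeftCLM (hT : IsRapidlySmooth T) (p : MvPolynomial (Fin d) ℝ) :
    IsRapidlySmooth (smulLeftCLM ℂ (cpoly p) T) := fun q n => by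
  rw [smulLeftCLM_smulLeftCLM_apply (cpoly_hasTemperateGrowth p) (cpoly_hasTemperateGrowth q),
    ← cpoly_mul]
  exact hT _ n

/-- Write p ∂T = ∂(pT) - (∂p)T; the lost Sobolev order is harmless because all orders are available.
-/
theorem lineDerivOp (hT : IsRapidlySmooth T) (i : Fin d) :
    IsRapidlySmooth (∂_{stdBasis d i} T) := fun p n => by
  have h := lineDerivOp_smulLeftCLM (cpoly_hasTemperateGrowth p)
    (cpoly_hasTemperateGrowth (MvPolynomial.pderiv i p)) (fun x => fderiv_cpoly p x i) T
  rw [← sub_eq_iff_eq_add] at h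
  rw [← h]
  refine MemSobolev.sub ?_ (hT _ n)
  have h1 := (hT p (n + 1)).lineDerivOp (m := stdBasis d i)
  rwa [show (n : ℝ) = ((n + 1 : ℕ) : ℝ) - 1 by push_cast; ring]

/-- Take f = 𝓕 w. The Fourier densities of the ∂_i T are integrable too and equal multiples of ξ_i
w, so |ξ||w| is integrable and 𝓕 w may be differentiated under the integral. -/
theorem exists_representation (hT : IsRapidlySmooth T) :
    ∃ (f : Space d → ℂ) (f' : Fin d → Space d → ℂ), Continuous f ∧ (∃ C, ∀ x, ‖f x‖ ≤ C) ∧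
      (∀ g : 𝓢(Space d, ℂ), T g = ∫ x, g x * f x) ∧
      (∀ i, Continuous (f' i) ∧ ∀ g : 𝓢(Space d, ℂ),
        (∂_{stdBasis d i} T) g = ∫ x, g x * f' i x) ∧
      ∀ x, HasFDerivAt f (∑ i, (EuclideanSpace.proj i : Space d →L[ℝ] ℝ).smulRight (f' i x)) x := by
  have hd : (d : ℝ) < 2 * ((d : ℕ) + 1 : ℕ) := by push_cast; linarith [(Nat.cast_nonneg d : (0:ℝ) ≤ d)]
  obtain ⟨w, hw, hTw⟩ := exists_integrable_fourier_of_memSobolev hd (hT.memSobolev (d + 1))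
  choose w' hw' hTw' using fun i => exists_integrable_fourier_of_memSobolev hd
    ((hT.lineDerivOp i).memSobolev (d + 1))
  have hae : ∀ i, w' i =ᵐ[volume]
      fun ξ => -(2 * Real.pi * Complex.I) * ((inner ℝ ξ (stdBasis d i) : ℝ) * w ξ) := fun i =>
    ae_eq_of_lineDeriv hw (hw' i) hTw (hTw' i)
  have hcont : ∀ {u : Space d → ℂ}, Integrable u → Continuous (𝓕 u) := fun hu =>
    VectorFourier.fourierIntegral_continuous Real.continuous_fourierChar
      (L := innerₗ (Space d)) continuous_inner hu
  have hmom : Integrable fun ξ : Space d => ‖ξ‖ * ‖w ξ‖ := by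
    have hsum : Integrable fun ξ => ∑ i, ‖w' i ξ‖ := integrable_finsetSum _ fun i _ => (hw' i).norm
    refine hsum.mono (continuous_norm.aestronglyMeasurable.mul hw.1.norm) ?_
    filter_upwards [ae_all_iff.2 hae] with ξ hξ
    rw [Real.norm_of_nonneg (by positivity), Real.norm_of_nonneg (by positivity)]
    have h1 : ‖ξ‖ ≤ ∑ i, |ξ i| := by
      rw [EuclideanSpace.norm_eq]
      refine Real.sqrt_le_iff.2 ⟨by positivity, ?_⟩
      simpa using Finset.sum_sq_le_sq_sum_of_nonneg (s := Finset.univ) (f := fun i => |ξ i|)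
        fun i _ => abs_nonneg _
    have hpi : (1 : ℝ) ≤ 2 * Real.pi := by linarith [Real.pi_gt_three]
    calc ‖ξ‖ * ‖w ξ‖ ≤ (∑ i, |ξ i|) * ‖w ξ‖ := by gcongr
      _ = ∑ i, |ξ i| * ‖w ξ‖ := Finset.sum_mul _ _ _
      _ ≤ ∑ i, ‖w' i ξ‖ := by
        refine Finset.sum_le_sum fun i _ => ?_
        rw [hξ i]
        have : inner ℝ ξ (stdBasis d i) = ξ i := by
          simp [EuclideanSpace.inner_single_right]
        rw [this, norm_mul, norm_mul, norm_neg]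
        have h3 : ‖(2 * Real.pi * Complex.I : ℂ)‖ = 2 * Real.pi := by
          simp [abs_of_pos Real.pi_pos]
        rw [h3, Complex.norm_real, Real.norm_eq_abs]
        exact le_mul_of_one_le_left (by positivity) hpi
  refine ⟨𝓕 w, fun i => 𝓕 (w' i), hcont hw, ⟨∫ ξ, ‖w ξ‖, fun x => ?_⟩, fun g => ?_,
    fun i => ⟨hcont (hw' i), fun g => ?_⟩, fun x => ?_⟩
  · exact VectorFourier.norm_fourierIntegral_le_integral_norm _ _ _ _ _
  · rw [hTw, integral_mul_fourier_eq hw]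
  · rw [hTw', integral_mul_fourier_eq (hw' i)]
  · refine (Real.hasFDerivAt_fourier hw hmom x).congr_fderiv ?_
    refine ContinuousLinearMap.coe_injective ((stdBasis d).toBasis.ext fun i => ?_)
    simp only [ContinuousLinearMap.coe_coe, OrthonormalBasis.coe_toBasis]
    have hint : Integrable (VectorFourier.fourierSMulRight (innerSL ℝ) w) :=
      (hmom.const_mul (2 * Real.pi * ‖innerSL ℝ (E := Space d)‖)).mono'
        hw.1.fourierSMulRight (Eventually.of_forall fun ξ => by
          simpa only [mul_assoc] using VectorFourier.norm_fourierSMulRight_le (innerSL ℝ) w ξ)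
    rw [Real.fourier_continuousLinearMap_apply hint, _root_.sum_apply,
      Finset.sum_eq_single i]
    · simp only [ContinuousLinearMap.smulRight_apply]
      have h1 : (EuclideanSpace.proj i : Space d →L[ℝ] ℝ) (stdBasis d i) = 1 := by simp
      rw [h1, one_smul]
      refine Real.fourier_congr_ae ?_ x
      filter_upwards [hae i] with ξ hξ
      rw [hξ, VectorFourier.fourierSMulRight_apply]
      simp only [Complex.real_smul, smul_eq_mul]
      rfl
    · intro j _ hj
      simp [hj]
    · simp

theorem eq_of_continuous {f₁ f₂ : Space d → ℂ} (h₁ : Continuous f₁) (h₂ : Continuous f₂)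
    (hf₁ : ∀ g : 𝓢(Space d, ℂ), T g = ∫ x, g x * f₁ x)
    (hf₂ : ∀ g : 𝓢(Space d, ℂ), T g = ∫ x, g x * f₂ x) : f₁ = f₂ :=
  (Continuous.ae_eq_iff_eq volume h₁ h₂).1 <|
    ae_eq_of_forall_integral_schwartz_mul h₁.locallyIntegrable h₂.locallyIntegrable fun g => by
      rw [← hf₁, ← hf₂]

theorem hasFDerivAt (hT : IsRapidlySmooth T) {f : Space d → ℂ} (hf : Continuous f)
    (hTf : ∀ g : 𝓢(Space d, ℂ), T g = ∫ x, g x * f x) :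
    ∃ f' : Fin d → Space d → ℂ, (∀ i, Continuous (f' i) ∧ ∀ g : 𝓢(Space d, ℂ),
        (∂_{stdBasis d i} T) g = ∫ x, g x * f' i x) ∧
      ∀ x, HasFDerivAt f (∑ i, (EuclideanSpace.proj i : Space d →L[ℝ] ℝ).smulRight (f' i x)) x := by
  obtain ⟨F, f', hF, -, hTF, hf', hder⟩ := hT.exists_representation
  obtain rfl := eq_of_continuous hf hF hTf hTF
  exact ⟨f', hf', hder⟩

theorem bounded (hT : IsRapidlySmooth T) {f : Space d → ℂ} (hf : Continuous f)
    (hTf : ∀ g : 𝓢(Space d, ℂ), T g = ∫ x, g x * f x) : ∃ C, ∀ x, ‖f x‖ ≤ C := by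
  obtain ⟨F, f', hF, hb, hTF, -⟩ := hT.exists_representation
  obtain rfl := eq_of_continuous hf hF hTf hTF
  exact hb

/-- The multiple of `T` by the polynomial (1+|x|²)^k is again rapidly smooth, so its continuous
representative is bounded. -/
theorem decay (hT : IsRapidlySmooth T) {f : Space d → ℂ} (hf : Continuous f)
    (hTf : ∀ g : 𝓢(Space d, ℂ), T g = ∫ x, g x * f x) (k : ℕ) : ∃ C, ∀ x, ‖x‖ ^ k * ‖f x‖ ≤ C := by
  let q : MvPolynomial (Fin d) ℝ := (1 + ∑ i, MvPolynomial.X i ^ 2) ^ k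
  have hq : ∀ x, cpoly q x = (((1 + ‖x‖ ^ 2) ^ k : ℝ) : ℂ) := by
    intro x
    simp [cpoly, polyFun, q, EuclideanSpace.norm_sq_eq]
  have hqc : Continuous (cpoly q) := (cpoly_hasTemperateGrowth q).1.continuous
  obtain ⟨C, hC⟩ := (hT.smulLeftCLM q).bounded (f := fun x => cpoly q x * f x) (hqc.mul hf)
    fun g => by
      rw [smulLeftCLM_apply_apply, hTf]
      refine integral_congr_ae (Eventually.of_forall fun x => ?_)
      simp only [SchwartzMap.smulLeftCLM_apply_apply (cpoly_hasTemperateGrowth q), smul_eq_mul]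
      ring
  refine ⟨C, fun x => ?_⟩
  refine le_trans ?_ (hC x)
  rw [norm_mul, hq, Complex.norm_real, Real.norm_of_nonneg (by positivity)]
  gcongr
  nlinarith [sq_nonneg (‖x‖ - 1)]

/-- A tempered distribution whose polynomial multiples belong to all Sobolev spaces is a Schwartz
function. -/
theorem exists_schwartz (hT : IsRapidlySmooth T) :
    ∃ F : 𝓢(Space d, ℂ), T = (F : 𝓢'(Space d, ℂ)) := by
  obtain ⟨f, -, hf, -, hTf, -⟩ := hT.exists_representation
  -- The class of continuous representatives of all rapidly smooth distributions is stable under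
  -- partial derivatives and decays rapidly.
  obtain ⟨F, rfl⟩ := IsDerivationClosed.exists_schwartz
    (𝒟 := fun f => ∃ T, IsRapidlySmooth T ∧ Continuous f ∧
      ∀ g : 𝓢(Space d, ℂ), T g = ∫ x, g x * f x)
    (fun f ⟨T, hT, hf, hTf⟩ => by
      obtain ⟨f', hf', hder⟩ := hT.hasFDerivAt hf hTf
      exact ⟨f', fun i => ⟨_, hT.lineDerivOp i, hf' i⟩, hder⟩)
    (fun f ⟨T, hT, hf, hTf⟩ => hT.decay hf hTf) ⟨T, hT, hf, hTf⟩
  refine ⟨F, ?_⟩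
  ext g
  rw [hTf, SchwartzMap.coe_apply]
  rfl

end IsRapidlySmooth

end RandomSmoothing

/-! ### Growth and coercivity of elliptic polynomials. -/

namespace RandomSmoothing

variable {d k : ℕ}

section PolyFun

variable (p q : MvPolynomial (Fin d) ℝ) (x : Space d)

theorem polyFun_add : polyFun (p + q) x = polyFun p x + polyFun q x := by simp [polyFun]

theorem polyFun_sub : polyFun (p - q) x = polyFun p x - polyFun q x := by simp [polyFun]

theorem polyFun_mul : polyFun (p * q) x = polyFun p x * polyFun q x := by simp [polyFun]

theorem polyFun_X (i : Fin d) : polyFun (MvPolynomial.X i) x = x i := by simp [polyFun]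

theorem polyFun_sum {ι : Type*} (s : Finset ι) (f : ι → MvPolynomial (Fin d) ℝ) :
    polyFun (∑ i ∈ s, f i) x = ∑ i ∈ s, polyFun (f i) x := by simp [polyFun]

theorem continuous_polyFun : Continuous (polyFun p) :=
  continuous_iff_continuousAt.2 fun x => (hasFDerivAt_polyFun p x).continuousAt

end PolyFun

theorem abs_coord_le_norm (x : Space d) (i : Fin d) : |x i| ≤ ‖x‖ := by
  simpa using PiLp.norm_apply_le x i

theorem exists_abs_polyFun_le (p : MvPolynomial (Fin d) ℝ) {n : ℕ} (hp : p.totalDegree ≤ n) :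
    ∃ C, 0 ≤ C ∧ ∀ x : Space d, |polyFun p x| ≤ C * (1 + ‖x‖) ^ n := by
  refine ⟨∑ m ∈ p.support, |p.coeff m|, by positivity, fun x => ?_⟩
  rw [polyFun, MvPolynomial.eval_eq', Finset.sum_mul]
  refine (Finset.abs_sum_le_sum_abs _ _).trans (Finset.sum_le_sum fun m hm => ?_)
  rw [abs_mul]
  gcongr
  rw [Finset.abs_prod]
  calc ∏ i, |x i ^ m i| ≤ ∏ i, (1 + ‖x‖) ^ m i := by
        refine Finset.prod_le_prod (fun i _ => abs_nonneg _) fun i _ => ?_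
        rw [abs_pow]
        gcongr
        linarith [abs_coord_le_norm x i]
    _ = (1 + ‖x‖) ^ ∑ i, m i := Finset.prod_pow_eq_pow_sum _ _ _
    _ ≤ (1 + ‖x‖) ^ n := by
        refine pow_le_pow_right₀ (by linarith [norm_nonneg x]) (le_trans ?_ hp)
        have := MvPolynomial.le_totalDegree hm
        rwa [Finsupp.sum_fintype _ _ (by simp)] at this

/-- Absorbs lower-order terms: either r ≤ C/δ and the left side is bounded, or C ≤ δ r. -/
theorem exists_mul_pow_le {C δ : ℝ} (hC : 0 ≤ C) (hδ : 0 < δ) (n : ℕ) :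
    ∃ C', 0 ≤ C' ∧ ∀ r : ℝ, 1 ≤ r → C * r ^ n ≤ δ * r ^ (n + 1) + C' := by
  refine ⟨C * (C / δ + 1) ^ n, by positivity, fun r hr => ?_⟩
  have hr0 : 0 ≤ r := by linarith
  rcases le_total r (C / δ) with h | h
  · have : C * r ^ n ≤ C * (C / δ + 1) ^ n := by gcongr; linarith
    have : 0 ≤ δ * r ^ (n + 1) := by positivity
    linarith
  · have h1 : C ≤ δ * r := by rwa [div_le_iff₀' hδ] at h
    have h2 : C * r ^ n ≤ δ * r * r ^ n := by gcongr
    have h3 : 0 ≤ C * (C / δ + 1) ^ n := by positivity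
    rw [pow_succ]; nlinarith

theorem polyFun_smul_of_isHomogeneous {p : MvPolynomial (Fin d) ℝ} {n : ℕ}
    (hp : p.IsHomogeneous n) (t : ℝ) (x : Space d) :
    polyFun p (t • x) = t ^ n * polyFun p x := by
  rw [polyFun, polyFun, MvPolynomial.eval_eq', MvPolynomial.eval_eq', Finset.mul_sum]
  refine Finset.sum_congr rfl fun m hm => ?_
  have h1 : ∑ i, m i = n := by
    have := hp (MvPolynomial.mem_support_iff.1 hm)
    rw [← this, Finsupp.weight_apply, Finsupp.sum_fintype _ _ (by simp)]
    simp
  simp only [PiLp.smul_apply, smul_eq_mul, mul_pow, Finset.prod_mul_distrib,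
    Finset.prod_pow_eq_pow_sum, h1]
  ring

theorem exists_mul_norm_pow_le_polyFun {p : MvPolynomial (Fin d) ℝ} {n : ℕ}
    (hp : p.IsHomogeneous n) (hn : n ≠ 0) (hpos : ∀ x : Space d, x ≠ 0 → 0 < polyFun p x) :
    ∃ c, 0 < c ∧ ∀ x : Space d, c * ‖x‖ ^ n ≤ polyFun p x := by
  obtain ⟨c, hc, hcs⟩ : ∃ c, 0 < c ∧ ∀ x ∈ Metric.sphere (0 : Space d) 1, c ≤ polyFun p x := by
    rcases (Metric.sphere (0 : Space d) 1).eq_empty_or_nonempty with h | h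
    · exact ⟨1, one_pos, by simp [h]⟩
    · obtain ⟨x, hx, hmin⟩ := (isCompact_sphere (0 : Space d) 1).exists_isMinOn h
        (continuous_polyFun p).continuousOn
      exact ⟨_, hpos x (fun h0 => by simp [h0] at hx), hmin⟩
  refine ⟨c, hc, fun x => ?_⟩
  by_cases hx : x = 0
  · have := polyFun_smul_of_isHomogeneous hp 0 (0 : Space d)
    rw [hx]
    simp [hn] at this ⊢
    rw [this]
  · have h0 : ‖x‖ ≠ 0 := norm_ne_zero_iff.2 hx
    have h1 := hcs (‖x‖⁻¹ • x) (by simp [norm_smul, h0])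
    rw [polyFun_smul_of_isHomogeneous hp, inv_pow, ← div_eq_inv_mul, le_div_iff₀ (by positivity)]
      at h1
    exact h1

/-- A polynomial with elliptic principal part is coercive. -/
theorem exists_coercive {V₀ R : MvPolynomial (Fin d) ℝ} (hk : 1 ≤ k)
    (hV₀ : V₀.IsHomogeneous (2 * k)) (hpos : ∀ x : Space d, x ≠ 0 → 0 < polyFun V₀ x)
    (hR : R.totalDegree ≤ 2 * k - 1) :
    ∃ c C, 0 < c ∧ 0 ≤ C ∧ ∀ x : Space d,
      c * (1 + ‖x‖) ^ (2 * k) - C ≤ polyFun V₀ x + polyFun R x := by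
  obtain ⟨c, hc, hcV⟩ := exists_mul_norm_pow_le_polyFun hV₀ (by omega) hpos
  obtain ⟨C, hC, hCR⟩ := exists_abs_polyFun_le R hR
  -- The factor 2^(2k) comes from 1 + |x| ≤ 2|x| when |x| ≥ 1; half of the resulting coefficient is
  -- spent on absorbing `R`.
  have hδ : 0 < c / 2 ^ (2 * k) / 2 := by positivity
  obtain ⟨C', hC', hCC⟩ := exists_mul_pow_le hC hδ (2 * k - 1)
  refine ⟨c / 2 ^ (2 * k) / 2, c + C', hδ, by positivity, fun x => ?_⟩
  have h1 := hcV x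
  have h2 := neg_le_of_abs_le (hCR x)
  have h3 := hCC (1 + ‖x‖) (by linarith [norm_nonneg x])
  rw [show 2 * k - 1 + 1 = 2 * k by omega] at h3
  have h4 : c / 2 ^ (2 * k) * (1 + ‖x‖) ^ (2 * k) - c ≤ c * ‖x‖ ^ (2 * k) := by
    have hx := norm_nonneg x
    rcases le_total 1 ‖x‖ with h | h
    · have : (1 + ‖x‖) ^ (2 * k) ≤ (2 * ‖x‖) ^ (2 * k) := by gcongr; linarith
      rw [mul_pow] at this
      have : c / 2 ^ (2 * k) * (1 + ‖x‖) ^ (2 * k) ≤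
          c / 2 ^ (2 * k) * (2 ^ (2 * k) * ‖x‖ ^ (2 * k)) := by gcongr
      rw [← mul_assoc, div_mul_cancel₀ _ (by positivity)] at this
      linarith
    · have : (1 + ‖x‖) ^ (2 * k) ≤ 2 ^ (2 * k) := by gcongr; linarith
      have : c / 2 ^ (2 * k) * (1 + ‖x‖) ^ (2 * k) ≤ c / 2 ^ (2 * k) * 2 ^ (2 * k) := by gcongr
      rw [div_mul_cancel₀ _ (by positivity)] at this
      have : 0 ≤ c * ‖x‖ ^ (2 * k) := by positivity
      linarith
  nlinarith

theorem totalDegree_pderiv_le (p : MvPolynomial (Fin d) ℝ) (i : Fin d) :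
    (MvPolynomial.pderiv i p).totalDegree ≤ p.totalDegree - 1 := by
  conv_lhs => rw [p.as_sum, map_sum]
  refine MvPolynomial.totalDegree_finsetSum_le fun m hm => ?_
  rw [MvPolynomial.pderiv_monomial]
  by_cases hi : m i = 0
  · simp [hi]
  · refine (MvPolynomial.totalDegree_monomial_le _ _).trans ?_
    have h1 := MvPolynomial.le_totalDegree hm
    have h2 : m - Finsupp.single i 1 + Finsupp.single i 1 = m :=
      tsub_add_cancel_of_le (by simpa using Nat.one_le_iff_ne_zero.2 hi)
    have h3 := congrArg (Finsupp.weight (1 : Fin d → ℕ)) h2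
    simp only [map_add, Finsupp.weight_apply, Finsupp.sum_fintype, Pi.one_apply, smul_eq_mul,
      mul_one, implies_true, Finsupp.single_apply, Finset.sum_ite_eq, Finset.mem_univ,
      if_true] at h3
    rw [Finsupp.sum_fintype _ _ (by simp)] at h1 ⊢
    simp only [id_eq]
    omega

/-- The polynomial `x · ∇V`. -/
def radialDeriv (V : MvPolynomial (Fin d) ℝ) : MvPolynomial (Fin d) ℝ :=
  ∑ i, MvPolynomial.X i * MvPolynomial.pderiv i V

theorem totalDegree_X_mul_pderiv_le {p : MvPolynomial (Fin d) ℝ} {n : ℕ} (hp : p.totalDegree ≤ n)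
    (i : Fin d) : (MvPolynomial.X i * MvPolynomial.pderiv i p).totalDegree ≤ n := by
  by_cases h : p.totalDegree = 0
  · rw [MvPolynomial.totalDegree_eq_zero_iff_eq_C] at h
    rw [h]; simp
  · refine (MvPolynomial.totalDegree_mul _ _).trans ?_
    rw [MvPolynomial.totalDegree_X]
    have := totalDegree_pderiv_le p i
    omega

theorem totalDegree_radialDeriv_le {p : MvPolynomial (Fin d) ℝ} {n : ℕ} (hp : p.totalDegree ≤ n) :
    (radialDeriv p).totalDegree ≤ n :=
  MvPolynomial.totalDegree_finsetSum_le fun i _ => totalDegree_X_mul_pderiv_le hp i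

namespace IsEllipticPotential

variable {V : MvPolynomial (Fin d) ℝ}

theorem totalDegree_le (hV : IsEllipticPotential k V) : V.totalDegree ≤ 2 * k := by
  obtain ⟨V₀, V₁, rfl, hV₀, -, hV₁⟩ := hV.elliptic
  refine (MvPolynomial.totalDegree_add _ _).trans (max_le hV₀.totalDegree_le ?_)
  omega

theorem exists_lower (hV : IsEllipticPotential k V) (hk : 1 ≤ k) :
    ∃ c C, 0 < c ∧ 0 ≤ C ∧ ∀ x : Space d, c * (1 + ‖x‖) ^ (2 * k) - C ≤ polyFun V x := by
  obtain ⟨V₀, V₁, rfl, hV₀, hpos, hV₁⟩ := hV.elliptic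
  simpa only [polyFun_add] using exists_coercive hk hV₀ hpos hV₁

/-- An elliptic potential controls all polynomials of at most the same degree. -/
theorem exists_abs_le (hV : IsEllipticPotential k V) (hk : 1 ≤ k) {p : MvPolynomial (Fin d) ℝ}
    (hp : p.totalDegree ≤ 2 * k) :
    ∃ C, 0 ≤ C ∧ ∀ x : Space d, |polyFun p x| ≤ C * (1 + polyFun V x) := by
  obtain ⟨c, C, hc, hC, h⟩ := hV.exists_lower hk
  obtain ⟨D, hD, hp⟩ := exists_abs_polyFun_le p hp
  refine ⟨D * ((1 + C) / c), by positivity, fun x => ?_⟩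
  refine (hp x).trans ?_
  rw [mul_assoc]
  gcongr
  rw [div_mul_eq_mul_div, le_div_iff₀ hc]
  have := hV.nonneg x
  nlinarith [h x]

/-- By Euler's identity x·∇V - V = (2k-1)V₀ + (x·∇V₁ - V₁). As 2k - 1 ≥ 1 and V₀ ≥ 0, coercivity
bounds this below. It is the input to the virial identity that bounds the kinetic energy from below.
-/
theorem exists_le_radialDeriv (hV : IsEllipticPotential k V) (hk : 1 ≤ k) :
    ∃ C, 0 ≤ C ∧ ∀ x : Space d, polyFun V x - C ≤ polyFun (radialDeriv V) x := by
  obtain ⟨V₀, V₁, rfl, hV₀, hpos, hV₁⟩ := hV.elliptic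
  have hR : (radialDeriv V₁ - V₁).totalDegree ≤ 2 * k - 1 :=
    (MvPolynomial.totalDegree_sub _ _).trans (max_le (totalDegree_radialDeriv_le hV₁) hV₁)
  obtain ⟨c, C, hc, hC, h⟩ := exists_coercive hk hV₀ hpos hR
  refine ⟨C, hC, fun x => ?_⟩
  have h1 : radialDeriv (V₀ + V₁) = (2 * k) • V₀ + radialDeriv V₁ := by
    rw [← hV₀.sum_X_mul_pderiv, radialDeriv, radialDeriv, ← Finset.sum_add_distrib]
    simp only [map_add, mul_add]
  have h2 : polyFun ((2 * k) • V₀) x = 2 * k * polyFun V₀ x := by simp [polyFun]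
  rw [h1, polyFun_add, polyFun_add, h2]
  have h3 := h x
  rw [polyFun_sub] at h3
  have h4 : 0 ≤ polyFun V₀ x := by
    obtain ⟨c, hc, h⟩ := exists_mul_norm_pow_le_polyFun hV₀ (by omega) hpos
    exact le_trans (by positivity) (h x)
  have h5 : (1 : ℝ) ≤ k := by exact_mod_cast hk
  have h6 : 0 ≤ c * (1 + ‖x‖) ^ (2 * k) := by positivity
  nlinarith

end IsEllipticPotential

end RandomSmoothing

/-! ### Integration by parts for the real L² pairing of Schwartz functions. -/

namespace RandomSmoothing

open LineDeriv

variable {d : ℕ}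

theorem schwartz_lineDerivOp_comm (f : 𝓢(Space d, ℂ)) (v w : Space d) :
    ∂_{v} (∂_{w} f) = ∂_{w} (∂_{v} f) := by
  have h : ∀ a : Space d, Function.HasTemperateGrowth fun ξ : Space d => inner ℝ ξ a := fun a => by
    fun_prop
  refine (FourierTransform.fourierEquiv ℂ 𝓢(Space d, ℂ)).injective ?_
  ext x
  simp only [FourierTransform.fourierEquiv_apply, SchwartzMap.fourier_lineDerivOp_eq,
    SchwartzMap.smulLeftCLM_apply_apply (h _), _root_.smul_apply, smul_eq_mul, Complex.real_smul]
  ring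

theorem schwartz_lineDerivOp_smulLeftCLM_real {b b' : Space d → ℝ} (hb : b.HasTemperateGrowth)
    (hb' : b'.HasTemperateGrowth) {m : Space d} (h : ∀ x, fderiv ℝ b x m = b' x)
    (g : 𝓢(Space d, ℂ)) :
    ∂_{m} (SchwartzMap.smulLeftCLM ℂ b g) =
      SchwartzMap.smulLeftCLM ℂ b (∂_{m} g) + SchwartzMap.smulLeftCLM ℂ b' g := by
  ext x
  rw [_root_.add_apply, SchwartzMap.smulLeftCLM_apply_apply hb,
    SchwartzMap.smulLeftCLM_apply_apply hb', SchwartzMap.lineDerivOp_apply_eq_fderiv,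
    SchwartzMap.lineDerivOp_apply_eq_fderiv]
  have h1 : (⇑(SchwartzMap.smulLeftCLM ℂ b g) : Space d → ℂ) = fun x => b x • g x := by
    funext y; rw [SchwartzMap.smulLeftCLM_apply_apply hb]
  rw [h1, fderiv_fun_smul (hb.1.differentiable (by simp) x) (g.differentiable x)]
  simp [h x]

theorem integrable_inner_schwartz (f g : 𝓢(Space d, ℂ)) :
    Integrable fun x => inner ℝ (f x) (g x) :=
  (SchwartzMap.pairing (innerSL ℝ : ℂ →L[ℝ] ℂ →L[ℝ] ℝ) f g).integrable

/-- The real `L²` inner product of Schwartz functions. -/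
def pair : 𝓢(Space d, ℂ) →ₗ[ℝ] 𝓢(Space d, ℂ) →ₗ[ℝ] ℝ :=
  LinearMap.mk₂ ℝ (fun f g => ∫ x, inner ℝ (f x) (g x))
    (fun f g h => by
      simp only [_root_.add_apply, inner_add_left]
      exact integral_add (integrable_inner_schwartz _ _) (integrable_inner_schwartz _ _))
    (fun c f g => by
      simp only [_root_.smul_apply, real_inner_smul_left, smul_eq_mul]
      exact integral_const_mul _ _)
    (fun f g h => by
      simp only [_root_.add_apply, inner_add_right]
      exact integral_add (integrable_inner_schwartz _ _) (integrable_inner_schwartz _ _))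
    (fun c f g => by
      simp only [_root_.smul_apply, real_inner_smul_right, smul_eq_mul]
      exact integral_const_mul _ _)

theorem pair_apply (f g : 𝓢(Space d, ℂ)) : pair f g = ∫ x, inner ℝ (f x) (g x) := rfl

theorem pair_comm (f g : 𝓢(Space d, ℂ)) : pair f g = pair g f := by
  simp only [pair_apply, real_inner_comm]

theorem pair_self (f : 𝓢(Space d, ℂ)) : pair f f = ∫ x, ‖f x‖ ^ 2 := by
  simp only [pair_apply, real_inner_self_eq_norm_sq]

theorem pair_self_nonneg (f : 𝓢(Space d, ℂ)) : 0 ≤ pair f f := by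
  rw [pair_self]; positivity

theorem pair_lineDerivOp (f g : 𝓢(Space d, ℂ)) (m : Space d) :
    pair (∂_{m} f) g = -pair f (∂_{m} g) := by
  have := SchwartzMap.integral_bilinear_lineDerivOp_right_eq_neg_left (μ := volume) f g
    (innerSL ℝ : ℂ →L[ℝ] ℂ →L[ℝ] ℝ) m
  rw [pair_apply, pair_apply]
  exact (neg_eq_iff_eq_neg.2 this).symm

theorem pair_laplacian (f g : 𝓢(Space d, ℂ)) :
    pair (Δ f) g = -∑ i, pair (∂_{stdBasis d i} f) (∂_{stdBasis d i} g) := by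
  rw [SchwartzMap.laplacian_eq_sum (stdBasis d), map_sum, LinearMap.sum_apply,
    ← Finset.sum_neg_distrib]
  exact Finset.sum_congr rfl fun i _ => pair_lineDerivOp _ _ _

theorem pair_smulLeftCLM {b : Space d → ℝ} (hb : b.HasTemperateGrowth)
    (f g : 𝓢(Space d, ℂ)) :
    pair (SchwartzMap.smulLeftCLM ℂ b f) g = pair f (SchwartzMap.smulLeftCLM ℂ b g) := by
  simp only [pair_apply, SchwartzMap.smulLeftCLM_apply_apply hb, real_inner_smul_left,
    real_inner_smul_right]

theorem pair_smulLeftCLM_self {b : Space d → ℝ} (hb : b.HasTemperateGrowth)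
    (f : 𝓢(Space d, ℂ)) :
    pair (SchwartzMap.smulLeftCLM ℂ b f) f = ∫ x, b x * ‖f x‖ ^ 2 := by
  simp only [pair_apply, SchwartzMap.smulLeftCLM_apply_apply hb, real_inner_smul_left,
    real_inner_self_eq_norm_sq]

theorem integrable_mul_norm_sq {b : Space d → ℝ} (hb : b.HasTemperateGrowth)
    (f : 𝓢(Space d, ℂ)) : Integrable fun x => b x * ‖f x‖ ^ 2 := by
  have := integrable_inner_schwartz (SchwartzMap.smulLeftCLM ℂ b f) f
  simpa only [SchwartzMap.smulLeftCLM_apply_apply hb, real_inner_smul_left,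
    real_inner_self_eq_norm_sq] using this

/-- Twice the pairing is ∫ b ∂(|f|²), integrated by parts. -/
theorem pair_smulLeftCLM_lineDerivOp {b b' : Space d → ℝ} (hb : b.HasTemperateGrowth)
    (hb' : b'.HasTemperateGrowth) {m : Space d}
    (h : ∀ x, fderiv ℝ b x m = b' x) (f : 𝓢(Space d, ℂ)) :
    2 * pair (SchwartzMap.smulLeftCLM ℂ b (∂_{m} f)) f = -∫ x, b' x * ‖f x‖ ^ 2 := by
  rw [← pair_smulLeftCLM_self hb']
  have h1 := pair_smulLeftCLM hb (∂_{m} f) f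
  rw [pair_lineDerivOp, schwartz_lineDerivOp_smulLeftCLM_real hb hb' h, map_add,
    pair_comm f, pair_comm f] at h1
  linarith

end RandomSmoothing

/-! ### The Agmon identity. -/

namespace RandomSmoothing

open TemperedDistribution LineDeriv

variable {d k : ℕ}

theorem polyFun_hasTemperateGrowth_real (V : MvPolynomial (Fin d) ℝ) :
    Function.HasTemperateGrowth (polyFun V) := by
  have := Complex.reCLM.hasTemperateGrowth.comp (polyFun_hasTemperateGrowth V)
  exact this

theorem toTemperedDistribution_injective {f g : 𝓢(Space d, ℂ)}
    (h : (f : 𝓢'(Space d, ℂ)) = (g : 𝓢'(Space d, ℂ))) : f = g := by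
  have h1 : (f : Space d → ℂ) = g :=
    IsRapidlySmooth.eq_of_continuous (T := (f : 𝓢'(Space d, ℂ))) f.continuous g.continuous
      (fun φ => by rw [SchwartzMap.coe_apply]; rfl) (fun φ => by rw [h, SchwartzMap.coe_apply]; rfl)
  exact DFunLike.coe_injective h1

theorem smulLeftCLM_ofReal {b : Space d → ℝ} (hb : b.HasTemperateGrowth) (f : 𝓢(Space d, ℂ)) :
    TemperedDistribution.smulLeftCLM ℂ (fun x => (b x : ℂ)) (f : 𝓢'(Space d, ℂ)) =
      (SchwartzMap.smulLeftCLM ℂ b f : 𝓢(Space d, ℂ)) := by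
  have hb' : Function.HasTemperateGrowth fun x => (b x : ℂ) :=
    Complex.ofRealCLM.hasTemperateGrowth.comp hb
  ext g
  rw [smulLeftCLM_apply_apply, SchwartzMap.coe_apply, SchwartzMap.coe_apply]
  refine integral_congr_ae (Eventually.of_forall fun x => ?_)
  simp only [SchwartzMap.smulLeftCLM_apply_apply hb', SchwartzMap.smulLeftCLM_apply_apply hb,
    smul_eq_mul, Complex.real_smul]
  ring

theorem hasTemperateGrowth_fderiv_apply {b : Space d → ℝ} (hb : b.HasTemperateGrowth)
    (m : Space d) : Function.HasTemperateGrowth fun x => fderiv ℝ b x m := by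
  have h : (fderiv ℝ b).HasTemperateGrowth := by
    refine ⟨hb.1.fderiv_right le_rfl, fun n => ?_⟩
    simpa only [norm_iteratedFDeriv_fderiv] using hb.2 (n + 1)
  exact (ContinuousLinearMap.apply ℝ ℝ m).hasTemperateGrowth.comp h

/-- The Agmon identity, as an inequality, for exponential type weights `a`
with logarithmic gradient `b`. -/
theorem integral_agmon_nonpos {V : MvPolynomial (Fin d) ℝ} {T : 𝓢'(Space d, ℂ)} {l : ℝ}
    (hT : schrodinger V T = (l : ℂ) • T) {a : Space d → ℂ} {b : Fin d → Space d → ℝ}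
    (ha : a.HasTemperateGrowth) (hb : ∀ i, (b i).HasTemperateGrowth)
    (hab : ∀ i x, fderiv ℝ a x (stdBasis d i) = b i x * a x) {w : 𝓢(Space d, ℂ)}
    (hw : TemperedDistribution.smulLeftCLM ℂ a T = w) :
    ∫ x, (polyFun V x - l - ∑ i, b i x ^ 2) * ‖w x‖ ^ 2 ≤ 0 := by
  have hVt := polyFun_hasTemperateGrowth_real V
  have hbc : ∀ i, Function.HasTemperateGrowth fun x => (b i x : ℂ) := fun i =>
    Complex.ofRealCLM.hasTemperateGrowth.comp (hb i)
  let b' : Fin d → Space d → ℝ := fun i x => fderiv ℝ (b i) x (stdBasis d i)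
  have hb' : ∀ i, (b' i).HasTemperateGrowth := fun i => hasTemperateGrowth_fderiv_apply (hb i) _
  let q : Fin d → Space d → ℝ := fun i x => b' i x + b i x ^ 2
  have hb2 : ∀ i, Function.HasTemperateGrowth fun x => b i x ^ 2 := fun i =>
    (hb i).pow 2
  have hq : ∀ i, (q i).HasTemperateGrowth := fun i => (hb' i).add (hb2 i)
  have hqc : ∀ i, Function.HasTemperateGrowth fun x => (q i x : ℂ) := fun i =>
    Complex.ofRealCLM.hasTemperateGrowth.comp (hq i)
  have hda' : ∀ i x, fderiv ℝ (fun x => (b i x : ℂ) * a x) x (stdBasis d i) = q i x * a x := by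
    intro i x
    have h1 : HasFDerivAt (fun x => (b i x : ℂ)) (Complex.ofRealCLM.comp (fderiv ℝ (b i) x)) x :=
      Complex.ofRealCLM.hasFDerivAt.comp x ((hb i).1.differentiable (by simp) x).hasFDerivAt
    have h2 := (ha.1.differentiable (by simp) x).hasFDerivAt
    rw [(h1.fun_mul h2).fderiv]
    simp only [_root_.add_apply, _root_.smul_apply, hab, ContinuousLinearMap.comp_apply,
      Complex.ofRealCLM_apply, smul_eq_mul, q, b']
    push_cast
    ring
  have key := laplacian_smulLeftCLM ha (fun i => (hbc i).mul ha) (fun i => (hqc i).mul ha) hab hda' T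
  have hΔ : Δ T = TemperedDistribution.smulLeftCLM ℂ (cpoly V) T - (l : ℂ) • T := by
    rw [← hT, schrodinger]
    change _ = TemperedDistribution.smulLeftCLM ℂ (cpoly V) T -
      (-Δ T + TemperedDistribution.smulLeftCLM ℂ (cpoly V) T)
    abel
  have hcomm : ∀ {c : Space d → ℂ}, c.HasTemperateGrowth →
      TemperedDistribution.smulLeftCLM ℂ (fun x => c x * a x) T =
        TemperedDistribution.smulLeftCLM ℂ c (w : 𝓢'(Space d, ℂ)) := fun hc => by
    rw [← hw, smulLeftCLM_smulLeftCLM_apply ha hc, mul_comm]; rfl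
  rw [hΔ, map_sub, map_smul, smulLeftCLM_smulLeftCLM_apply (cpoly_hasTemperateGrowth V) ha,
    hw] at key
  have h3 : TemperedDistribution.smulLeftCLM ℂ (cpoly V * a) T =
      (SchwartzMap.smulLeftCLM ℂ (polyFun V) w : 𝓢(Space d, ℂ)) :=
    (hcomm (cpoly_hasTemperateGrowth V)).trans (smulLeftCLM_ofReal hVt w)
  have h4 : ∀ i, TemperedDistribution.smulLeftCLM ℂ (fun x => (b i x : ℂ) * a x) T =
      (SchwartzMap.smulLeftCLM ℂ (b i) w : 𝓢(Space d, ℂ)) := fun i =>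
    (hcomm (hbc i)).trans (smulLeftCLM_ofReal (hb i) w)
  have h5 : ∀ i, TemperedDistribution.smulLeftCLM ℂ (fun x => (q i x : ℂ) * a x) T =
      (SchwartzMap.smulLeftCLM ℂ (q i) w : 𝓢(Space d, ℂ)) := fun i =>
    (hcomm (hqc i)).trans (smulLeftCLM_ofReal (hq i) w)
  -- The equation satisfied by w = aT; here q_i a is the second derivative of `a` in direction i.
  have hS : Δ w = SchwartzMap.smulLeftCLM ℂ (polyFun V) w - l • w +
      ∑ i, ((2 : ℝ) • ∂_{stdBasis d i} (SchwartzMap.smulLeftCLM ℂ (b i) w) -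
        SchwartzMap.smulLeftCLM ℂ (q i) w) := by
    apply toTemperedDistribution_injective
    have hl : l • w = (l : ℂ) • w := by ext x; simp
    have h2 : ∀ f : 𝓢(Space d, ℂ), (2 : ℝ) • f = (2 : ℂ) • f := fun f => by ext x; simp
    rw [hl]
    simp only [h2, map_add, map_sub, map_sum, map_smul]
    rw [← laplacian_toTemperedDistributionCLM_eq, key, h3]
    congr 1
    refine Finset.sum_congr rfl fun i _ => ?_
    rw [← lineDerivOp_toTemperedDistributionCLM_eq, ← h4 i, ← h5 i]
    rfl
  have hfin := congrArg (fun f => pair f w) hS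
  simp only [map_add, map_sub, map_sum, map_smul, LinearMap.add_apply, LinearMap.sub_apply,
    LinearMap.sum_apply, LinearMap.smul_apply, smul_eq_mul, pair_laplacian] at hfin
  -- Paired with w, all contributions of the derivatives of b_i cancel and only the square of the
  -- logarithmic gradient remains.
  have h6 : ∀ i, 2 * pair (∂_{stdBasis d i} (SchwartzMap.smulLeftCLM ℂ (b i) w)) w -
      pair (SchwartzMap.smulLeftCLM ℂ (q i) w) w = -∫ x, b i x ^ 2 * ‖w x‖ ^ 2 := by
    intro i
    have e1 := pair_smulLeftCLM_lineDerivOp (hb i) (hb' i) (fun x => rfl) w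
    rw [schwartz_lineDerivOp_smulLeftCLM_real (hb i) (hb' i) (fun x => rfl), map_add,
      LinearMap.add_apply, mul_add, e1, pair_smulLeftCLM_self (hb' i), pair_smulLeftCLM_self (hq i)]
    simp only [q, add_mul]
    rw [integral_add (integrable_mul_norm_sq (hb' i) w) (integrable_mul_norm_sq (hb2 i) w)]
    ring
  -- Discarding this kinetic energy turns the identity into the inequality.
  have h7 : 0 ≤ ∑ i, pair (∂_{stdBasis d i} w) (∂_{stdBasis d i} w) :=
    Finset.sum_nonneg fun i _ => pair_self_nonneg _
  rw [Finset.sum_congr rfl fun i _ => h6 i, Finset.sum_neg_distrib, pair_smulLeftCLM_self hVt,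
    pair_self] at hfin
  have hi1 := integrable_mul_norm_sq hVt w
  have hi2 : Integrable fun x => l * ‖w x‖ ^ 2 :=
    integrable_mul_norm_sq (.const l) w
  have hi3 : ∀ i ∈ Finset.univ, Integrable fun x => b i x ^ 2 * ‖w x‖ ^ 2 := fun i _ =>
    integrable_mul_norm_sq (hb2 i) w
  have h8 : ∫ x, (polyFun V x - l - ∑ i, b i x ^ 2) * ‖w x‖ ^ 2 =
      ((∫ x, polyFun V x * ‖w x‖ ^ 2) - l * ∫ x, ‖w x‖ ^ 2) -
        ∑ i, ∫ x, b i x ^ 2 * ‖w x‖ ^ 2 := by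
    rw [← integral_const_mul, ← integral_sub hi1 hi2, ← integral_finsetSum _ hi3]
    refine Eq.trans ?_ (integral_sub (hi1.sub hi2) (integrable_finsetSum _ hi3))
    simp only [sub_mul, Finset.sum_mul]
  rw [h8]
  linarith

end RandomSmoothing

/-! ### Polynomials times Gaussians as multipliers. -/

namespace RandomSmoothing

open TemperedDistribution LineDeriv

variable {d k : ℕ}

/-- The polynomial `|x|²`. -/
def normSqPoly (d : ℕ) : MvPolynomial (Fin d) ℝ := ∑ i, MvPolynomial.X i ^ 2

theorem polyFun_normSqPoly (x : Space d) : polyFun (normSqPoly d) x = ‖x‖ ^ 2 := by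
  simp [polyFun, normSqPoly, EuclideanSpace.norm_sq_eq]

theorem pderiv_normSqPoly (i : Fin d) :
    MvPolynomial.pderiv i (normSqPoly d) = MvPolynomial.C 2 * MvPolynomial.X i := by
  rw [normSqPoly, map_sum, Finset.sum_eq_single i]
  · rw [MvPolynomial.pderiv_pow, MvPolynomial.pderiv_X_self]
    simp [map_ofNat]
  · intro j _ hj
    rw [MvPolynomial.pderiv_pow, MvPolynomial.pderiv_X_of_ne hj]
    simp
  · simp

/-- The product of a polynomial with the Gaussian `exp (-ε |x|²)`. -/
def gaussPoly (ε : ℝ) (p : MvPolynomial (Fin d) ℝ) (x : Space d) : ℂ :=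
  ((polyFun p x * Real.exp (-ε * ‖x‖ ^ 2) : ℝ) : ℂ)

theorem hasFDerivAt_gaussPoly (ε : ℝ) (p : MvPolynomial (Fin d) ℝ) (x : Space d) :
    HasFDerivAt (gaussPoly ε p) (∑ i, (EuclideanSpace.proj i : Space d →L[ℝ] ℝ).smulRight
      (gaussPoly ε (MvPolynomial.pderiv i p - MvPolynomial.C (2 * ε) * MvPolynomial.X i * p) x))
      x := by
  have h1 : HasFDerivAt (fun y : Space d => Real.exp (-ε * ‖y‖ ^ 2)) _ x :=
    (by simpa only [polyFun_normSqPoly] using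
      (hasFDerivAt_polyFun (normSqPoly d) x).const_mul (-ε) :
      HasFDerivAt (fun y : Space d => -ε * ‖y‖ ^ 2) _ x).exp
  have h2 := Complex.ofRealCLM.hasFDerivAt.comp x ((hasFDerivAt_polyFun p x).fun_mul h1)
  refine HasFDerivAt.congr_fderiv h2 ?_
  refine ContinuousLinearMap.coe_injective ((stdBasis d).toBasis.ext fun j => ?_)
  have e : ∀ i, (EuclideanSpace.proj i : Space d →L[ℝ] ℝ) (stdBasis d j) = if i = j then 1 else 0 :=
    fun i => by simp [eq_comm]
  simp only [ContinuousLinearMap.coe_coe, OrthonormalBasis.coe_toBasis,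
    ContinuousLinearMap.comp_apply, _root_.add_apply, _root_.smul_apply, _root_.sum_apply,
    ContinuousLinearMap.smulRight_apply, e, pderiv_normSqPoly, smul_eq_mul, ite_smul, mul_ite,
    mul_one, mul_zero, zero_smul, one_smul, Finset.sum_ite_eq', Finset.mem_univ, if_true,
    Complex.ofRealCLM_apply, gaussPoly, polyFun_mul, polyFun_sub]
  norm_cast
  simp [polyFun]
  ring

theorem gaussPoly_decay {ε : ℝ} (hε : 0 < ε) (p : MvPolynomial (Fin d) ℝ) (k : ℕ) :
    ∃ C, ∀ x : Space d, ‖x‖ ^ k * ‖gaussPoly ε p x‖ ≤ C := by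
  obtain ⟨C, hC, hp⟩ := exists_abs_polyFun_le p le_rfl
  let n := k + p.totalDegree
  refine ⟨C * ((2 / ε) ^ n * n.factorial * Real.exp ε), fun x => ?_⟩
  have h0 := norm_nonneg x
  have h1 : ((1 + ‖x‖) ^ n) ≤ (2 / ε) ^ n * (ε * (1 + ‖x‖ ^ 2)) ^ n := by
    rw [← mul_pow]
    gcongr
    rw [← mul_assoc, div_mul_cancel₀ _ hε.ne']
    nlinarith [sq_nonneg (‖x‖ - 1)]
  have h2 : (ε * (1 + ‖x‖ ^ 2)) ^ n ≤ n.factorial * Real.exp (ε * (1 + ‖x‖ ^ 2)) := by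
    have := Real.pow_div_factorial_le_exp (x := ε * (1 + ‖x‖ ^ 2)) (by positivity) n
    rwa [div_le_iff₀' (by positivity)] at this
  have h3 : Real.exp (ε * (1 + ‖x‖ ^ 2)) * Real.exp (-ε * ‖x‖ ^ 2) = Real.exp ε := by
    rw [← Real.exp_add]; congr 1; ring
  rw [gaussPoly, Complex.norm_real, norm_mul, Real.norm_eq_abs, Real.norm_eq_abs, Real.abs_exp]
  calc ‖x‖ ^ k * (|polyFun p x| * Real.exp (-ε * ‖x‖ ^ 2))
      ≤ (1 + ‖x‖) ^ k * (C * (1 + ‖x‖) ^ p.totalDegree * Real.exp (-ε * ‖x‖ ^ 2)) := by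
        gcongr
        · linarith
        · exact hp x
    _ = C * ((1 + ‖x‖) ^ n * Real.exp (-ε * ‖x‖ ^ 2)) := by rw [pow_add]; ring
    _ ≤ C * ((2 / ε) ^ n * (n.factorial * Real.exp (ε * (1 + ‖x‖ ^ 2))) *
          Real.exp (-ε * ‖x‖ ^ 2)) := by
        gcongr
        exact h1.trans (by gcongr)
    _ = C * ((2 / ε) ^ n * n.factorial * Real.exp ε) := by rw [← h3]; ring

theorem exists_schwartz_gaussPoly {ε : ℝ} (hε : 0 < ε) (p : MvPolynomial (Fin d) ℝ) :
    ∃ F : 𝓢(Space d, ℂ), ⇑F = gaussPoly ε p :=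
  IsDerivationClosed.exists_schwartz (𝒟 := fun f => ∃ p, f = gaussPoly ε p)
    (fun _ ⟨p, hf⟩ => ⟨_, fun _ => ⟨_, rfl⟩, fun x => hf ▸ hasFDerivAt_gaussPoly ε p x⟩)
    (fun _ ⟨p, hf⟩ k => hf ▸ gaussPoly_decay hε p k) ⟨p, rfl⟩

theorem gaussPoly_hasTemperateGrowth {ε : ℝ} (hε : 0 < ε) (p : MvPolynomial (Fin d) ℝ) :
    (gaussPoly ε p).HasTemperateGrowth := by
  obtain ⟨F, hF⟩ := exists_schwartz_gaussPoly hε p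
  exact hF ▸ F.hasTemperateGrowth

theorem fderiv_gaussPoly (ε : ℝ) (p : MvPolynomial (Fin d) ℝ) (x : Space d) (i : Fin d) :
    fderiv ℝ (gaussPoly ε p) x (stdBasis d i) =
      gaussPoly ε (MvPolynomial.pderiv i p - MvPolynomial.C (2 * ε) * MvPolynomial.X i * p) x := by
  rw [(hasFDerivAt_gaussPoly ε p x).fderiv, _root_.sum_apply, Finset.sum_eq_single i]
  · simp
  · intro j _ hj; simp [hj]
  · simp

theorem cpoly_mul_gaussPoly (ε : ℝ) (p q : MvPolynomial (Fin d) ℝ) :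
    cpoly p * gaussPoly ε q = gaussPoly ε (p * q) := by
  funext x
  simp [cpoly, gaussPoly, polyFun_mul, mul_assoc]

theorem smulLeftCLM_coe_Lp {g : Space d → ℂ} (hg : g.HasTemperateGrowth) {u : L2 d}
    (hgu : MemLp (fun x => g x * u x) 2 volume) :
    TemperedDistribution.smulLeftCLM ℂ g (u : 𝓢'(Space d, ℂ)) = (hgu.toLp _ : L2 d) := by
  ext φ
  rw [smulLeftCLM_apply_apply, Lp.toTemperedDistribution_apply, Lp.toTemperedDistribution_apply]
  refine integral_congr_ae ?_
  filter_upwards [hgu.coeFn_toLp] with x hx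
  rw [hx, SchwartzMap.smulLeftCLM_apply_apply hg]
  simp only [smul_eq_mul]
  ring

theorem memLp_bounded_mul {g : Space d → ℂ} (hg : Continuous g) {C : ℝ} (hC : ∀ x, ‖g x‖ ≤ C)
    (u : L2 d) : MemLp (fun x => g x * u x) 2 volume :=
  (Lp.memLp u).of_le_mul (hg.aestronglyMeasurable.mul (Lp.aestronglyMeasurable u))
    (c := C) (Eventually.of_forall fun x => by rw [norm_mul]; gcongr; exact hC x)

/-- Nothing is known yet about the decay of `u`, but a polynomial times a Gaussian is bounded, so
the bootstrap starts from `u` in L² alone. -/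
theorem isRapidlySmooth_gaussPoly {V : MvPolynomial (Fin d) ℝ} {u : L2 d} {l : ℂ}
    (hu : schrodinger V (u : 𝓢'(Space d, ℂ)) = l • (u : 𝓢'(Space d, ℂ))) {ε : ℝ} (hε : 0 < ε)
    (p : MvPolynomial (Fin d) ℝ) :
    IsRapidlySmooth (TemperedDistribution.smulLeftCLM ℂ (gaussPoly ε p) (u : 𝓢'(Space d, ℂ))) := by
  intro q n
  rw [smulLeftCLM_smulLeftCLM_apply (gaussPoly_hasTemperateGrowth hε p)
    (cpoly_hasTemperateGrowth q), mul_comm, cpoly_mul_gaussPoly]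
  refine memSobolev_of_multipliers hu (fun a => ∃ p, a = gaussPoly ε p) ?_ ?_ ?_ ?_ n _ ⟨_, rfl⟩
  · rintro _ ⟨p, rfl⟩
    exact gaussPoly_hasTemperateGrowth hε p
  · rintro _ ⟨p, rfl⟩
    exact ⟨_, cpoly_mul_gaussPoly ε V p⟩
  · rintro _ ⟨p, rfl⟩ i
    exact ⟨_, ⟨_, rfl⟩, fun x => fderiv_gaussPoly ε p x i⟩
  · rintro _ ⟨p, rfl⟩
    obtain ⟨C, hC⟩ := gaussPoly_decay hε p 0
    simp only [pow_zero, one_mul] at hC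
    have ht := gaussPoly_hasTemperateGrowth hε p
    exact memSobolev_zero_iff.2 ⟨_, smulLeftCLM_coe_Lp ht (memLp_bounded_mul ht.1.continuous hC u)⟩

end RandomSmoothing

/-! ### Eigenfunctions are Schwartz functions. -/

namespace RandomSmoothing

open TemperedDistribution LineDeriv

variable {d k : ℕ}

theorem japanese_hasTemperateGrowth : Function.HasTemperateGrowth fun x : Space d =>
    (1 + ‖x‖ ^ 2)⁻¹ := by
  simpa only [Real.rpow_neg_one] using
    Function.hasTemperateGrowth_one_add_norm_sq_rpow (Space d) (-1)

/-- A bound on Gaussian regularisations of weighted eigenfunctions which is uniform in the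
regularisation parameter. -/
theorem exists_eLpNorm_gaussian_weight_le {V : MvPolynomial (Fin d) ℝ}
    (hV : IsEllipticPotential k V) (hk : 1 ≤ k) {u : L2 d} {l : ℝ}
    (hu : schrodinger V (u : 𝓢'(Space d, ℂ)) = (l : ℂ) • (u : 𝓢'(Space d, ℂ))) (m : ℕ) :
    ∃ ε₀ > 0, ∃ M : ℝ≥0, ∀ ε > 0, ε ≤ ε₀ →
      eLpNorm (fun x => gaussPoly ε ((1 + normSqPoly d) ^ m) x * u x) 2 volume ≤ M := by
  obtain ⟨c, C, hc, hC, hVc⟩ := hV.exists_lower hk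
  -- With these constants V - l - ∑ b_i² ≥ (c/2)(1+|x|²) - K, which is at least K once 1+|x|² ≥ R.
  -- Where 1+|x|² ≤ R, the weight squared is at most R^(2m), whatever ε is.
  let K : ℝ := C + |l| + 8 * m ^ 2 + 1
  have hK : 0 < K := by positivity
  let R : ℝ := 4 * K / c
  let M : ℝ := 2 * (R ^ (2 * m) * ∫ x, ‖u x‖ ^ 2)
  have hM : 0 ≤ M := by positivity
  -- ε ≤ 1 and ε ≤ c/16 give 8ε² ≤ c/2, so the Gaussian part of the gradient is absorbed by the
  -- potential.
  refine ⟨min 1 (c / 16), by positivity, (√M).toNNReal, fun ε hε hε₀ => ?_⟩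
  have hε1 : ε ≤ 1 := hε₀.trans (min_le_left _ _)
  have hε2 : ε ≤ c / 16 := hε₀.trans (min_le_right _ _)
  let a : Space d → ℂ := gaussPoly ε ((1 + normSqPoly d) ^ m)
  have ha : a.HasTemperateGrowth := gaussPoly_hasTemperateGrowth hε _
  have haeq : ∀ x, a x = (((1 + ‖x‖ ^ 2) ^ m * Real.exp (-ε * ‖x‖ ^ 2) : ℝ) : ℂ) := fun x => by
    simp only [a, gaussPoly, polyFun, map_pow, map_add, map_one]
    rw [← polyFun_normSqPoly, polyFun]
  obtain ⟨w, hw⟩ := (isRapidlySmooth_gaussPoly hu hε ((1 + normSqPoly d) ^ m)).exists_schwartz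
  have hau : MemLp (fun x => a x * u x) 2 volume := by
    obtain ⟨C, hC⟩ := gaussPoly_decay hε ((1 + normSqPoly d) ^ m) 0
    simp only [pow_zero, one_mul] at hC
    exact memLp_bounded_mul ha.1.continuous hC u
  have hwau : ⇑w =ᵐ[volume] fun x => a x * u x := by
    refine ae_eq_of_forall_integral_schwartz_mul w.continuous.locallyIntegrable
      (hau.locallyIntegrable (by simp)) fun g => ?_
    have h1 := congrArg (fun T => T g) (hw.symm.trans (smulLeftCLM_coe_Lp ha hau))
    simp only [SchwartzMap.coe_apply, Lp.toTemperedDistribution_apply, smul_eq_mul] at h1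
    rw [h1]
    refine integral_congr_ae ?_
    filter_upwards [hau.coeFn_toLp] with x hx
    rw [hx]
  -- The logarithmic gradient of (1+|x|²)^m exp(-ε|x|²).
  let b : Fin d → Space d → ℝ := fun i x => (2 * m * (1 + ‖x‖ ^ 2)⁻¹ - 2 * ε) * x i
  have hb : ∀ i, (b i).HasTemperateGrowth := fun i => by
    have h1 : Function.HasTemperateGrowth fun x : Space d => x i :=
      (EuclideanSpace.proj i : Space d →L[ℝ] ℝ).hasTemperateGrowth
    have h2 := japanese_hasTemperateGrowth (d := d)
    fun_prop
  have hab : ∀ i x, fderiv ℝ a x (stdBasis d i) = b i x * a x := by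
    intro i x
    rw [fderiv_gaussPoly]
    simp only [a, b, gaussPoly]
    norm_cast
    rw [← mul_assoc]
    congr 1
    have h0 : (1 + ‖x‖ ^ 2) ≠ 0 := by positivity
    have h1 : polyFun (1 + normSqPoly d) x = 1 + ‖x‖ ^ 2 := by
      rw [polyFun_add, polyFun_normSqPoly]; simp [polyFun]
    rw [MvPolynomial.pderiv_pow, polyFun_sub, polyFun_mul, polyFun_mul, polyFun_mul, polyFun_mul,
      polyFun_X, map_add, pderiv_normSqPoly]
    have h2 : ∀ n : ℕ, polyFun ((1 + normSqPoly d) ^ n) x = (1 + ‖x‖ ^ 2) ^ n := fun n => by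
      rw [← h1]; simp [polyFun]
    rw [h2, h2]
    rcases m with _ | m
    · simp [polyFun]
    · simp [polyFun]; field_simp; ring
  have hag := integral_agmon_nonpos hu ha hb hab hw
  have hbt : Function.HasTemperateGrowth fun x => polyFun V x - l - ∑ i, b i x ^ 2 := by
    have := polyFun_hasTemperateGrowth_real V
    fun_prop
  have hi1 := integrable_mul_norm_sq hbt w
  have hw2 : Integrable fun x => ‖w x‖ ^ 2 := (w.memLp 2 volume).integrable_norm_pow (by simp)
  have hu2 : Integrable fun x => ‖u x‖ ^ 2 := (Lp.memLp u).integrable_norm_pow (by simp)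
  have hpt : ∀ᵐ x, K * ‖w x‖ ^ 2 ≤ (polyFun V x - l - ∑ i, b i x ^ 2) * ‖w x‖ ^ 2 +
      2 * K * (R ^ (2 * m) * ‖u x‖ ^ 2) := by
    filter_upwards [hwau] with x hx
    have hx0 := norm_nonneg x
    have hbs : ∑ i, b i x ^ 2 ≤ 8 * m ^ 2 + c / 2 * (1 + ‖x‖ ^ 2) := by
      simp only [b, mul_pow]
      rw [← Finset.mul_sum]
      have h1 : ∑ i, x i ^ 2 = ‖x‖ ^ 2 := by rw [EuclideanSpace.norm_sq_eq]; simp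
      rw [h1]
      have h2 : (1 + ‖x‖ ^ 2)⁻¹ * ‖x‖ ≤ 1 := by
        rw [inv_mul_le_iff₀ (by positivity)]; nlinarith [sq_nonneg (‖x‖ - 1)]
      have h3 : ((1 + ‖x‖ ^ 2)⁻¹ * ‖x‖) ^ 2 ≤ 1 := pow_le_one₀ (by positivity) h2
      have h4 : (2 * (m : ℝ) * (1 + ‖x‖ ^ 2)⁻¹ - 2 * ε) ^ 2 * ‖x‖ ^ 2 ≤
          8 * m ^ 2 * ((1 + ‖x‖ ^ 2)⁻¹ * ‖x‖) ^ 2 + 8 * ε ^ 2 * ‖x‖ ^ 2 := by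
        nlinarith [sq_nonneg (2 * (m : ℝ) * ((1 + ‖x‖ ^ 2)⁻¹ * ‖x‖) + 2 * ε * ‖x‖)]
      have h5 : ε ^ 2 ≤ c / 16 := by nlinarith
      nlinarith [sq_nonneg ‖x‖, sq_nonneg (m : ℝ)]
    have hVx : c * (1 + ‖x‖ ^ 2) - C ≤ polyFun V x := by
      refine le_trans ?_ (hVc x)
      have h1 : (1 + ‖x‖) ^ 2 ≤ (1 + ‖x‖) ^ (2 * k) :=
        pow_le_pow_right₀ (by linarith) (by omega)
      have : 1 + ‖x‖ ^ 2 ≤ (1 + ‖x‖) ^ (2 * k) := by nlinarith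
      nlinarith
    have hlow : c / 2 * (1 + ‖x‖ ^ 2) - K ≤ polyFun V x - l - ∑ i, b i x ^ 2 := by
      simp only [K]
      linarith [le_abs_self l]
    rcases le_total R (1 + ‖x‖ ^ 2) with h | h
    · have h1 : 2 * K ≤ c / 2 * (1 + ‖x‖ ^ 2) := by
        simp only [R] at h
        rw [div_le_iff₀ hc] at h
        linarith
      have h2 : 0 ≤ 2 * K * (R ^ (2 * m) * ‖u x‖ ^ 2) := by positivity
      have h3 : K * ‖w x‖ ^ 2 ≤ (polyFun V x - l - ∑ i, b i x ^ 2) * ‖w x‖ ^ 2 := by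
        gcongr; linarith
      linarith
    · have h1 : ‖w x‖ ^ 2 ≤ R ^ (2 * m) * ‖u x‖ ^ 2 := by
        rw [hx, norm_mul, mul_pow, haeq, Complex.norm_real, Real.norm_of_nonneg (by positivity)]
        gcongr
        rw [pow_mul', ]
        gcongr
        have : Real.exp (-ε * ‖x‖ ^ 2) ≤ 1 := Real.exp_le_one_iff.2 (by nlinarith [sq_nonneg ‖x‖])
        calc _ ≤ (1 + ‖x‖ ^ 2) ^ m * 1 := by gcongr
          _ ≤ R ^ m := by rw [mul_one]; gcongr
      have h2 : -K * ‖w x‖ ^ 2 ≤ (polyFun V x - l - ∑ i, b i x ^ 2) * ‖w x‖ ^ 2 := by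
        gcongr
        have : 0 ≤ c / 2 * (1 + ‖x‖ ^ 2) := by positivity
        linarith
      nlinarith
  have hint : ∫ x, ‖w x‖ ^ 2 ≤ M := by
    have h1 := integral_mono_ae (hw2.const_mul K)
      (hi1.add ((hu2.const_mul (R ^ (2 * m))).const_mul (2 * K))) hpt
    have h2 := integral_add hi1 ((hu2.const_mul (R ^ (2 * m))).const_mul (2 * K))
    simp only [Pi.add_apply] at h1
    rw [h2, integral_const_mul, integral_const_mul, integral_const_mul] at h1
    have h3 : K * ∫ x, ‖w x‖ ^ 2 ≤ K * M := by simp only [M]; linarith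
    exact le_of_mul_le_mul_left h3 hK
  rw [← eLpNorm_congr_ae hwau]
  rw [(w.memLp 2 volume).eLpNorm_eq_integral_rpow_norm (by simp) (by simp)]
  change _ ≤ ENNReal.ofReal (√M)
  apply ENNReal.ofReal_le_ofReal
  simp only [ENNReal.toReal_ofNat, Real.rpow_ofNat]
  rw [Real.sqrt_eq_rpow, one_div]
  gcongr

/-- Let ε tend to 0 in the uniform Gaussian bound and apply Fatou's lemma. -/
theorem memLp_polynomial_mul_eigenfunction {V : MvPolynomial (Fin d) ℝ}
    (hV : IsEllipticPotential k V) (hk : 1 ≤ k) {u : L2 d} {l : ℝ}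
    (hu : schrodinger V (u : 𝓢'(Space d, ℂ)) = (l : ℂ) • (u : 𝓢'(Space d, ℂ)))
    (p : MvPolynomial (Fin d) ℝ) : MemLp (fun x => cpoly p x * u x) 2 volume := by
  obtain ⟨C, hC, hp⟩ := exists_abs_polyFun_le p le_rfl
  let m := p.totalDegree
  obtain ⟨ε₀, hε₀, M, hM⟩ := exists_eLpNorm_gaussian_weight_le hV hk hu m
  have hcont : ∀ q, Continuous (cpoly (d := d) q) := fun q =>
    (cpoly_hasTemperateGrowth q).1.continuous
  have hweight : MemLp (fun x => cpoly ((1 + normSqPoly d) ^ m) x * u x) 2 volume := by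
    refine ⟨(hcont _).aestronglyMeasurable.mul (Lp.aestronglyMeasurable u), ?_⟩
    refine lt_of_le_of_lt (Lp.eLpNorm_lim_le_liminf_eLpNorm
      (f := fun (n : ℕ) x => gaussPoly (ε₀ / (n + 1)) ((1 + normSqPoly d) ^ m) x * u x)
      (fun n => ?_) _ (Eventually.of_forall fun x => ?_)) ?_
    · exact (gaussPoly_hasTemperateGrowth (by positivity) _).1.continuous.aestronglyMeasurable.mul
        (Lp.aestronglyMeasurable u)
    · refine Tendsto.mul_const _ ?_
      have h1 : Tendsto (fun n : ℕ => ε₀ / ((n : ℝ) + 1)) atTop (𝓝 0) :=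
        tendsto_const_div_atTop_nhds_zero_nat ε₀ |>.comp (tendsto_add_atTop_nat 1) |>.congr
          fun n => by simp
      have h2 : Continuous fun ε : ℝ => gaussPoly ε ((1 + normSqPoly d) ^ m) x := by
        unfold gaussPoly; fun_prop
      have h3 := (h2.tendsto 0).comp h1
      simpa [gaussPoly, cpoly, Function.comp_def] using! h3
    · refine lt_of_le_of_lt (liminf_le_of_le (by isBoundedDefault) fun b hb => ?_)
        (ENNReal.coe_lt_top (r := M))
      obtain ⟨n, hn⟩ := hb.exists
      exact hn.trans (hM _ (by positivity) (div_le_self hε₀.le (by linarith [n.cast_nonneg (α := ℝ)])))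
  refine hweight.of_le_mul ((hcont _).aestronglyMeasurable.mul (Lp.aestronglyMeasurable u))
    (c := C * 2 ^ m) (Eventually.of_forall fun x => ?_)
  rw [norm_mul, norm_mul, ← mul_assoc]
  gcongr
  have h1 : polyFun ((1 + normSqPoly d) ^ m) x = (1 + ‖x‖ ^ 2) ^ m := by
    rw [← polyFun_normSqPoly]; simp [polyFun]
  rw [cpoly, cpoly, Complex.norm_real, Complex.norm_real, h1, Real.norm_eq_abs,
    Real.norm_of_nonneg (by positivity), mul_assoc, ← mul_pow]
  refine (hp x).trans ?_
  gcongr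
  nlinarith [sq_nonneg (‖x‖ - 1)]

/-- Eigenfunctions of `-Δ + V` are Schwartz functions. -/
theorem exists_schwartz_eigenfunction {V : MvPolynomial (Fin d) ℝ}
    (hV : IsEllipticPotential k V) (hk : 1 ≤ k) {u : L2 d} {l : ℝ}
    (hu : schrodinger V (u : 𝓢'(Space d, ℂ)) = (l : ℂ) • (u : 𝓢'(Space d, ℂ))) :
    ∃ f : 𝓢(Space d, ℂ), f.toLp 2 volume = u := by
  -- The same bootstrap, now with bare polynomials: their products with `u` are known to be in L².
  have h : IsRapidlySmooth (u : 𝓢'(Space d, ℂ)) := by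
    intro q n
    refine memSobolev_of_multipliers hu (fun a => ∃ p, a = cpoly p) ?_ ?_ ?_ ?_ n _ ⟨_, rfl⟩
    · rintro _ ⟨p, rfl⟩
      exact cpoly_hasTemperateGrowth p
    · rintro _ ⟨p, rfl⟩
      exact ⟨_, (cpoly_mul V p).symm⟩
    · rintro _ ⟨p, rfl⟩ i
      exact ⟨_, ⟨_, rfl⟩, fun x => fderiv_cpoly p x i⟩
    · rintro _ ⟨p, rfl⟩
      exact memSobolev_zero_iff.2 ⟨_, smulLeftCLM_coe_Lp (cpoly_hasTemperateGrowth p)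
        (memLp_polynomial_mul_eigenfunction hV hk hu p)⟩
  obtain ⟨f, hf⟩ := h.exists_schwartz
  refine ⟨f, ?_⟩
  have h1 : Lp.toTemperedDistributionCLM ℂ volume 2 (f.toLp 2 volume - u) = 0 := by
    rw [map_sub, Lp.toTemperedDistributionCLM_apply, Lp.toTemperedDistributionCLM_apply,
      Lp.toTemperedDistribution_toLp_eq, hf, sub_self]
  have h2 : f.toLp 2 volume - u ∈ (Lp.toTemperedDistributionCLM ℂ (volume : Measure (Space d)) 2).ker :=
    h1
  rw [Lp.ker_toTemperedDistributionCLM_eq_bot] at h2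
  exact sub_eq_zero.1 h2

end RandomSmoothing

/-! ### Virial identity and energy bounds. -/

namespace RandomSmoothing

open TemperedDistribution LineDeriv

variable {d k : ℕ}

/-- `f` is a Schwartz eigenfunction of `-Δ + V`. -/
def IsSchwartzEigenfunction (V : MvPolynomial (Fin d) ℝ) (l : ℝ) (f : 𝓢(Space d, ℂ)) : Prop :=
  -Δ f + SchwartzMap.smulLeftCLM ℂ (polyFun V) f = l • f

/-- The kinetic energy of `f`. -/
def kinetic (f : 𝓢(Space d, ℂ)) : ℝ := ∑ i, pair (∂_{stdBasis d i} f) (∂_{stdBasis d i} f)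

theorem kinetic_nonneg (f : 𝓢(Space d, ℂ)) : 0 ≤ kinetic f :=
  Finset.sum_nonneg fun _ _ => pair_self_nonneg _

theorem isSchwartzEigenfunction_of_toLp {V : MvPolynomial (Fin d) ℝ} {l : ℝ} {u : L2 d}
    (hu : schrodinger V (u : 𝓢'(Space d, ℂ)) = (l : ℂ) • (u : 𝓢'(Space d, ℂ)))
    {f : 𝓢(Space d, ℂ)} (hf : f.toLp 2 volume = u) : IsSchwartzEigenfunction V l f := by
  apply toTemperedDistribution_injective
  have hl : l • f = (l : ℂ) • f := by ext x; simp
  rw [hl, map_add, map_neg, map_smul, ← laplacian_toTemperedDistributionCLM_eq,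
    ← smulLeftCLM_ofReal (polyFun_hasTemperateGrowth_real V),
    ← Lp.toTemperedDistribution_toLp_eq (p := 2), hf, ← hu]
  rfl

theorem fderiv_polyFun (p : MvPolynomial (Fin d) ℝ) (x : Space d) (i : Fin d) :
    fderiv ℝ (polyFun p) x (stdBasis d i) = polyFun (MvPolynomial.pderiv i p) x := by
  rw [(hasFDerivAt_polyFun p x).fderiv, _root_.sum_apply, Finset.sum_eq_single i]
  · simp
  · intro j _ hj; simp [hj]
  · simp

theorem pair_polyFun_lineDerivOp (p : MvPolynomial (Fin d) ℝ) (i : Fin d) (f : 𝓢(Space d, ℂ)) :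
    2 * pair (SchwartzMap.smulLeftCLM ℂ (polyFun p) (∂_{stdBasis d i} f)) f =
      -∫ x, polyFun (MvPolynomial.pderiv i p) x * ‖f x‖ ^ 2 :=
  pair_smulLeftCLM_lineDerivOp (polyFun_hasTemperateGrowth_real p)
    (polyFun_hasTemperateGrowth_real _) (fun x => fderiv_polyFun p x i) f

theorem lineDerivOp_smulLeftCLM_polyFun (p : MvPolynomial (Fin d) ℝ) (i : Fin d)
    (f : 𝓢(Space d, ℂ)) : ∂_{stdBasis d i} (SchwartzMap.smulLeftCLM ℂ (polyFun p) f) =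
      SchwartzMap.smulLeftCLM ℂ (polyFun p) (∂_{stdBasis d i} f) +
        SchwartzMap.smulLeftCLM ℂ (polyFun (MvPolynomial.pderiv i p)) f :=
  schwartz_lineDerivOp_smulLeftCLM_real (polyFun_hasTemperateGrowth_real p)
    (polyFun_hasTemperateGrowth_real _) (fun x => fderiv_polyFun p x i) f

theorem lineDerivOp_smulLeftCLM_coord (i j : Fin d) (f : 𝓢(Space d, ℂ)) :
    ∂_{stdBasis d j} (SchwartzMap.smulLeftCLM ℂ (polyFun (MvPolynomial.X i)) f) =
      SchwartzMap.smulLeftCLM ℂ (polyFun (MvPolynomial.X i)) (∂_{stdBasis d j} f) +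
        if j = i then f else 0 := by
  rw [lineDerivOp_smulLeftCLM_polyFun]
  congr 1
  ext x
  rw [SchwartzMap.smulLeftCLM_apply_apply (polyFun_hasTemperateGrowth_real _)]
  split_ifs with h
  · subst h; simp [polyFun]
  · rw [MvPolynomial.pderiv_X_of_ne (Ne.symm h)]; simp [polyFun]

namespace IsSchwartzEigenfunction

variable {V : MvPolynomial (Fin d) ℝ} {l : ℝ} {f : 𝓢(Space d, ℂ)}

theorem kinetic_add (hf : IsSchwartzEigenfunction V l f) :
    kinetic f + ∫ x, polyFun V x * ‖f x‖ ^ 2 = l * pair f f := by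
  have := congrArg (fun g => pair g f) hf
  simp only [map_add, map_neg, map_smul, LinearMap.add_apply, LinearMap.neg_apply,
    LinearMap.smul_apply, smul_eq_mul, pair_laplacian, neg_neg,
    pair_smulLeftCLM_self (polyFun_hasTemperateGrowth_real V)] at this
  exact this

/-- Pair the eigenvalue equation with x_i ∂_i f, one coordinate of the dilation generator, and
eliminate `l` by the energy identity. -/
theorem virial_coord (hf : IsSchwartzEigenfunction V l f) (i : Fin d) :
    2 * pair (∂_{stdBasis d i} f) (∂_{stdBasis d i} f) =
      ∫ x, polyFun (MvPolynomial.X i * MvPolynomial.pderiv i V) x * ‖f x‖ ^ 2 := by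
  have hX := polyFun_hasTemperateGrowth_real (MvPolynomial.X i : MvPolynomial (Fin d) ℝ)
  have hV := polyFun_hasTemperateGrowth_real V
  have half : ∀ g : 𝓢(Space d, ℂ), 2 * pair g
      (SchwartzMap.smulLeftCLM ℂ (polyFun (MvPolynomial.X i)) (∂_{stdBasis d i} g)) =
        -pair g g := fun g => by
    rw [pair_comm, pair_polyFun_lineDerivOp, pair_self]
    simp [polyFun]
  let A := SchwartzMap.smulLeftCLM ℂ (polyFun (MvPolynomial.X i)) (∂_{stdBasis d i} f)
  have h1 := congrArg (fun g => 2 * pair g A) hf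
  simp only [map_add, map_neg, map_smul, LinearMap.add_apply, LinearMap.neg_apply,
    LinearMap.smul_apply, smul_eq_mul, pair_laplacian, neg_neg] at h1
  have h2 : ∀ j, pair (∂_{stdBasis d j} f) (∂_{stdBasis d j} A) =
      pair (∂_{stdBasis d j} f) (SchwartzMap.smulLeftCLM ℂ (polyFun (MvPolynomial.X i))
        (∂_{stdBasis d i} (∂_{stdBasis d j} f))) +
      if j = i then pair (∂_{stdBasis d i} f) (∂_{stdBasis d i} f) else 0 := fun j => by
    simp only [A]
    rw [lineDerivOp_smulLeftCLM_coord, map_add, schwartz_lineDerivOp_comm]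
    split_ifs with h
    · rw [h]
    · simp
  have h3 : 2 * ∑ j, pair (∂_{stdBasis d j} f) (∂_{stdBasis d j} A) =
      -kinetic f + 2 * pair (∂_{stdBasis d i} f) (∂_{stdBasis d i} f) := by
    simp only [h2, Finset.sum_add_distrib, mul_add, Finset.mul_sum, half]
    rw [Finset.sum_neg_distrib, kinetic, ← Finset.mul_sum]
    simp
  have h4 : 2 * pair (SchwartzMap.smulLeftCLM ℂ (polyFun V) f) A =
      -((∫ x, polyFun V x * ‖f x‖ ^ 2) +
        ∫ x, polyFun (MvPolynomial.X i * MvPolynomial.pderiv i V) x * ‖f x‖ ^ 2) := by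
    have e1 : SchwartzMap.smulLeftCLM ℂ (polyFun V) A =
        SchwartzMap.smulLeftCLM ℂ (polyFun (MvPolynomial.X i * V)) (∂_{stdBasis d i} f) := by
      simp only [A]
      rw [SchwartzMap.smulLeftCLM_smulLeftCLM_apply hV hX]
      congr 2
      funext x
      simp [polyFun, mul_comm]
    rw [pair_smulLeftCLM hV, e1, pair_comm, pair_polyFun_lineDerivOp,
      ← integral_add (integrable_mul_norm_sq hV f)
        (integrable_mul_norm_sq (polyFun_hasTemperateGrowth_real _) f)]
    congr 1
    refine integral_congr_ae (Eventually.of_forall fun x => ?_)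
    simp [polyFun]
    ring
  have h5 : 2 * pair f A = -pair f f := half f
  have h6 := hf.kinetic_add
  linear_combination h1 - h3 - h4 + h6 + l * h5

theorem virial (hf : IsSchwartzEigenfunction V l f) :
    2 * kinetic f = ∫ x, polyFun (radialDeriv V) x * ‖f x‖ ^ 2 := by
  simp only [radialDeriv, polyFun_sum, Finset.sum_mul]
  rw [integral_finsetSum _ fun i _ =>
    integrable_mul_norm_sq (polyFun_hasTemperateGrowth_real _) f, kinetic, Finset.mul_sum]
  exact Finset.sum_congr rfl fun i _ => hf.virial_coord i

/-- Take the squared norm of the equation. The cross term equals 2∫V|∇f|² - ∫(ΔV)|f|², and its first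
part is nonnegative because V ≥ 0. -/
theorem norm_sq_laplacian_add_le (hf : IsSchwartzEigenfunction V l f) (hV0 : ∀ x, 0 ≤ polyFun V x) :
    pair (Δ f) (Δ f) + ∫ x, polyFun V x ^ 2 * ‖f x‖ ^ 2 ≤ l ^ 2 * pair f f +
      ∑ i, ∫ x, polyFun (MvPolynomial.pderiv i (MvPolynomial.pderiv i V)) x * ‖f x‖ ^ 2 := by
  have hV := polyFun_hasTemperateGrowth_real V
  have h1 := congrArg (fun g => pair g g) hf
  simp only [map_add, map_neg, map_smul, LinearMap.add_apply, LinearMap.neg_apply,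
    LinearMap.smul_apply, smul_eq_mul] at h1
  have h2 : pair (SchwartzMap.smulLeftCLM ℂ (polyFun V) f) (SchwartzMap.smulLeftCLM ℂ (polyFun V) f)
      = ∫ x, polyFun V x ^ 2 * ‖f x‖ ^ 2 := by
    simp only [pair_apply, SchwartzMap.smulLeftCLM_apply_apply hV, real_inner_self_eq_norm_sq,
      norm_smul, mul_pow, Real.norm_eq_abs, sq_abs]
  have h3 : ∀ i, -∫ x, polyFun (MvPolynomial.pderiv i (MvPolynomial.pderiv i V)) x * ‖f x‖ ^ 2 ≤
      2 * pair (∂_{stdBasis d i} f)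
        (∂_{stdBasis d i} (SchwartzMap.smulLeftCLM ℂ (polyFun V) f)) := fun i => by
    rw [lineDerivOp_smulLeftCLM_polyFun, map_add, mul_add,
      ← pair_smulLeftCLM (polyFun_hasTemperateGrowth_real (MvPolynomial.pderiv i V)),
      pair_polyFun_lineDerivOp, pair_comm, pair_smulLeftCLM_self hV]
    have : 0 ≤ ∫ x, polyFun V x * ‖(∂_{stdBasis d i} f) x‖ ^ 2 :=
      integral_nonneg fun x => mul_nonneg (hV0 x) (by positivity)
    linarith
  have h4 := Finset.sum_le_sum fun i (_ : i ∈ Finset.univ) => h3 i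
  rw [Finset.sum_neg_distrib, ← Finset.mul_sum] at h4
  rw [pair_comm (SchwartzMap.smulLeftCLM ℂ (polyFun V) f) (Δ f), h2,
    pair_laplacian f (SchwartzMap.smulLeftCLM ℂ (polyFun V) f)] at h1
  linarith

end IsSchwartzEigenfunction

/-- Energy bounds for normalized eigenfunctions. -/
theorem exists_energy_bounds {V : MvPolynomial (Fin d) ℝ} (hV : IsEllipticPotential k V)
    (hk : 1 ≤ k) : ∃ c C : ℝ, 0 < c ∧ 0 ≤ C ∧ ∀ (l : ℝ) (f : 𝓢(Space d, ℂ)),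
      IsSchwartzEigenfunction V l f → pair f f = 1 →
      0 ≤ l ∧ kinetic f ≤ l ∧ (∫ x, polyFun V x * ‖f x‖ ^ 2) ≤ l ∧
      c * l - C ≤ kinetic f ∧ c * l - C ≤ ∫ x, polyFun V x * ‖f x‖ ^ 2 ∧
      pair (Δ f) (Δ f) ≤ C * (1 + l) ^ 2 ∧ (∫ x, polyFun V x ^ 2 * ‖f x‖ ^ 2) ≤ C * (1 + l) ^ 2 := by
  obtain ⟨A, hA, hA'⟩ := hV.exists_le_radialDeriv hk
  obtain ⟨B, hB, hB'⟩ := hV.exists_abs_le hk (totalDegree_radialDeriv_le hV.totalDegree_le)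
  choose D hD hD' using fun i => hV.exists_abs_le hk
    (p := MvPolynomial.pderiv i (MvPolynomial.pderiv i V))
    ((totalDegree_pderiv_le _ _).trans ((Nat.sub_le _ _).trans ((totalDegree_pderiv_le _ _).trans
      ((Nat.sub_le _ _).trans hV.totalDegree_le))))
  have hDs : 0 ≤ ∑ i, D i := Finset.sum_nonneg fun i _ => hD i
  -- With kinetic energy K and potential energy P, K + P = l. Then P - A ≤ 2K gives 3K ≥ l - A,
  -- while 2K ≤ B(1+P) gives (2+B)P ≥ 2l - B.
  refine ⟨min (1 / 3) (2 / (2 + B)), A + B + ∑ i, D i + 1, by positivity, by positivity,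
    fun l f hf h1 => ?_⟩
  have hVt := polyFun_hasTemperateGrowth_real V
  have e1 := hf.kinetic_add
  have e2 := hf.virial
  have e3 := hf.norm_sq_laplacian_add_le hV.nonneg
  rw [h1, mul_one] at e1 e3
  have hK := kinetic_nonneg f
  have hP : 0 ≤ ∫ x, polyFun V x * ‖f x‖ ^ 2 :=
    integral_nonneg fun x => mul_nonneg (hV.nonneg x) (by positivity)
  have hl : 0 ≤ l := by linarith
  rw [pair_self] at h1
  have iV := integrable_mul_norm_sq hVt f
  have i1 : Integrable fun x => ‖f x‖ ^ 2 := by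
    simpa using integrable_mul_norm_sq (b := fun _ => 1) (.const 1) f
  have key : ∀ {p : MvPolynomial (Fin d) ℝ} {E : ℝ},
      (∀ x, |polyFun p x| ≤ E * (1 + polyFun V x)) →
      ∫ x, polyFun p x * ‖f x‖ ^ 2 ≤ E * (1 + ∫ x, polyFun V x * ‖f x‖ ^ 2) := by
    intro p E hp
    rw [← h1, ← integral_add i1 iV, ← integral_const_mul]
    refine integral_mono (integrable_mul_norm_sq (polyFun_hasTemperateGrowth_real p) f)
      ((i1.add iV).const_mul E) fun x => ?_
    have := mul_le_mul_of_nonneg_right ((le_abs_self _).trans (hp x)) (sq_nonneg ‖f x‖)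
    dsimp only
    linarith
  have r1 : (∫ x, polyFun V x * ‖f x‖ ^ 2) - A ≤ 2 * kinetic f := by
    rw [e2]
    have : (∫ x, polyFun V x * ‖f x‖ ^ 2) - A =
        ∫ x, polyFun V x * ‖f x‖ ^ 2 - A * ‖f x‖ ^ 2 := by
      rw [integral_sub iV (i1.const_mul A), integral_const_mul, h1, mul_one]
    rw [this]
    refine integral_mono (iV.sub (i1.const_mul A))
      (integrable_mul_norm_sq (polyFun_hasTemperateGrowth_real _) f) fun x => ?_
    have := mul_le_mul_of_nonneg_right (hA' x) (sq_nonneg ‖f x‖)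
    dsimp only
    linarith
  have r2 := key hB'
  rw [← e2] at r2
  have r3 : ∑ i, ∫ x, polyFun (MvPolynomial.pderiv i (MvPolynomial.pderiv i V)) x * ‖f x‖ ^ 2 ≤
      (∑ i, D i) * (1 + l) := by
    rw [Finset.sum_mul]
    refine Finset.sum_le_sum fun i _ => (key (hD' i)).trans ?_
    have := hD i
    gcongr
    linarith
  have r4 : l ^ 2 + (∑ i, D i) * (1 + l) ≤ (A + B + ∑ i, D i + 1) * (1 + l) ^ 2 := by
    have : 0 ≤ (A + B) * (1 + l) ^ 2 := by positivity
    have : 0 ≤ (∑ i, D i) * (l * (1 + l)) := by positivity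
    nlinarith
  have hLap := pair_self_nonneg (Δ f)
  have hV2 : 0 ≤ ∫ x, polyFun V x ^ 2 * ‖f x‖ ^ 2 := by positivity
  refine ⟨hl, by linarith, by linarith, ?_, ?_, by linarith, by linarith⟩
  · have : min (1 / 3) (2 / (2 + B)) * l ≤ 1 / 3 * l := by gcongr; exact min_le_left _ _
    linarith
  · have h2 : min (1 / 3) (2 / (2 + B)) * l ≤ 2 / (2 + B) * l := by gcongr; exact min_le_right _ _
    have h3 : 2 / (2 + B) * l ≤ (∫ x, polyFun V x * ‖f x‖ ^ 2) + B := by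
      rw [div_mul_eq_mul_div, div_le_iff₀ (by positivity)]
      nlinarith
    linarith

end RandomSmoothing

/-! ### Where eigenfunctions carry their mass, in frequency and in space. -/

namespace RandomSmoothing

open LineDeriv FourierTransform

variable {d k : ℕ}

theorem integral_norm_sq_fourier_eq_pair (f : 𝓢(Space d, ℂ)) :
    ∫ ξ, ‖𝓕 f ξ‖ ^ 2 = pair f f := by
  rw [pair_self]
  exact SchwartzMap.integral_norm_sq_fourier f

theorem fourier_lineDerivOp_apply (f : 𝓢(Space d, ℂ)) (i : Fin d) (ξ : Space d) :
    𝓕 (∂_{stdBasis d i} f) ξ = 2 * Real.pi * Complex.I * (ξ i * 𝓕 f ξ) := by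
  have h : Function.HasTemperateGrowth fun x : Space d => inner ℝ x (stdBasis d i) := by fun_prop
  rw [SchwartzMap.fourier_lineDerivOp_eq, _root_.smul_apply, SchwartzMap.smulLeftCLM_apply_apply h,
    EuclideanSpace.basisFun_apply, EuclideanSpace.inner_single_right]
  simp

theorem normSq_hasTemperateGrowth : Function.HasTemperateGrowth fun x : Space d => ‖x‖ ^ 2 := by
  fun_prop

theorem kinetic_eq_fourier (f : 𝓢(Space d, ℂ)) :
    kinetic f = (2 * Real.pi) ^ 2 * ∫ ξ, ‖ξ‖ ^ 2 * ‖𝓕 f ξ‖ ^ 2 := by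
  have h : ∀ i, pair (∂_{stdBasis d i} f) (∂_{stdBasis d i} f) =
      ∫ ξ, (2 * Real.pi) ^ 2 * (ξ i ^ 2 * ‖𝓕 f ξ‖ ^ 2) := fun i => by
    rw [← integral_norm_sq_fourier_eq_pair]
    refine integral_congr_ae (Eventually.of_forall fun ξ => ?_)
    simp only [fourier_lineDerivOp_apply, norm_mul, mul_pow, Complex.norm_I, Complex.norm_real,
      Real.norm_eq_abs, sq_abs, Complex.norm_ofNat]
    ring
  have hi : ∀ i : Fin d, Integrable fun ξ : Space d =>
      (2 * Real.pi) ^ 2 * (ξ i ^ 2 * ‖𝓕 f ξ‖ ^ 2) := fun i => by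
    refine Integrable.const_mul ?_ _
    refine integrable_mul_norm_sq ?_ (𝓕 f)
    exact (EuclideanSpace.proj i : Space d →L[ℝ] ℝ).hasTemperateGrowth.pow 2
  rw [kinetic, Finset.sum_congr rfl fun i _ => h i, ← integral_finsetSum _ fun i _ => hi i,
    ← integral_const_mul]
  refine integral_congr_ae (Eventually.of_forall fun ξ => ?_)
  simp only [← Finset.mul_sum, ← Finset.sum_mul]
  rw [EuclideanSpace.norm_sq_eq]
  simp

theorem pair_laplacian_self_eq_fourier (f : 𝓢(Space d, ℂ)) :
    pair (Δ f) (Δ f) = (2 * Real.pi) ^ 4 * ∫ ξ, (‖ξ‖ ^ 2) ^ 2 * ‖𝓕 f ξ‖ ^ 2 := by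
  have h : ∀ ξ, 𝓕 (Δ f) ξ = -((2 * Real.pi) ^ 2 * (‖ξ‖ ^ 2 : ℝ)) * 𝓕 f ξ := fun ξ => by
    rw [SchwartzMap.laplacian_eq_sum (stdBasis d)]
    have e : 𝓕 (∑ i, ∂_{stdBasis d i} (∂_{stdBasis d i} f)) =
        ∑ i, 𝓕 (∂_{stdBasis d i} (∂_{stdBasis d i} f)) :=
      map_sum (FourierTransform.fourierEquiv ℂ 𝓢(Space d, ℂ)) _ _
    rw [e, _root_.sum_apply]
    simp only [fourier_lineDerivOp_apply]
    rw [EuclideanSpace.norm_sq_eq]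
    push_cast
    rw [Finset.mul_sum, ← Finset.sum_neg_distrib, Finset.sum_mul]
    refine Finset.sum_congr rfl fun i _ => ?_
    rw [Real.norm_eq_abs, ← Complex.ofReal_pow, sq_abs]
    push_cast
    linear_combination (2 * Real.pi) ^ 2 * ((ξ i : ℝ) : ℂ) ^ 2 * 𝓕 f ξ * Complex.I_sq
  rw [← integral_norm_sq_fourier_eq_pair, ← integral_const_mul]
  refine integral_congr_ae (Eventually.of_forall fun ξ => ?_)
  simp only [h]
  rw [norm_mul, norm_neg, ← Complex.ofReal_ofNat, ← Complex.ofReal_mul, ← Complex.ofReal_pow,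
    ← Complex.ofReal_mul, Complex.norm_real, Real.norm_of_nonneg (by positivity)]
  ring

/-- Normalized eigenfunctions of large eigenvalue `l` carry a fixed proportion of their mass on the
frequencies of size at least `√l`. -/
theorem exists_le_fourier_mass {V : MvPolynomial (Fin d) ℝ} (hV : IsEllipticPotential k V)
    (hk : 1 ≤ k) : ∃ c m L : ℝ, 0 < c ∧ 0 < m ∧ 1 ≤ L ∧ ∀ (l : ℝ) (f : 𝓢(Space d, ℂ)),
      IsSchwartzEigenfunction V l f → pair f f = 1 → L ≤ l →
      m ≤ ∫ ξ in {ξ | c * l ≤ ‖ξ‖ ^ 2}, ‖𝓕 f ξ‖ ^ 2 := by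
  obtain ⟨c, C, hc, hC, h⟩ := exists_energy_bounds hV hk
  have hπ : 0 < 2 * Real.pi := by positivity
  -- For l ≥ 1 and C ≤ cl/2, |ξ|² has mean at least A = cl/(2(2π)²) and second moment at most B =
  -- 4(C+1)l²/(2π)⁴ under |𝓕f|². Paley–Zygmund yields the threshold A/2 and the mass A²/(4B).
  refine ⟨c / (4 * (2 * Real.pi) ^ 2), c ^ 2 / (64 * (C + 1)), max 1 (2 * C / c), by positivity,
    by positivity, le_max_left _ _, fun l f hf h1 hl => ?_⟩
  obtain ⟨-, -, -, hK, -, hL, -⟩ := h l f hf h1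
  have hl1 : 1 ≤ l := (le_max_left _ _).trans hl
  have hl2 : C ≤ c * l / 2 := by
    have := (le_max_right _ _).trans hl
    rw [div_le_iff₀ hc] at this
    linarith
  rw [kinetic_eq_fourier] at hK
  rw [pair_laplacian_self_eq_fourier] at hL
  have ht := normSq_hasTemperateGrowth (d := d)
  have i0 : Integrable fun ξ => ‖𝓕 f ξ‖ ^ 2 := by
    simpa using integrable_mul_norm_sq (b := fun _ => 1) (.const 1) (𝓕 f)
  have hpz := sq_le_mul_setIntegral_of_le_integral (μ := volume) (f := fun ξ : Space d => ‖ξ‖ ^ 2)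
    (ρ := fun ξ => ‖𝓕 f ξ‖ ^ 2) (by fun_prop) (fun ξ => sq_nonneg _) i0
    (by rw [integral_norm_sq_fourier_eq_pair, h1]) (integrable_mul_norm_sq ht (𝓕 f))
    (integrable_mul_norm_sq (ht.pow 2) (𝓕 f)) (A := c * l / 2 / (2 * Real.pi) ^ 2)
    (B := 4 * (C + 1) * l ^ 2 / (2 * Real.pi) ^ 4) (by positivity)
    (by rw [div_le_iff₀' (by positivity)]; linarith)
    (by
      rw [le_div_iff₀' (by positivity)]
      refine hL.trans ?_
      calc C * (1 + l) ^ 2 ≤ (C + 1) * (2 * l) ^ 2 := by gcongr <;> linarith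
        _ = _ := by ring)
  have e1 : c * l / 2 / (2 * Real.pi) ^ 2 / 2 = c / (4 * (2 * Real.pi) ^ 2) * l := by
    field_simp; ring
  rw [e1] at hpz
  have e2 : (c * l / 2 / (2 * Real.pi) ^ 2) ^ 2 / 4 =
      4 * (C + 1) * l ^ 2 / (2 * Real.pi) ^ 4 * (c ^ 2 / (64 * (C + 1))) := by
    field_simp; ring
  rw [e2] at hpz
  exact le_of_mul_le_mul_left hpz (by positivity)

/-- Normalized eigenfunctions of large eigenvalue `l` carry a fixed proportion of their mass at
distance at least `l ^ (1 / (2 k))`. -/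
theorem exists_le_mass {V : MvPolynomial (Fin d) ℝ} (hV : IsEllipticPotential k V)
    (hk : 1 ≤ k) : ∃ c m L : ℝ, 0 < c ∧ 0 < m ∧ 1 ≤ L ∧ ∀ (l : ℝ) (f : 𝓢(Space d, ℂ)),
      IsSchwartzEigenfunction V l f → pair f f = 1 → L ≤ l →
      m ≤ ∫ x in {x | c * l ≤ (1 + ‖x‖) ^ (2 * k)}, ‖f x‖ ^ 2 := by
  obtain ⟨c, C, hc, hC, h⟩ := exists_energy_bounds hV hk
  obtain ⟨D, hD, hVD⟩ := exists_abs_polyFun_le V hV.totalDegree_le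
  refine ⟨c / (4 * (D + 1)), c ^ 2 / (64 * (C + 1)), max 1 (2 * C / c), by positivity,
    by positivity, le_max_left _ _, fun l f hf h1 hl => ?_⟩
  obtain ⟨-, -, -, -, hP, -, hL⟩ := h l f hf h1
  have hl1 : 1 ≤ l := (le_max_left _ _).trans hl
  have hl2 : C ≤ c * l / 2 := by
    have := (le_max_right _ _).trans hl
    rw [div_le_iff₀ hc] at this
    linarith
  have ht := polyFun_hasTemperateGrowth_real V
  have i0 : Integrable fun x => ‖f x‖ ^ 2 := by
    simpa using integrable_mul_norm_sq (b := fun _ => 1) (.const 1) f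
  have hpz := sq_le_mul_setIntegral_of_le_integral (μ := volume) (f := polyFun V)
    (ρ := fun x => ‖f x‖ ^ 2) (continuous_polyFun V).measurable (fun x => sq_nonneg _) i0
    (by rw [← pair_self, h1]) (integrable_mul_norm_sq ht f)
    (integrable_mul_norm_sq (ht.pow 2) f) (A := c * l / 2)
    (B := 4 * (C + 1) * l ^ 2) (by positivity) (by linarith)
    (by
      refine hL.trans ?_
      calc C * (1 + l) ^ 2 ≤ (C + 1) * (2 * l) ^ 2 := by gcongr <;> linarith
        _ = _ := by ring)
  have e2 : (c * l / 2) ^ 2 / 4 = 4 * (C + 1) * l ^ 2 * (c ^ 2 / (64 * (C + 1))) := by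
    field_simp; ring
  rw [e2] at hpz
  -- Paley–Zygmund gives mass where V is large; V ≤ (D+1)(1+|x|)^(2k) converts this into a lower
  -- bound on |x|.
  refine (le_of_mul_le_mul_left hpz (by positivity)).trans ?_
  refine setIntegral_mono_set i0.integrableOn (Eventually.of_forall fun x => sq_nonneg _)
    (Eventually.of_forall fun x hx => ?_)
  have hx : c * l / 2 / 2 ≤ polyFun V x := hx
  have h2 := hx.trans ((le_abs_self _).trans (hVD x))
  change c / (4 * (D + 1)) * l ≤ (1 + ‖x‖) ^ (2 * k)
  rw [div_mul_eq_mul_div, div_le_iff₀ (by positivity)]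
  have : 0 ≤ (1 + ‖x‖) ^ (2 * k) := by positivity
  nlinarith

end RandomSmoothing

/-! ### Phase space count of the eigenvalues. -/

namespace RandomSmoothing

open FourierTransform

variable {d k : ℕ}

theorem inner_toLp_toLp (f g : 𝓢(Space d, ℂ)) :
    inner ℂ (f.toLp 2 volume) (g.toLp 2 volume) = ∫ x, inner ℂ (f x) (g x) := by
  rw [L2.inner_def]
  refine integral_congr_ae ?_
  filter_upwards [f.coeFn_toLp 2 volume, g.coeFn_toLp 2 volume] with x hf hg
  rw [hf, hg]

theorem orthonormal_fourier {ι : Type*} {f : ι → 𝓢(Space d, ℂ)}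
    (h : Orthonormal ℂ fun i => (f i).toLp 2 volume) :
    Orthonormal ℂ fun i => (𝓕 (f i)).toLp 2 volume := by
  classical
  rw [orthonormal_iff_ite] at h ⊢
  intro i j
  rw [← h i j, inner_toLp_toLp, inner_toLp_toLp, SchwartzMap.integral_inner_fourier_fourier]

theorem L2_norm_sq_eq_integral (u : L2 d) : ‖u‖ ^ 2 = ∫ x, ‖u x‖ ^ 2 := by
  rw [@norm_sq_eq_re_inner ℂ, L2.inner_def, ← integral_re (L2.integrable_inner u u)]
  simp only [inner_self_eq_norm_sq]

theorem norm_toLp_sq {g : Space d → ℂ} (hg : MemLp g 2 volume) :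
    ‖hg.toLp g‖ ^ 2 = ∫ x, ‖g x‖ ^ 2 := by
  rw [L2_norm_sq_eq_integral]
  refine integral_congr_ae ?_
  filter_upwards [hg.coeFn_toLp] with x hx
  rw [hx]

theorem pair_self_eq_norm_sq (f : 𝓢(Space d, ℂ)) : pair f f = ‖f.toLp 2 volume‖ ^ 2 := by
  rw [pair_self]
  exact (norm_toLp_sq (f.memLp 2 volume)).symm

/-- Bessel's inequality for the values at `x` of frequency truncations. -/
theorem sum_norm_sq_fourierInv_smulLeftCLM_le {ι : Type*} {f : ι → 𝓢(Space d, ℂ)}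
    (h : Orthonormal ℂ fun i => (f i).toLp 2 volume) (s : Finset ι) {b : Space d → ℝ}
    (hb : b.HasTemperateGrowth) (hb2 : MemLp b 2 volume) (x : Space d) :
    ∑ i ∈ s, ‖𝓕⁻ (SchwartzMap.smulLeftCLM ℂ b (𝓕 (f i))) x‖ ^ 2 ≤ ∫ ξ, b ξ ^ 2 := by
  -- The value at x of the truncation is the inner product of `𝓕 (f i)` with this function, and
  -- Plancherel keeps the `𝓕 (f i)` orthonormal.
  let e : Space d → ℂ := fun ξ =>
    (b ξ : ℂ) * Complex.exp (((-(2 * Real.pi * inner ℝ ξ x) : ℝ) : ℂ) * Complex.I)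
  have hne : ∀ ξ, ‖e ξ‖ = ‖b ξ‖ := fun ξ => by
    rw [norm_mul, Complex.norm_exp_ofReal_mul_I, mul_one, Complex.norm_real]
  have hec : Continuous e := by
    have := hb.1.continuous
    fun_prop
  have he : MemLp e 2 volume :=
    hb2.of_le hec.aestronglyMeasurable (Eventually.of_forall fun ξ => (hne ξ).le)
  have hbes := (orthonormal_fourier h).sum_inner_products_le (s := s) (x := he.toLp e)
  have hnorm : ‖he.toLp e‖ ^ 2 = ∫ ξ, b ξ ^ 2 := by
    simp only [norm_toLp_sq, hne, Real.norm_eq_abs, sq_abs]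
  rw [hnorm] at hbes
  refine le_trans (le_of_eq (Finset.sum_congr rfl fun i _ => ?_)) hbes
  rw [norm_inner_symm, L2.inner_def, SchwartzMap.fourierInv_coe, Real.fourierInv_eq']
  congr 2
  refine integral_congr_ae ?_
  filter_upwards [he.coeFn_toLp, (𝓕 (f i)).coeFn_toLp 2 volume] with ξ h1 h2
  rw [h1, h2, SchwartzMap.smulLeftCLM_apply_apply hb, RCLike.inner_apply]
  simp only [e, map_mul, Complex.conj_ofReal, ← Complex.exp_conj, Complex.conj_I, smul_eq_mul,
    Complex.real_smul]
  push_cast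
  rw [show -(2 * (Real.pi : ℂ) * (inner ℝ ξ x : ℝ)) * -Complex.I =
    2 * (Real.pi : ℂ) * (inner ℝ ξ x : ℝ) * Complex.I by ring]
  ring

/-- The number of orthonormal functions which are concentrated in a given region of phase space. -/
theorem card_le_of_orthonormal {ι : Type*} {f : ι → 𝓢(Space d, ℂ)}
    (h : Orthonormal ℂ fun i => (f i).toLp 2 volume) (s : Finset ι) {R : ℝ} (hR : 0 < R)
    (hx : ∀ i ∈ s, ∫ x, ‖x‖ ^ 2 * ‖f i x‖ ^ 2 ≤ R ^ 2)
    (hξ : ∀ i ∈ s, ∫ ξ, ‖ξ‖ ^ 2 * ‖𝓕 (f i) ξ‖ ^ 2 ≤ R ^ 2) :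
    (s.card : ℝ) / 4 ≤ volume.real (Metric.closedBall (0 : Space d) (4 * R)) *
      volume.real (Metric.closedBall (0 : Space d) (8 * R)) := by
  let B := Metric.closedBall (0 : Space d) (4 * R)
  let B' := Metric.closedBall (0 : Space d) (8 * R)
  let b : ContDiffBump (0 : Space d) := ⟨4 * R, 8 * R, by positivity, by linarith⟩
  have hbt : Function.HasTemperateGrowth b := b.hasCompactSupport.hasTemperateGrowth b.contDiff
  have hb2 : MemLp b 2 volume := b.continuous.memLp_of_hasCompactSupport b.hasCompactSupport
  have hball : ∀ r, volume (Metric.closedBall (0 : Space d) r) ≠ ⊤ := fun r =>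
    (isCompact_closedBall _ _).measure_ne_top
  have hbint : ∫ ξ, b ξ ^ 2 ≤ volume.real B' := by
    have h1 : ∀ ξ, b ξ ^ 2 ≤ B'.indicator (fun _ => (1 : ℝ)) ξ := fun ξ => by
      by_cases hξ : ξ ∈ B'
      · rw [Set.indicator_of_mem hξ]
        exact pow_le_one₀ b.nonneg b.le_one
      · rw [Set.indicator_of_notMem hξ, b.zero_of_le_dist]
        · simp
        · simpa [B', b] using (not_le.1 (by simpa [B'] using hξ) : 8 * R < ‖ξ‖).le
    have h2 : Integrable (B'.indicator fun _ => (1 : ℝ)) volume :=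
      (integrable_indicator_iff Metric.isClosed_closedBall.measurableSet).2
        (integrableOn_const (hball _))
    refine (integral_mono hb2.integrable_sq h2 h1).trans (le_of_eq ?_)
    rw [integral_indicator Metric.isClosed_closedBall.measurableSet]
    simp [B']
  let Q : ι → 𝓢(Space d, ℂ) := fun i => 𝓕⁻ (SchwartzMap.smulLeftCLM ℂ b (𝓕 (f i)))
  have isq : ∀ g : 𝓢(Space d, ℂ), Integrable fun x => ‖g x‖ ^ 2 := fun g => by
    simpa using integrable_mul_norm_sq (b := fun _ => 1) (.const 1) g
  -- By Chebyshev at radius 4R, at most 1/16 of the mass of `f i` is outside `B`, and ‖f i - Q i‖² ≤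
  -- 1/16. Then 15/16 ≤ 2∫_B |Q i|² + 1/8. Summing over `i` against the pointwise Bessel bound gives
  -- the count.
  have hQ : ∀ i ∈ s, 1 / 4 ≤ ∫ x in B, ‖Q i x‖ ^ 2 := fun i hi => by
    have h1 : ∫ x, ‖f i x‖ ^ 2 = 1 := by
      rw [← pair_self, pair_self_eq_norm_sq, h.norm_eq_one]; norm_num
    have hBm : MeasurableSet B := Metric.isClosed_closedBall.measurableSet
    have h2 := integral_add_compl hBm (isq (f i))
    have iw := integrable_mul_norm_sq (normSq_hasTemperateGrowth (d := d)) (f i)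
    have h3 : ∫ x in Bᶜ, ‖f i x‖ ^ 2 ≤ 1 / 16 := by
      have h4 : ∫ x in Bᶜ, ‖f i x‖ ^ 2 ≤
          ∫ x in Bᶜ, (16 * R ^ 2)⁻¹ * (‖x‖ ^ 2 * ‖f i x‖ ^ 2) := by
        refine setIntegral_mono_on (isq _).integrableOn (iw.const_mul _).integrableOn hBm.compl
          fun x hx => ?_
        have hx' : 4 * R < ‖x‖ := not_le.1 (by simpa [B] using hx)
        rw [← mul_assoc]
        refine le_mul_of_one_le_left (sq_nonneg _) ?_
        rw [inv_mul_eq_div, one_le_div (by positivity)]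
        nlinarith
      refine h4.trans ((setIntegral_le_integral (iw.const_mul _)
        (Eventually.of_forall fun x => by positivity)).trans ?_)
      rw [integral_const_mul, inv_mul_le_iff₀ (by positivity)]
      linarith [hx i hi]
    have h5 : ∫ x, ‖(f i - Q i) x‖ ^ 2 ≤ 1 / 16 := by
      rw [← pair_self, ← integral_norm_sq_fourier_eq_pair]
      have h6 : ∀ ξ, 𝓕 (f i - Q i) ξ = (1 - b ξ : ℝ) * 𝓕 (f i) ξ := fun ξ => by
        have e1 : 𝓕 (f i - Q i) = 𝓕 (f i) - 𝓕 (Q i) :=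
          map_sub (FourierTransform.fourierEquiv ℂ 𝓢(Space d, ℂ)) _ _
        rw [e1, FourierTransform.fourier_fourierInv_eq, _root_.sub_apply,
          SchwartzMap.smulLeftCLM_apply_apply hbt, Complex.real_smul]
        push_cast
        ring
      have iw' := integrable_mul_norm_sq (normSq_hasTemperateGrowth (d := d)) (𝓕 (f i))
      have h7 : ∫ ξ, ‖𝓕 (f i - Q i) ξ‖ ^ 2 ≤
          ∫ ξ, (16 * R ^ 2)⁻¹ * (‖ξ‖ ^ 2 * ‖𝓕 (f i) ξ‖ ^ 2) := by
        refine integral_mono (isq _) (iw'.const_mul _) fun ξ => ?_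
        dsimp only
        rw [h6, norm_mul, mul_pow, ← mul_assoc, Complex.norm_real, Real.norm_eq_abs, sq_abs]
        gcongr
        rcases le_or_gt ‖ξ‖ (4 * R) with hl | hl
        · rw [b.one_of_mem_closedBall (by simpa [b] using hl)]
          simp only [sub_self, ne_eq, OfNat.ofNat_ne_zero, not_false_eq_true, zero_pow]
          positivity
        · have : (1 - b ξ) ^ 2 ≤ 1 := pow_le_one₀ (by linarith [b.le_one (x := ξ)])
            (by linarith [b.nonneg (x := ξ)])
          refine this.trans ?_
          rw [inv_mul_eq_div, one_le_div (by positivity)]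
          nlinarith
      refine h7.trans ?_
      rw [integral_const_mul, inv_mul_le_iff₀ (by positivity)]
      linarith [hξ i hi]
    have h8 : ∫ x in B, ‖f i x‖ ^ 2 ≤
        ∫ x in B, (2 * ‖Q i x‖ ^ 2 + 2 * ‖(f i - Q i) x‖ ^ 2) := by
      refine setIntegral_mono (isq _).integrableOn
        (((isq _).const_mul 2).add ((isq _).const_mul 2)).integrableOn fun x => ?_
      have e1 : f i x = Q i x + (f i - Q i) x := by rw [_root_.sub_apply]; ring
      have e2 : ‖f i x‖ ≤ ‖Q i x‖ + ‖(f i - Q i) x‖ := by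
        conv_lhs => rw [e1]
        exact norm_add_le _ _
      dsimp only
      nlinarith [norm_nonneg (f i x), sq_nonneg (‖Q i x‖ - ‖(f i - Q i) x‖)]
    rw [integral_add ((isq _).const_mul 2).integrableOn ((isq _).const_mul 2).integrableOn,
      integral_const_mul, integral_const_mul] at h8
    have h9 : ∫ x in B, ‖(f i - Q i) x‖ ^ 2 ≤ ∫ x, ‖(f i - Q i) x‖ ^ 2 :=
      setIntegral_le_integral (isq _) (Eventually.of_forall fun x => sq_nonneg _)
    linarith
  calc (s.card : ℝ) / 4 = ∑ _i ∈ s, (1 / 4 : ℝ) := by simp; ring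
    _ ≤ ∑ i ∈ s, ∫ x in B, ‖Q i x‖ ^ 2 := Finset.sum_le_sum hQ
    _ = ∫ x in B, ∑ i ∈ s, ‖Q i x‖ ^ 2 :=
      (integral_finsetSum _ fun i _ => (isq (Q i)).integrableOn).symm
    _ ≤ ∫ x in B, volume.real B' :=
      setIntegral_mono (integrable_finsetSum _ fun i _ => (isq (Q i)).integrableOn)
        (integrableOn_const (hball _)) fun x =>
        (sum_norm_sq_fourierInv_smulLeftCLM_le h s hbt hb2 x).trans hbint
    _ = volume.real B * volume.real B' := by simp [B]

/-- A polynomial bound for the eigenvalue counting function. -/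
theorem exists_index_le {V : MvPolynomial (Fin d) ℝ} (hV : IsEllipticPotential k V)
    (hk : 1 ≤ k) {f : ℕ → 𝓢(Space d, ℂ)} (h : Orthonormal ℂ fun i => (f i).toLp 2 volume)
    {lam : ℕ → ℝ} (hmono : Monotone lam) (hf : ∀ j, IsSchwartzEigenfunction V (lam j) (f j)) :
    ∃ C, 0 < C ∧ ∀ j : ℕ, (j : ℝ) + 1 ≤ C * (1 + lam j) ^ d := by
  obtain ⟨c₁, C₁, hc₁, hC₁, hb⟩ := exists_energy_bounds hV hk
  obtain ⟨c, C, hc, hC, hl⟩ := hV.exists_lower hk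
  let v := volume.real (Metric.ball (0 : Space d) 1)
  let D := (1 + C) / c + 1
  have hD : 1 ≤ D := by simp only [D]; linarith [show 0 ≤ (1 + C) / c by positivity]
  have hn : ∀ j, pair (f j) (f j) = 1 := fun j => by
    rw [pair_self_eq_norm_sq, h.norm_eq_one]; norm_num
  -- With R² = D(1+λ_j), the balls of radii 4R and 8R have volume product (32R²)^d v². `D` makes R²
  -- dominate both second moments of all φ_i with i ≤ j.
  refine ⟨4 * (32 * D) ^ d * v ^ 2 + 1, by positivity, fun j => ?_⟩
  have hlam : 0 ≤ lam j := (hb _ _ (hf j) (hn j)).1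
  have hR : 0 < √(D * (1 + lam j)) := Real.sqrt_pos.2 (by positivity)
  have hRsq : √(D * (1 + lam j)) ^ 2 = D * (1 + lam j) := Real.sq_sqrt (by positivity)
  have key := card_le_of_orthonormal h (Finset.range (j + 1)) hR (fun i hi => ?_) fun i hi => ?_
  · rw [Measure.addHaar_real_closedBall _ _ (by positivity),
      Measure.addHaar_real_closedBall _ _ (by positivity), finrank_euclideanSpace,
      Fintype.card_fin, Finset.card_range] at key
    have e1 : (4 * √(D * (1 + lam j))) ^ d * v * ((8 * √(D * (1 + lam j))) ^ d * v) =
        (32 * D) ^ d * v ^ 2 * (1 + lam j) ^ d := by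
      rw [show (4 * √(D * (1 + lam j))) ^ d * v * ((8 * √(D * (1 + lam j))) ^ d * v) =
        ((4 * √(D * (1 + lam j))) * (8 * √(D * (1 + lam j)))) ^ d * v ^ 2 by
        rw [mul_pow (4 * √(D * (1 + lam j))) (8 * √(D * (1 + lam j))) d]; ring]
      rw [show 4 * √(D * (1 + lam j)) * (8 * √(D * (1 + lam j))) = 32 * D * (1 + lam j) by
        linear_combination 32 * hRsq, mul_pow (32 * D)]
      ring
    change ((j + 1 : ℕ) : ℝ) / 4 ≤
      (4 * √(D * (1 + lam j))) ^ d * v * ((8 * √(D * (1 + lam j))) ^ d * v) at key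
    rw [e1] at key
    push_cast at key
    have : 0 ≤ (1 + lam j) ^ d := by positivity
    linarith
  · rw [hRsq]
    have hij : lam i ≤ lam j := hmono (Nat.lt_succ_iff.1 (Finset.mem_range.1 hi))
    obtain ⟨hl0, -, hP, -⟩ := hb _ _ (hf i) (hn i)
    have iV := integrable_mul_norm_sq (polyFun_hasTemperateGrowth_real V) (f i)
    have i1 : Integrable fun x => ‖f i x‖ ^ 2 := by
      simpa using integrable_mul_norm_sq (b := fun _ => 1) (.const 1) (f i)
    have h1 : ∫ x, ‖x‖ ^ 2 * ‖f i x‖ ^ 2 ≤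
        ∫ x, c⁻¹ * (polyFun V x * ‖f i x‖ ^ 2 + C * ‖f i x‖ ^ 2) := by
      refine integral_mono (integrable_mul_norm_sq normSq_hasTemperateGrowth _)
        ((iV.add (i1.const_mul C)).const_mul _) fun x => ?_
      dsimp only
      rw [← add_mul, ← mul_assoc]
      gcongr
      rw [le_inv_mul_iff₀ hc]
      have h2 : (1 + ‖x‖) ^ 2 ≤ (1 + ‖x‖) ^ (2 * k) :=
        pow_le_pow_right₀ (by linarith [norm_nonneg x]) (by omega)
      have h3 : ‖x‖ ^ 2 ≤ (1 + ‖x‖) ^ (2 * k) := by nlinarith [norm_nonneg x]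
      nlinarith [hl x]
    rw [integral_const_mul, integral_add iV (i1.const_mul C), integral_const_mul, ← pair_self,
      hn i, mul_one] at h1
    refine h1.trans ?_
    rw [inv_mul_le_iff₀ hc]
    have : c * (D * (1 + lam j)) = (1 + C + c) * (1 + lam j) := by
      simp only [D]; field_simp
    rw [this]
    nlinarith
  · rw [hRsq]
    have hij : lam i ≤ lam j := hmono (Nat.lt_succ_iff.1 (Finset.mem_range.1 hi))
    obtain ⟨hl0, hK, -⟩ := hb _ _ (hf i) (hn i)
    rw [kinetic_eq_fourier] at hK
    have hpi : 1 ≤ (2 * Real.pi) ^ 2 := one_le_pow₀ (by linarith [Real.pi_gt_three])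
    have h0 : 0 ≤ ∫ ξ, ‖ξ‖ ^ 2 * ‖𝓕 (f i) ξ‖ ^ 2 := by positivity
    nlinarith

end RandomSmoothing

/-! ### Almost sure convergence of the random series. -/

namespace RandomSmoothing

open TemperedDistribution

variable {d k : ℕ}

/-- Random variables of unit second moment grow at most linearly, almost surely. -/
theorem ae_exists_norm_le_mul {E : Type*} [NormedAddCommGroup E] {Ω : Type*} [MeasurableSpace Ω]
    {P : Measure Ω} {X : ℕ → Ω → E} (hX : ∀ j, AEStronglyMeasurable (X j) P)
    (hX_var : ∀ j, ∫ ω, ‖X j ω‖ ^ 2 ∂P = 1) :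
    ∀ᵐ ω ∂P, ∃ C : ℝ, ∀ j : ℕ, ‖X j ω‖ ≤ C * (j + 1) := by
  have hint : ∀ j, Integrable (fun ω => ‖X j ω‖ ^ 2) P := fun j => by
    by_contra h
    have := hX_var j
    rw [integral_undef h] at this
    exact zero_ne_one this
  have h1 : ∀ j, ∫⁻ ω, ENNReal.ofReal (‖X j ω‖ ^ 2 / ((j : ℝ) + 1) ^ 2) ∂P =
      ENNReal.ofReal (1 / ((j : ℝ) + 1) ^ 2) := fun j => by
    rw [← ofReal_integral_eq_lintegral_ofReal ((hint j).div_const _)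
      (Eventually.of_forall fun ω => by positivity), integral_div, hX_var]
  have hsum : Summable fun j : ℕ => 1 / ((j : ℝ) + 1) ^ 2 := by
    have := (summable_nat_add_iff 1).2 (Real.summable_one_div_nat_pow.2 one_lt_two)
    simpa using this
  have hmeas : ∀ j, AEMeasurable
      (fun ω => ENNReal.ofReal (‖X j ω‖ ^ 2 / ((j : ℝ) + 1) ^ 2)) P := fun j =>
    (((hX j).norm.aemeasurable.pow_const 2).div_const _).ennreal_ofReal
  -- The expectation of ∑ |X_j|²/(j+1)² is finite, so the sum is finite almost surely and bounds
  -- each of its terms.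
  have h2 : ∫⁻ ω, ∑' j, ENNReal.ofReal (‖X j ω‖ ^ 2 / ((j : ℝ) + 1) ^ 2) ∂P ≠ ⊤ := by
    rw [lintegral_tsum hmeas]
    simp only [h1]
    exact hsum.tsum_ofReal_ne_top
  filter_upwards [ae_lt_top' (AEMeasurable.tsum hmeas) h2] with ω hω
  let S := (∑' j, ENNReal.ofReal (‖X j ω‖ ^ 2 / ((j : ℝ) + 1) ^ 2)).toReal
  refine ⟨√S, fun j => ?_⟩
  have h3 : ‖X j ω‖ ^ 2 / ((j : ℝ) + 1) ^ 2 ≤ S := by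
    rw [← ENNReal.ofReal_le_iff_le_toReal hω.ne]
    exact ENNReal.le_tsum j
  rw [div_le_iff₀ (by positivity)] at h3
  refine le_of_sq_le_sq ?_ (by positivity)
  rwa [mul_pow, Real.sq_sqrt ENNReal.toReal_nonneg]

/-- The operator `1 - Δ + V` on Schwartz functions. -/
def oneAddSchrodinger (V : MvPolynomial (Fin d) ℝ) (g : 𝓢(Space d, ℂ)) : 𝓢(Space d, ℂ) :=
  g + (-Δ g + SchwartzMap.smulLeftCLM ℂ (cpoly V) g)

theorem apply_oneAddSchrodinger {V : MvPolynomial (Fin d) ℝ} {T : 𝓢'(Space d, ℂ)} {l : ℝ}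
    (hT : schrodinger V T = (l : ℂ) • T) (g : 𝓢(Space d, ℂ)) :
    T (oneAddSchrodinger V g) = ((1 + l : ℝ) : ℂ) * T g := by
  have h1 : (schrodinger V T) g = l * T g := by rw [hT]; rfl
  have h2 : (schrodinger V T) g = -T (Δ g) + T (SchwartzMap.smulLeftCLM ℂ (cpoly V) g) := by
    rw [← laplacian_apply_apply]; rfl
  rw [oneAddSchrodinger, map_add, map_add, map_neg, ← h2, h1]
  push_cast
  ring

theorem apply_oneAddSchrodinger_iterate {V : MvPolynomial (Fin d) ℝ} {T : 𝓢'(Space d, ℂ)} {l : ℝ}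
    (hT : schrodinger V T = (l : ℂ) • T) (m : ℕ) (g : 𝓢(Space d, ℂ)) :
    T ((oneAddSchrodinger V)^[m] g) = ((1 + l : ℝ) : ℂ) ^ m * T g := by
  induction m with
  | zero => simp
  | succ m ih => rw [Function.iterate_succ_apply', apply_oneAddSchrodinger hT, ih, pow_succ']; ring

theorem isSeriesSum_iff {φ : HilbertBasis ℕ ℂ (L2 d)} {c : ℕ → ℂ} {T : 𝓢'(Space d, ℂ)} :
    IsSeriesSum φ c T ↔ ∀ g : 𝓢(Space d, ℂ), Tendsto
      (fun n => ∑ j ∈ Finset.range n, c j * (φ j : 𝓢'(Space d, ℂ)) g) atTop (𝓝 (T g)) := by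
  rw [IsSeriesSum, PointwiseConvergenceCLM.tendsto_iff_forall_tendsto]
  refine forall_congr' fun g => ?_
  have : ∀ n, (∑ j ∈ Finset.range n, c j • (φ j : 𝓢'(Space d, ℂ))) g =
      ∑ j ∈ Finset.range n, c j * (φ j : 𝓢'(Space d, ℂ)) g := fun n => by
    rw [_root_.sum_apply]; rfl
  simp only [this]

/-- The coefficients of a convergent eigenfunction expansion are dominated by any power of the
eigenvalues. -/
theorem exists_norm_coeff_le {V : MvPolynomial (Fin d) ℝ} {φ : HilbertBasis ℕ ℂ (L2 d)}
    {lam : ℕ → ℝ} (hφ : IsEigenbasis V φ lam) {γ : ℕ → ℂ} {v : 𝓢'(Space d, ℂ)}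
    (hv : IsSeriesSum φ γ v) (hlam : ∀ j, 0 ≤ lam j) (m : ℕ) (g : 𝓢(Space d, ℂ)) :
    ∃ C, ∀ j, ‖γ j * (φ j : 𝓢'(Space d, ℂ)) g‖ * (1 + lam j) ^ m ≤ C := by
  -- Moving (1+H)^m onto φ_j produces the factor (1+λ_j)^m, and the terms of a convergent series are
  -- bounded.
  have h := isSeriesSum_iff.1 hv ((oneAddSchrodinger V)^[m] g)
  have h1 : Tendsto (fun j => γ j * (φ j : 𝓢'(Space d, ℂ)) ((oneAddSchrodinger V)^[m] g))
      atTop (𝓝 0) := by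
    have h2 := (h.comp (tendsto_add_atTop_nat 1)).sub h
    simpa [Finset.sum_range_succ, Function.comp_def] using h2
  obtain ⟨C, hC⟩ := h1.norm.bddAbove_range
  refine ⟨C, fun j => ?_⟩
  have h3 := hC ⟨j, rfl⟩
  dsimp only at h3
  rw [apply_oneAddSchrodinger_iterate (hφ.eigen j)] at h3
  refine le_trans (le_of_eq ?_) h3
  have := hlam j
  rw [norm_mul, norm_mul, norm_mul, norm_pow, Complex.norm_real, Real.norm_of_nonneg (by positivity)]
  ring

/-- Almost sure convergence of the randomized series. -/
theorem ae_exists_isSeriesSum {V : MvPolynomial (Fin d) ℝ} {φ : HilbertBasis ℕ ℂ (L2 d)}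
    {lam : ℕ → ℝ} (hφ : IsEigenbasis V φ lam) {γ : ℕ → ℂ} {v : 𝓢'(Space d, ℂ)}
    (hv : IsSeriesSum φ γ v) (hlam : ∀ j, 0 ≤ lam j)
    {A : ℝ} (hcount : ∀ j : ℕ, (j : ℝ) + 1 ≤ A * (1 + lam j) ^ d)
    {Ω : Type*} [MeasurableSpace Ω] {P : Measure Ω} {X : ℕ → Ω → ℂ}
    (hX : ∀ j, AEStronglyMeasurable (X j) P) (hX_var : ∀ j, ∫ ω, ‖X j ω‖ ^ 2 ∂P = 1) :
    ∀ᵐ ω ∂P, ∃ T : 𝓢'(Space d, ℂ), IsSeriesSum φ (fun j => γ j * X j ω) T := by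
  filter_upwards [ae_exists_norm_le_mul hX hX_var] with ω ⟨B, hB⟩
  have hB0 : 0 ≤ B := by simpa using (norm_nonneg _).trans (hB 0)
  refine TemperedDistribution.exists_tendsto_of_forall_tendsto _ fun g => ?_
  -- Since j+1 ≤ A(1+λ_j)^d, this exponent buys (j+1)³: one power for |X_j| and two for summability.
  obtain ⟨C, hC⟩ := exists_norm_coeff_le hφ hv hlam (d * 3) g
  have hC0 : 0 ≤ C := le_trans (by have := hlam 0; positivity) (hC 0)
  have hA0 : 0 ≤ A := by
    by_contra hA
    have h1 := hcount 0
    have h2 : 0 ≤ (1 + lam 0) ^ d := by have := hlam 0; positivity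
    simp only [Nat.cast_zero] at h1
    nlinarith
  have hsum : Summable fun j => γ j * X j ω * (φ j : 𝓢'(Space d, ℂ)) g := by
    have hs : Summable fun j : ℕ => B * (C * A ^ 3) * (1 / ((j : ℝ) + 1) ^ 2) := by
      have := (summable_nat_add_iff 1).2 (Real.summable_one_div_nat_pow.2 one_lt_two)
      exact (by simpa using this : Summable fun j : ℕ => 1 / ((j : ℝ) + 1) ^ 2).mul_left _
    refine Summable.of_norm_bounded hs fun j => ?_
    have hl := hlam j
    have h1 : ((j : ℝ) + 1) ^ 3 ≤ A ^ 3 * (1 + lam j) ^ (d * 3) := by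
      rw [pow_mul, ← mul_pow]
      gcongr
      exact hcount j
    have h2 : ‖γ j * (φ j : 𝓢'(Space d, ℂ)) g‖ * ((j : ℝ) + 1) ^ 3 ≤ C * A ^ 3 := by
      calc _ ≤ ‖γ j * (φ j : 𝓢'(Space d, ℂ)) g‖ * (A ^ 3 * (1 + lam j) ^ (d * 3)) := by gcongr
        _ = ‖γ j * (φ j : 𝓢'(Space d, ℂ)) g‖ * (1 + lam j) ^ (d * 3) * A ^ 3 := by ring
        _ ≤ _ := by gcongr; exact hC j
    rw [mul_right_comm, norm_mul, mul_one_div, le_div_iff₀ (by positivity)]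
    calc ‖γ j * (φ j : 𝓢'(Space d, ℂ)) g‖ * ‖X j ω‖ * ((j : ℝ) + 1) ^ 2
        ≤ ‖γ j * (φ j : 𝓢'(Space d, ℂ)) g‖ * (B * ((j : ℝ) + 1)) * ((j : ℝ) + 1) ^ 2 := by
          gcongr; exact hB j
      _ = B * (‖γ j * (φ j : 𝓢'(Space d, ℂ)) g‖ * ((j : ℝ) + 1) ^ 3) := by ring
      _ ≤ _ := by gcongr
  refine ⟨_, hsum.hasSum.tendsto_sum_nat.congr fun n => ?_⟩
  rw [_root_.sum_apply]
  rfl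

end RandomSmoothing

/-! ### From divergent coefficients to leaving L². -/

namespace RandomSmoothing

open TemperedDistribution

variable {d k : ℕ}

theorem hasSum_norm_sq_inner {H : Type*} [NormedAddCommGroup H] [InnerProductSpace ℂ H]
    (φ : HilbertBasis ℕ ℂ H) (u : H) : HasSum (fun m => ‖inner ℂ (φ m) u‖ ^ 2) (‖u‖ ^ 2) := by
  have h := lp.hasSum_norm (p := 2) (by simp) (φ.repr u)
  simpa [φ.repr_apply_apply] using h

/-- The complex conjugate of a Schwartz function. -/
def conjSchwartz (f : 𝓢(Space d, ℂ)) : 𝓢(Space d, ℂ) :=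
  SchwartzMap.postcompCLM (𝕜 := ℝ) (Complex.conjCLE : ℂ →L[ℝ] ℂ) f

/-- The duality pairing is bilinear; conjugating the test function gives the L² inner product, so
coordinates against φ_m can be read off distributions. -/
theorem coe_apply_conjSchwartz (u : L2 d) (f : 𝓢(Space d, ℂ)) :
    (u : 𝓢'(Space d, ℂ)) (conjSchwartz f) = inner ℂ (f.toLp 2 volume) u := by
  rw [Lp.toTemperedDistribution_apply, L2.inner_def]
  refine integral_congr_ae ?_
  filter_upwards [f.coeFn_toLp 2 volume] with x hx
  rw [hx, RCLike.inner_apply, mul_comm]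
  rfl

theorem isSeriesSum_map {φ : HilbertBasis ℕ ℂ (L2 d)} {c : ℕ → ℂ} {T : 𝓢'(Space d, ℂ)}
    (hT : IsSeriesSum φ c T) (A : 𝓢'(Space d, ℂ) →L[ℂ] 𝓢'(Space d, ℂ)) (g : 𝓢(Space d, ℂ)) :
    Tendsto (fun n => ∑ j ∈ Finset.range n, c j * A (φ j : 𝓢'(Space d, ℂ)) g) atTop
      (𝓝 (A T g)) := by
  have h := (A.continuous.tendsto T).comp hT
  rw [PointwiseConvergenceCLM.tendsto_iff_forall_tendsto] at h
  refine (h g).congr fun n => ?_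
  simp only [Function.comp_apply, map_sum, map_smul]
  rw [_root_.sum_apply]
  rfl

/-- If `∑ ‖γ_j A φ_j‖² = ∞`, then almost surely `A` maps the randomized series outside `L²`. -/
theorem ae_forall_not_exists_Lp {φ : HilbertBasis ℕ ℂ (L2 d)} {f : ℕ → 𝓢(Space d, ℂ)}
    (hf : ∀ j, (f j).toLp 2 volume = φ j) {𝕂 : Type*} [RCLike 𝕂] {ν : Measure 𝕂}
    (hν : ConcentrationProperty ν)
    {Ω : Type*} [MeasurableSpace Ω] {P : Measure Ω} [IsProbabilityMeasure P]
    {X : ℕ → Ω → 𝕂} (hX_law : ∀ j, HasLaw (X j) ν P) (hX_indep : iIndepFun X P)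
    (hX_mean : ∀ j, ∫ ω, X j ω ∂P = 0) (hX_var : ∀ j, ∫ ω, ‖X j ω‖ ^ 2 ∂P = 1) {γ : ℕ → ℂ}
    (A : 𝓢'(Space d, ℂ) →L[ℂ] 𝓢'(Space d, ℂ)) {G : ℕ → L2 d}
    (hG : ∀ j, A (φ j : 𝓢'(Space d, ℂ)) = (G j : 𝓢'(Space d, ℂ)))
    (hdiv : ¬ Summable fun j => ‖γ j‖ ^ 2 * ‖G j‖ ^ 2) :
    ∀ᵐ ω ∂P, ∀ T : 𝓢'(Space d, ℂ), IsSeriesSum φ (fun j => γ j * RCLike.map 𝕂 ℂ (X j ω)) T →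
      ¬ ∃ F : L2 d, A T = (F : 𝓢'(Space d, ℂ)) := by
  have hrow : ∀ j, HasSum (fun m => ‖γ j * inner ℂ (φ m) (G j)‖ ^ 2) (‖γ j‖ ^ 2 * ‖G j‖ ^ 2) :=
    fun j => by
      simpa only [norm_mul, mul_pow] using (hasSum_norm_sq_inner φ (G j)).mul_left (‖γ j‖ ^ 2)
  have hdiv' : ¬ Summable fun p : ℕ × ℕ => ‖γ p.1 * inner ℂ (φ p.2) (G p.1)‖ ^ 2 := fun h => by
    refine hdiv ?_
    have := h.prod
    exact this.congr fun j => (hrow j).tsum_eq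
  filter_upwards [hν.ae_not_summable hX_law hX_indep hX_mean hX_var
    (c := fun j m => γ j * inner ℂ (φ m) (G j)) (fun j => (hrow j).summable) hdiv'] with ω hω
  rintro T hT ⟨F, hF⟩
  refine hω (fun m => inner ℂ (φ m) F) (fun m => ?_) (hasSum_norm_sq_inner φ F).summable
  have h := isSeriesSum_map hT A (conjSchwartz (f m))
  rw [hF, coe_apply_conjSchwartz, hf] at h
  refine h.congr fun n => Finset.sum_congr rfl fun j _ => ?_
  rw [hG, coe_apply_conjSchwartz, hf]
  ring

/-- Riesz–Fischer produces both L² functions from their coefficients; uniqueness of limits of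
distributions identifies `v` with the first. -/
theorem memHk_of_summable {φ : HilbertBasis ℕ ℂ (L2 d)} {lam : ℕ → ℝ} {γ : ℕ → ℂ}
    {v : 𝓢'(Space d, ℂ)} (hv : IsSeriesSum φ γ v) {s : ℝ} (h0 : Summable fun j => ‖γ j‖ ^ 2)
    (h1 : Summable fun j =>
      ‖γ j‖ ^ 2 * (lam j ^ (((k : ℝ) + 1) / (2 * (k : ℝ)) * s)) ^ 2) :
    MemHk k φ lam s v := by
  have hmem : ∀ {a : ℕ → ℂ}, (Summable fun j => ‖a j‖ ^ 2) →
      ∃ u : L2 d, HasSum (fun j => a j • φ j) u ∧ ∀ j, inner ℂ (φ j) u = a j := fun {a} ha => by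
    have hm : Memℓp a 2 := memℓp_gen (by simpa using ha)
    refine ⟨φ.repr.symm ⟨a, hm⟩, φ.hasSum_repr_symm ⟨a, hm⟩, fun j => ?_⟩
    rw [← φ.repr_apply_apply, LinearIsometryEquiv.apply_symm_apply]
  obtain ⟨u, hu, hu'⟩ := hmem h0
  obtain ⟨w, -, hw'⟩ := hmem
    (a := fun j => ((lam j ^ (((k : ℝ) + 1) / (2 * (k : ℝ)) * s) : ℝ) : ℂ) * γ j) (by
      refine h1.congr fun j => ?_
      rw [norm_mul, mul_pow, Complex.norm_real, Real.norm_eq_abs, sq_abs, mul_comm])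
  refine ⟨u, w, ?_, fun j => by rw [hw', hu']⟩
  have h2 : Tendsto (fun n => Lp.toTemperedDistributionCLM ℂ volume 2
      (∑ j ∈ Finset.range n, γ j • φ j)) atTop (𝓝 (u : 𝓢'(Space d, ℂ))) :=
    ((Lp.toTemperedDistributionCLM ℂ (volume : Measure (Space d)) 2).continuous.tendsto u).comp
      hu.tendsto_sum_nat
  refine tendsto_nhds_unique hv (h2.congr fun n => ?_)
  rw [map_sum]
  exact Finset.sum_congr rfl fun j _ => by rw [map_smul]; rfl

/-- Divergence of `∑ ‖γ_j‖² b_j` when `b_j` dominates the weights defining `𝓗_k^s`. -/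
theorem not_summable_of_not_memHk {φ : HilbertBasis ℕ ℂ (L2 d)} {lam : ℕ → ℝ} {γ : ℕ → ℂ}
    {v : 𝓢'(Space d, ℂ)} (hk : 1 ≤ k) (hv : IsSeriesSum φ γ v) {s : ℝ} (hs : 0 ≤ s)
    (hvs : ¬ MemHk k φ lam s v) {b : ℕ → ℝ} {c L : ℝ} (hc : 0 < c) (hL : 1 ≤ L)
    (hlam : ∀ᶠ j in atTop, L ≤ lam j)
    (hb : ∀ j, L ≤ lam j → c * lam j ^ (((k : ℝ) + 1) / (k : ℝ) * s) ≤ b j) :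
    ¬ Summable fun j => ‖γ j‖ ^ 2 * b j := by
  intro hsum
  obtain ⟨J, hJ⟩ := eventually_atTop.1 hlam
  have hk0 : (0 : ℝ) < k := by exact_mod_cast hk
  have hsq : ∀ j, L ≤ lam j → (lam j ^ (((k : ℝ) + 1) / (2 * (k : ℝ)) * s)) ^ 2 =
      lam j ^ (((k : ℝ) + 1) / (k : ℝ) * s) := fun j hj => by
    rw [← Real.rpow_natCast, ← Real.rpow_mul (by linarith)]
    congr 1
    push_cast
    field_simp
  have hsum' := ((summable_nat_add_iff J).2 hsum).mul_left c⁻¹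
  -- Finitely many indices do not affect summability. For the others λ_j ≥ L ≥ 1, so the weight is
  -- at least 1 and the weighted sum controls the plain one too.
  refine hvs (memHk_of_summable hv ((summable_nat_add_iff J).1 ?_) ((summable_nat_add_iff J).1 ?_))
  · refine Summable.of_nonneg_of_le (fun j => by positivity) (fun j => ?_) hsum'
    have hj := hJ (j + J) (by omega)
    have h1 := hb _ hj
    have h2 : 1 ≤ lam (j + J) ^ (((k : ℝ) + 1) / (k : ℝ) * s) :=
      Real.one_le_rpow (hL.trans hj) (by positivity)
    rw [← mul_assoc, mul_comm c⁻¹, mul_assoc]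
    refine le_mul_of_one_le_right (sq_nonneg _) ?_
    rw [inv_mul_eq_div, one_le_div hc]
    nlinarith
  · refine Summable.of_nonneg_of_le (fun j => by positivity) (fun j => ?_) hsum'
    have hj := hJ (j + J) (by omega)
    rw [hsq _ hj, ← mul_assoc, mul_comm c⁻¹, mul_assoc]
    gcongr
    rw [inv_mul_eq_div, le_div_iff₀' hc]
    exact hb _ hj

end RandomSmoothing

/-! ### Lower bounds for the Sobolev and weighted norms of eigenfunctions. -/

namespace RandomSmoothing

open TemperedDistribution FourierTransform

variable {d k : ℕ}

theorem besselPotential_schwartz (σ : ℝ) (f : 𝓢(Space d, ℂ)) :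
    besselPotential (Space d) ℂ σ (f : 𝓢'(Space d, ℂ)) =
      (((SchwartzMap.fourierMultiplierCLM ℂ
        (fun x : Space d => (((1 + ‖x‖ ^ 2) ^ (σ / 2) : ℝ) : ℂ)) f).toLp 2 volume : L2 d) :
        𝓢'(Space d, ℂ)) := by
  rw [besselPotential, Lp.toTemperedDistribution_toLp_eq,
    fourierMultiplierCLM_toTemperedDistributionCLM_eq (by fun_prop)]

theorem norm_sq_besselPotential_schwartz (σ : ℝ) (f : 𝓢(Space d, ℂ)) :
    ‖(SchwartzMap.fourierMultiplierCLM ℂ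
      (fun x : Space d => (((1 + ‖x‖ ^ 2) ^ (σ / 2) : ℝ) : ℂ)) f).toLp 2 volume‖ ^ 2 =
      ∫ ξ, (1 + ‖ξ‖ ^ 2) ^ σ * ‖𝓕 f ξ‖ ^ 2 := by
  rw [← pair_self_eq_norm_sq, ← integral_norm_sq_fourier_eq_pair]
  refine integral_congr_ae (Eventually.of_forall fun ξ => ?_)
  have ht : Function.HasTemperateGrowth
      fun x : Space d => (((1 + ‖x‖ ^ 2) ^ (σ / 2) : ℝ) : ℂ) := by fun_prop
  simp only [SchwartzMap.fourierMultiplierCLM_apply, FourierTransform.fourier_fourierInv_eq,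
    SchwartzMap.smulLeftCLM_apply_apply ht]
  have h0 : 0 ≤ 1 + ‖ξ‖ ^ 2 := by positivity
  rw [norm_smul, Complex.norm_real, Real.norm_of_nonneg (by positivity), mul_pow,
    ← Real.rpow_natCast, ← Real.rpow_mul h0]
  congr 2
  push_cast
  ring

/-- Lower bound for the Sobolev norms of eigenfunctions. -/
theorem exists_le_norm_sq_besselPotential {V : MvPolynomial (Fin d) ℝ}
    (hV : IsEllipticPotential k V) (hk : 1 ≤ k) {σ : ℝ} (hσ : 0 ≤ σ) :
    ∃ c L : ℝ, 0 < c ∧ 1 ≤ L ∧ ∀ (l : ℝ) (f : 𝓢(Space d, ℂ)),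
      IsSchwartzEigenfunction V l f → pair f f = 1 → L ≤ l →
      c * l ^ σ ≤ ‖(SchwartzMap.fourierMultiplierCLM ℂ
        (fun x : Space d => (((1 + ‖x‖ ^ 2) ^ (σ / 2) : ℝ) : ℂ)) f).toLp 2 volume‖ ^ 2 := by
  obtain ⟨c, m, L, hc, hm, hL, h⟩ := exists_le_fourier_mass hV hk
  refine ⟨c ^ σ * m, L, by positivity, hL, fun l f hf h1 hl => ?_⟩
  have hl0 : 0 ≤ l := by linarith
  rw [norm_sq_besselPotential_schwartz]
  have ht : Function.HasTemperateGrowth fun x : Space d => (1 + ‖x‖ ^ 2) ^ σ :=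
    Function.hasTemperateGrowth_one_add_norm_sq_rpow (Space d) σ
  have i0 : Integrable fun ξ => ‖𝓕 f ξ‖ ^ 2 := by
    simpa using integrable_mul_norm_sq (b := fun _ => 1) (.const 1) (𝓕 f)
  have i1 := integrable_mul_norm_sq ht (𝓕 f)
  have hS : MeasurableSet {ξ : Space d | c * l ≤ ‖ξ‖ ^ 2} :=
    measurableSet_le measurable_const (by fun_prop)
  calc c ^ σ * m * l ^ σ = (c * l) ^ σ * m := by rw [Real.mul_rpow hc.le hl0]; ring
    _ ≤ (c * l) ^ σ * ∫ ξ in {ξ | c * l ≤ ‖ξ‖ ^ 2}, ‖𝓕 f ξ‖ ^ 2 := by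
      gcongr; exact h l f hf h1 hl
    _ = ∫ ξ in {ξ | c * l ≤ ‖ξ‖ ^ 2}, (c * l) ^ σ * ‖𝓕 f ξ‖ ^ 2 :=
      (integral_const_mul _ _).symm
    _ ≤ ∫ ξ in {ξ | c * l ≤ ‖ξ‖ ^ 2}, (1 + ‖ξ‖ ^ 2) ^ σ * ‖𝓕 f ξ‖ ^ 2 := by
      refine setIntegral_mono_on (i0.const_mul _).integrableOn i1.integrableOn hS fun ξ hξ => ?_
      have hξ : c * l ≤ ‖ξ‖ ^ 2 := hξ
      gcongr
      linarith
    _ ≤ _ := setIntegral_le_integral i1 (Eventually.of_forall fun ξ => by positivity)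

/-- A smooth substitute for the weight `|x| ^ (a / 2)`. -/
def smoothWeight (a : ℝ) (x : Space d) : ℝ :=
  -- |x|^(a/2) need not be smooth at 0 and so may not multiply distributions. The high-order zero at
  -- the origin keeps this smooth function below |x|^(a/2) for a ≥ 0; both have the same size at
  -- infinity.
  (‖x‖ ^ 2) ^ (⌈a⌉₊) * (1 + ‖x‖ ^ 2) ^ (a / 4 - ⌈a⌉₊)

theorem smoothWeight_hasTemperateGrowth (a : ℝ) :
    (smoothWeight (d := d) a).HasTemperateGrowth :=
  (normSq_hasTemperateGrowth.pow _).mul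
    (Function.hasTemperateGrowth_one_add_norm_sq_rpow (Space d) _)

theorem smoothWeight_sq (a : ℝ) (x : Space d) : smoothWeight a x ^ 2 =
    (‖x‖ ^ 2 / (1 + ‖x‖ ^ 2)) ^ (2 * ⌈a⌉₊) * (1 + ‖x‖ ^ 2) ^ (a / 2) := by
  have h0 : 0 < 1 + ‖x‖ ^ 2 := by positivity
  rw [smoothWeight, mul_pow, Real.rpow_sub h0, div_pow, div_pow, Real.rpow_natCast, ← pow_mul,
    ← pow_mul, ← Real.rpow_natCast (_ ^ (a / 4)), ← Real.rpow_mul h0.le, mul_comm ⌈a⌉₊ 2]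
  rw [show a / 4 * ((2 : ℕ) : ℝ) = a / 2 by push_cast; ring]
  ring

theorem smoothWeight_sq_le {a : ℝ} (ha : 0 ≤ a) (x : Space d) :
    smoothWeight a x ^ 2 ≤ ‖x‖ ^ a := by
  have h0 : 0 < 1 + ‖x‖ ^ 2 := by positivity
  have hx : ‖x‖ ^ a = (‖x‖ ^ 2 / (1 + ‖x‖ ^ 2)) ^ (a / 2) * (1 + ‖x‖ ^ 2) ^ (a / 2) := by
    rw [← Real.mul_rpow (by positivity) h0.le, div_mul_cancel₀ _ h0.ne', ← Real.rpow_natCast,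
      ← Real.rpow_mul (norm_nonneg x)]
    congr 1
    push_cast
    ring
  rw [smoothWeight_sq, hx]
  gcongr
  rw [← Real.rpow_natCast]
  refine Real.rpow_le_rpow_of_exponent_ge' (by positivity) ?_ (by positivity) ?_
  · rw [div_le_one h0]; linarith
  · push_cast
    linarith [Nat.le_ceil a]

theorem le_smoothWeight_sq (a : ℝ) {x : Space d} (hx : 1 ≤ ‖x‖) :
    (1 / 2) ^ (2 * ⌈a⌉₊) * (1 + ‖x‖ ^ 2) ^ (a / 2) ≤ smoothWeight a x ^ 2 := by
  have h1 : (1 / 2 : ℝ) ≤ ‖x‖ ^ 2 / (1 + ‖x‖ ^ 2) := by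
    rw [div_le_div_iff₀ (by norm_num) (by positivity)]
    nlinarith
  rw [smoothWeight_sq]
  exact mul_le_mul_of_nonneg_right (pow_le_pow_left₀ (by norm_num) h1 _) (by positivity)

/-- Lower bound for the weighted norms of eigenfunctions. -/
theorem exists_le_norm_sq_smoothWeight {V : MvPolynomial (Fin d) ℝ}
    (hV : IsEllipticPotential k V) (hk : 1 ≤ k) {a : ℝ} (ha : 0 ≤ a) :
    ∃ c L : ℝ, 0 < c ∧ 1 ≤ L ∧ ∀ (l : ℝ) (f : 𝓢(Space d, ℂ)),
      IsSchwartzEigenfunction V l f → pair f f = 1 → L ≤ l →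
      c * l ^ (a / (2 * k)) ≤
        ‖(SchwartzMap.smulLeftCLM ℂ (smoothWeight a) f).toLp 2 volume‖ ^ 2 := by
  obtain ⟨c, m, L, hc, hm, hL, h⟩ := exists_le_mass hV hk
  have hk0 : (0 : ℝ) < k := by exact_mod_cast hk
  -- The threshold 4^k/c forces |x| ≥ 1 on the region carrying the mass; the powers of 1/2 come from
  -- |x|²/(1+|x|²) ≥ 1/2 there and from (1+|x|)² ≤ 2(1+|x|²).
  refine ⟨(1 / 2) ^ (2 * ⌈a⌉₊) * (1 / 2) ^ (a / 2) * c ^ (a / (2 * k)) * m, max L (4 ^ k / c),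
    by positivity, hL.trans (le_max_left _ _), fun l f hf h1 hl => ?_⟩
  have hl1 : L ≤ l := (le_max_left _ _).trans hl
  have hl2 : 4 ^ k ≤ c * l := by
    have := (le_max_right _ _).trans hl
    rwa [div_le_iff₀' hc] at this
  have hl0 : 0 ≤ l := by linarith
  have ht := smoothWeight_hasTemperateGrowth (d := d) a
  rw [← pair_self_eq_norm_sq, pair_self]
  simp only [SchwartzMap.smulLeftCLM_apply_apply ht, norm_smul, mul_pow, Real.norm_eq_abs, sq_abs]
  have i0 : Integrable fun ξ => ‖f ξ‖ ^ 2 := by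
    simpa using integrable_mul_norm_sq (b := fun _ => 1) (.const 1) f
  have i1 := integrable_mul_norm_sq (ht.pow 2) f
  have hS : MeasurableSet {x : Space d | c * l ≤ (1 + ‖x‖) ^ (2 * k)} :=
    measurableSet_le measurable_const (by fun_prop)
  let K : ℝ := (1 / 2) ^ (2 * ⌈a⌉₊) * (1 / 2) ^ (a / 2) * (c * l) ^ (a / (2 * k))
  have hK : 0 ≤ K := by positivity
  calc (1 / 2) ^ (2 * ⌈a⌉₊) * (1 / 2) ^ (a / 2) * c ^ (a / (2 * k)) * m * l ^ (a / (2 * k))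
      = K * m := by simp only [K]; rw [Real.mul_rpow hc.le hl0]; ring
    _ ≤ K * ∫ x in {x | c * l ≤ (1 + ‖x‖) ^ (2 * k)}, ‖f x‖ ^ 2 := by
      gcongr; exact h l f hf h1 hl1
    _ = ∫ x in {x | c * l ≤ (1 + ‖x‖) ^ (2 * k)}, K * ‖f x‖ ^ 2 := (integral_const_mul _ _).symm
    _ ≤ ∫ x in {x | c * l ≤ (1 + ‖x‖) ^ (2 * k)}, smoothWeight a x ^ 2 * ‖f x‖ ^ 2 := by
      refine setIntegral_mono_on (i0.const_mul _).integrableOn i1.integrableOn hS fun x hx => ?_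
      have hx : c * l ≤ (1 + ‖x‖) ^ (2 * k) := hx
      have hx1 : 1 ≤ ‖x‖ := by
        by_contra! hlt
        have : (1 + ‖x‖) ^ (2 * k) < 2 ^ (2 * k) :=
          pow_lt_pow_left₀ (by linarith) (by positivity) (by omega)
        rw [pow_mul 2 2 k] at this
        norm_num at this
        linarith
      gcongr
      refine le_trans ?_ (le_smoothWeight_sq a hx1)
      simp only [K]
      rw [mul_assoc]
      gcongr
      have h2 : (c * l) ^ (a / (2 * k)) ≤ ((1 + ‖x‖) ^ 2) ^ (a / 2) := by
        calc (c * l) ^ (a / (2 * k)) ≤ ((1 + ‖x‖) ^ (2 * k)) ^ (a / (2 * k)) := by gcongr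
          _ = ((1 + ‖x‖) ^ 2) ^ (a / 2) := by
            rw [pow_mul, ← Real.rpow_natCast _ k, ← Real.rpow_mul (by positivity)]
            congr 1
            field_simp
      calc (1 / 2) ^ (a / 2) * (c * l) ^ (a / (2 * k))
          ≤ (1 / 2) ^ (a / 2) * ((1 + ‖x‖) ^ 2) ^ (a / 2) := by gcongr
        _ = (1 / 2 * (1 + ‖x‖) ^ 2) ^ (a / 2) := (Real.mul_rpow (by norm_num) (by positivity)).symm
        _ ≤ (1 + ‖x‖ ^ 2) ^ (a / 2) := by
          gcongr
          nlinarith [sq_nonneg (‖x‖ - 1)]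
    _ ≤ _ := setIntegral_le_integral i1 (Eventually.of_forall fun x => by positivity)

theorem MemWeightedL2.exists_Lp {a : ℝ} (ha : 0 ≤ a) {T : 𝓢'(Space d, ℂ)} (hT : MemWeightedL2 a T) :
    ∃ F : L2 d, smulLeftCLM ℂ (fun x => (smoothWeight a x : ℂ)) T = (F : 𝓢'(Space d, ℂ)) := by
  obtain ⟨f, hfm, hf, hint⟩ := hT
  have ht : Function.HasTemperateGrowth fun x : Space d => (smoothWeight a x : ℂ) :=
    Complex.ofRealCLM.hasTemperateGrowth.comp (smoothWeight_hasTemperateGrowth a)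
  have hm : AEStronglyMeasurable (fun x => (smoothWeight a x : ℂ) * f x) volume :=
    ht.1.continuous.aestronglyMeasurable.mul hfm
  have hmem : MemLp (fun x => (smoothWeight a x : ℂ) * f x) 2 volume := by
    rw [memLp_two_iff_integrable_sq_norm hm]
    refine hint.mono' (hm.norm.pow 2) (Eventually.of_forall fun x => ?_)
    rw [Real.norm_of_nonneg (by positivity), norm_mul, mul_pow, Complex.norm_real,
      Real.norm_eq_abs, sq_abs, mul_comm]
    gcongr
    exact smoothWeight_sq_le ha x
  refine ⟨hmem.toLp _, ?_⟩
  ext g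
  rw [smulLeftCLM_apply_apply, (hf _).2, Lp.toTemperedDistribution_apply]
  refine integral_congr_ae ?_
  filter_upwards [hmem.coeFn_toLp] with x hx
  rw [hx, SchwartzMap.smulLeftCLM_apply_apply ht]
  simp only [smul_eq_mul]
  ring

end RandomSmoothing

/-! ### Conclusion. -/

theorem theorem3 {d k : ℕ} (hd : 2 ≤ d) (hk : 1 ≤ k)
    (V : MvPolynomial (Fin d) ℝ) (hV : RandomSmoothing.IsEllipticPotential k V)
    (φ : HilbertBasis ℕ ℂ (RandomSmoothing.L2 d)) (lam : ℕ → ℝ)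
    (hφ : RandomSmoothing.IsEigenbasis V φ lam)
    {𝕂 : Type*} [RCLike 𝕂] (ν : Measure 𝕂) [IsProbabilityMeasure ν]
    (hν : RandomSmoothing.ConcentrationProperty ν)
    {Ω : Type*} [MeasurableSpace Ω] (P : Measure Ω) [IsProbabilityMeasure P]
    (X : ℕ → Ω → 𝕂) (hX_law : ∀ j, HasLaw (X j) ν P) (hX_indep : iIndepFun X P)
    (hX_mean : ∀ j, ∫ ω, X j ω ∂P = 0) (hX_var : ∀ j, ∫ ω, ‖X j ω‖ ^ 2 ∂P = 1)
    (γ : ℕ → ℂ) (v : 𝓢'(RandomSmoothing.Space d, ℂ)) (hv : RandomSmoothing.IsSeriesSum φ γ v)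
    (s : ℝ) (hs : 0 ≤ s) (hvs : ¬ RandomSmoothing.MemHk k φ lam s v) :
    ∀ᵐ ω ∂P, ∃ vω : 𝓢'(RandomSmoothing.Space d, ℂ),
      RandomSmoothing.IsSeriesSum φ (fun j => γ j * RCLike.map 𝕂 ℂ (X j ω)) vω ∧
      ¬ TemperedDistribution.MemSobolev (((k : ℝ) + 1) / (k : ℝ) * s) 2 vω ∧
      ¬ RandomSmoothing.MemWeightedL2 (2 * (((k : ℝ) + 1) * s)) vω := by
  open RandomSmoothing in
  choose f hf using fun j => exists_schwartz_eigenfunction hV hk (hφ.eigen j)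
  have hfe : ∀ j, IsSchwartzEigenfunction V (lam j) (f j) := fun j =>
    isSchwartzEigenfunction_of_toLp (hφ.eigen j) (hf j)
  have hon : Orthonormal ℂ fun j => (f j).toLp 2 volume := by
    simpa only [hf] using φ.orthonormal
  have hn : ∀ j, pair (f j) (f j) = 1 := fun j => by
    rw [pair_self_eq_norm_sq, hon.norm_eq_one]; norm_num
  have hlam0 : ∀ j, 0 ≤ lam j := fun j => by
    obtain ⟨c, C, -, -, h⟩ := exists_energy_bounds hV hk
    exact (h _ _ (hfe j) (hn j)).1
  obtain ⟨A, hA, hcount⟩ := exists_index_le hV hk hon hφ.mono hfe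
  -- The counting bound forces the eigenvalues to infinity.
  have hlam : ∀ L : ℝ, ∀ᶠ j in atTop, L ≤ lam j := fun L => by
    obtain ⟨N, hN⟩ := exists_nat_ge (A * (1 + L) ^ d)
    filter_upwards [eventually_ge_atTop N] with j hj
    by_contra! hlt
    have h1 : A * (1 + lam j) ^ d ≤ A * (1 + L) ^ d := by
      have := hlam0 j
      gcongr
    have h2 : (N : ℝ) ≤ j := by exact_mod_cast hj
    linarith [hcount j]
  have hcoe : ∀ j, (φ j : 𝓢'(Space d, ℂ)) = (f j : 𝓢'(Space d, ℂ)) := fun j => by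
    rw [← hf j, Lp.toTemperedDistribution_toLp_eq]
  have hk0 : (0 : ℝ) < k := by exact_mod_cast hk
  have hXc : ∀ j, AEStronglyMeasurable (fun ω => RCLike.map 𝕂 ℂ (X j ω)) P := fun j =>
    (RCLike.map 𝕂 ℂ).continuous.comp_aestronglyMeasurable
      (hX_law j).aemeasurable.aestronglyMeasurable
  obtain ⟨c₁, L₁, hc₁, hL₁, hb₁⟩ := exists_le_norm_sq_besselPotential hV hk
    (σ := ((k : ℝ) + 1) / (k : ℝ) * s) (by positivity)
  obtain ⟨c₂, L₂, hc₂, hL₂, hb₂⟩ := exists_le_norm_sq_smoothWeight hV hk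
    (a := 2 * (((k : ℝ) + 1) * s)) (by positivity)
  -- Position scales as λ^(1/(2k)) and frequency as λ^(1/2), so both norms grow with the same power
  -- of λ, the one defining 𝓗_k^s.
  have hexp : 2 * (((k : ℝ) + 1) * s) / (2 * k) = ((k : ℝ) + 1) / (k : ℝ) * s := by field_simp
  rw [hexp] at hb₂
  have hSob := ae_forall_not_exists_Lp hf hν hX_law hX_indep hX_mean hX_var (γ := γ)
    (TemperedDistribution.besselPotential (Space d) ℂ (((k : ℝ) + 1) / (k : ℝ) * s))
    (fun j => by rw [hcoe, besselPotential_schwartz])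
    (not_summable_of_not_memHk hk hv hs hvs hc₁ hL₁ (hlam L₁) fun j hj =>
      hb₁ _ _ (hfe j) (hn j) hj)
  have hWei := ae_forall_not_exists_Lp hf hν hX_law hX_indep hX_mean hX_var (γ := γ)
    (TemperedDistribution.smulLeftCLM ℂ
      (fun x : Space d => (smoothWeight (2 * (((k : ℝ) + 1) * s)) x : ℂ)))
    (fun j => by
      rw [hcoe, smulLeftCLM_ofReal (smoothWeight_hasTemperateGrowth _),
        ← Lp.toTemperedDistribution_toLp_eq (p := 2)])
    (not_summable_of_not_memHk hk hv hs hvs hc₂ hL₂ (hlam L₂) fun j hj =>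
      hb₂ _ _ (hfe j) (hn j) hj)
  filter_upwards [ae_exists_isSeriesSum hφ hv hlam0 hcount hXc
    (by simpa only [norm_map_complex] using hX_var), hSob, hWei] with ω ⟨T, hT⟩ h1 h2
  exact ⟨T, hT, fun h => h1 T hT h, fun h => h2 T hT (h.exists_Lp (by positivity))⟩

end
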